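/- Let $n\ge 1$ and $h_0>0$. For an open set $S\subset\mathbb{R}^n$ and $m\in\mathbb{N}_0$, $W^m(S)$ is the space of (real- or complex-valued) $u\in L^2(S)$ with weak derivatives $D^\alpha u\in L^2(S)$ for all $|\alpha|\le m$, with $|u|_{W^j(S)}=\big(\sum_{|\alpha|=j}\|D^\alpha u\|_{L^2(S)}^2\big)^{1/2}$ and $\|u\|_{W^m(S)}=\big(\sum_{j=0}^m|u|_{W^j(S)}^2\big)^{1/2}$; $\mathcal{P}_p(S)$ is the set of polynomials on $S$ of total degree at most $p$. Let $\Omega\subset\mathbb{R}^n$ be a non-empty open set and let $\mathcal{T}$ be a mesh of $\Omega$, that is, a countable collection of non-empty, bounded, pairwise disjoint open subsets of $\Omega$ with $|\Omega\setminus\bigcup_{K\in\mathcal{T}}K|=0$. Let $\mathcal{T}^\#$ be a covering of $\mathcal{T}$, that is, a set of (non-degenerate) open simplices or open cubes such that each $K\in\mathcal{T}$ is contained in some $\mathcal{K}\in\mathcal{T}^\#$, and let $\kappa:\mathcal{T}\to\mathcal{T}^\#$ satisfy $K\subset\kappa(K)$ for all $K\in\mathcal{T}$. Write $h_{\mathcal{K}}=\operatorname{diam}(\mathcal{K})$,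 and suppose $h_{\mathcal{K}}\le h_0$ for each $\mathcal{K}\in\mathcal{T}^\#$. Let $u\in L^2(\Omega)$ and suppose that for each $\mathcal{K}\in\mathcal{T}^\#$ there are $m_{\mathcal{K}}\in\mathbb{N}_0$ and $U_{\mathcal{K}}\in W^{m_{\mathcal{K}}}(\mathcal{K})$ with $U_{\mathcal{K}}|_K=u|_K$ for each $K\in\kappa^{-1}(\mathcal{K})$. Then for each $\mathcal{K}\in\mathcal{T}^\#$ and each $p\in\mathbb{N}_0$ there is a linear operator $\pi_{p,m_{\mathcal{K}},\mathcal{K}}:W^{m_{\mathcal{K}}}(\mathcal{K})\to\mathcal{P}_p(\mathcal{K})$, depending only on $n$, $h_0$, $p$, $m_{\mathcal{K}}$ and $\mathcal{K}$ (and not on $\Omega,\mathcal{T},\mathcal{T}^\#,\kappa,u$), such that, with $t_{\mathcal{K}}:=\min(m_{\mathcal{K}},p+1)$ and for all $j=0,1,\dots,m_{\mathcal{K}}$, $$\Bigg(\sum_{K\in\kappa^{-1}(\mathcal{K})}\big\|u-\pi_{p,m_{\mathcal{K}},\mathcal{K}}(U_{\mathcal{K}})\big\|_{W^j(K)}^2\Bigg)^{1/2}\le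 C\,\frac{h_{\mathcal{K}}^{\,t_{\mathcal{K}}-j}}{(p+1)^{m_{\mathcal{K}}-j}}\sum_{r=t_{\mathcal{K}}}^{m_{\mathcal{K}}}|U_{\mathcal{K}}|_{W^r(\mathcal{K})}.$$ Here $C=C(n,h_0,m_{\mathcal{K}},\sigma_{\mathcal{K}})>0$ depends only on $n$, $h_0$, $m_{\mathcal{K}}$ and the shape regularity $\sigma_{\mathcal{K}}$ of $\mathcal{K}$ (the ratio of its diameter to its inradius), and it is non-decreasing in $\sigma_{\mathcal{K}}$, so it is uniform over shape-regular families. -/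

import Mathlib

open MeasureTheory Set
open scoped ENNReal ContDiff

namespace CoverApprox

/-- Euclidean space `ℝⁿ`. -/
abbrev E (n : ℕ) : Type := EuclideanSpace ℝ (Fin n)

/-! ### Weak derivatives and Sobolev spaces -/

/-- The classical partial derivative `∂φ/∂xᵢ`. -/
noncomputable def partialDeriv {n : ℕ} (i : Fin n) (φ : E n → ℝ) : E n → ℝ :=
  fun x => fderiv ℝ φ x (EuclideanSpace.single i 1)

/-- The classical derivative `D^α φ = ∂₁^{α₁} ⋯ ∂ₙ^{αₙ} φ` for a multi-index `α`
(used for smooth `φ` only). -/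
noncomputable def multiDeriv {n : ℕ} (α : Fin n → ℕ) (φ : E n → ℝ) : E n → ℝ :=
  (List.finRange n).foldr (fun i ψ => (partialDeriv i)^[α i] ψ) φ

/-- `φ ∈ C₀^∞(S)`. -/
structure IsTestFunction {n : ℕ} (S : Set (E n)) (φ : E n → ℝ) : Prop where
  smooth : ContDiff ℝ ∞ φ
  compact : HasCompactSupport φ
  support : tsupport φ ⊆ S

variable {𝕜 : Type*} [RCLike 𝕜]

/-- `g` is the weak derivative `D^α f` on the open set `S`. -/
structure HasWeakDeriv {n : ℕ} (α : Fin n → ℕ) (S : Set (E n)) (f g : E n → 𝕜) : Prop where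
  locInt : LocallyIntegrableOn f S
  locInt_deriv : LocallyIntegrableOn g S
  integral_eq : ∀ φ : E n → ℝ, IsTestFunction S φ →
    ∫ x in S, multiDeriv α φ x • f x = (-1 : ℝ) ^ (∑ i, α i) • ∫ x in S, φ x • g x

/-- The seminorm `|f|_{W^j(S)} = (∑_{|α| = j} ‖D^α f‖²_{L²(S)})^{1/2}` with values in `[0, ∞]`.
The weak derivative is unique up to null sets, so the infimum is its `L²(S)` norm, and it is `∞` if
the weak derivative does not exist. -/
noncomputable def sobolevSeminorm {n : ℕ} (j : ℕ) (S : Set (E n)) (f : E n → 𝕜) : ℝ≥0∞ :=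
  (∑ α ∈ Finset.piAntidiag (Finset.univ : Finset (Fin n)) j,
    (⨅ (g : E n → 𝕜) (_ : HasWeakDeriv α S f g), eLpNorm g 2 (volume.restrict S)) ^ 2) ^ (1 / 2 : ℝ)

/-- The norm `‖f‖_{W^m(S)} = (∑_{j ≤ m} |f|²_{W^j(S)})^{1/2}` with values in `[0, ∞]`. -/
noncomputable def sobolevNorm {n : ℕ} (m : ℕ) (S : Set (E n)) (f : E n → 𝕜) : ℝ≥0∞ :=
  (∑ j ∈ Finset.range (m + 1), sobolevSeminorm j S f ^ 2) ^ (1 / 2 : ℝ)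

section closure

lemma contDiff_partialDeriv {n : ℕ} (i : Fin n) {φ : E n → ℝ} (h : ContDiff ℝ ∞ φ) :
    ContDiff ℝ ∞ (partialDeriv i φ) :=
  (h.fderiv_right (m := ∞) (by simp)).clm_apply contDiff_const

lemma tsupport_partialDeriv {n : ℕ} (i : Fin n) (φ : E n → ℝ) :
    tsupport (partialDeriv i φ) ⊆ tsupport φ := by
  refine (closure_minimal ?_ (isClosed_tsupport φ))
  intro x hx
  by_contra hn
  apply hx
  have : fderiv ℝ φ x = 0 := by
    by_contra h0
    exact hn (support_fderiv_subset ℝ h0)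
  simp [partialDeriv, this]

lemma isTestFunction_partialDeriv {n : ℕ} {S : Set (E n)} (i : Fin n) {φ : E n → ℝ}
    (h : IsTestFunction S φ) : IsTestFunction S (partialDeriv i φ) :=
  ⟨contDiff_partialDeriv i h.smooth,
    h.compact.of_isClosed_subset (isClosed_tsupport _) (tsupport_partialDeriv i φ),
    (tsupport_partialDeriv i φ).trans h.support⟩

lemma isTestFunction_multiDeriv {n : ℕ} {S : Set (E n)} (α : Fin n → ℕ) {φ : E n → ℝ}
    (h : IsTestFunction S φ) : IsTestFunction S (multiDeriv α φ) := by
  unfold multiDeriv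
  induction List.finRange n with
  | nil => exact h
  | cons i l ih =>
    simp only [List.foldr_cons]
    generalize α i = k
    induction k with
    | zero => exact ih
    | succ k ihk =>
      rw [Function.iterate_succ_apply']
      exact isTestFunction_partialDeriv i ihk

lemma integrableOn_test_smul {n : ℕ} {S : Set (E n)} {φ : E n → ℝ} (h : IsTestFunction S φ)
    {f : E n → 𝕜} (hf : LocallyIntegrableOn f S) :
    Integrable (fun x => φ x • f x) (volume.restrict S) := by
  have h1 : IntegrableOn (fun x => φ x • f x) (tsupport φ) := by
    refine IntegrableOn.continuousOn_smul (hf.integrableOn_compact_subset h.support h.compact)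
      h.smooth.continuous.continuousOn h.compact
  have h2 : Integrable (fun x => φ x • f x) volume := by
    rw [← integrableOn_iff_integrable_of_support_subset (s := tsupport φ)]
    · exact h1
    · intro x hx
      apply subset_tsupport
      intro h0
      apply hx
      simp [h0]
  exact h2.integrableOn

lemma hasWeakDeriv_congr {n : ℕ} {α : Fin n → ℕ} {S : Set (E n)}
    {f f' g : E n → 𝕜} (hff : f =ᵐ[volume.restrict S] f') (h : HasWeakDeriv α S f g) :
    HasWeakDeriv α S f' g := by
  refine ⟨?_, h.locInt_deriv, fun φ hφ => ?_⟩
  · intro x hx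
    obtain ⟨s, hs, hi⟩ := h.locInt x hx
    refine ⟨s ∩ S, Filter.inter_mem hs self_mem_nhdsWithin, ?_⟩
    refine (hi.mono_set inter_subset_left).congr_fun_ae ?_
    exact ae_mono (Measure.restrict_mono inter_subset_right le_rfl) hff
  · rw [← h.integral_eq φ hφ]
    refine integral_congr_ae ?_
    filter_upwards [hff] with x hx
    rw [hx]

lemma hasWeakDeriv_zero {n : ℕ} (α : Fin n → ℕ) (S : Set (E n)) :
    HasWeakDeriv α S (fun _ => (0 : 𝕜)) (fun _ => 0) :=
  ⟨(locallyIntegrable_zero).locallyIntegrableOn S, (locallyIntegrable_zero).locallyIntegrableOn S,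
    fun φ _ => by simp⟩

lemma HasWeakDeriv.add {n : ℕ} {α : Fin n → ℕ} {S : Set (E n)} {f g f' g' : E n → 𝕜}
    (h : HasWeakDeriv α S f g) (h' : HasWeakDeriv α S f' g') :
    HasWeakDeriv α S (f + f') (g + g') := by
  refine ⟨h.locInt.add h'.locInt, h.locInt_deriv.add h'.locInt_deriv, fun φ hφ => ?_⟩
  have hφ' := isTestFunction_multiDeriv α hφ
  simp only [Pi.add_apply, smul_add]
  rw [integral_add (integrableOn_test_smul hφ' h.locInt) (integrableOn_test_smul hφ' h'.locInt),
    integral_add (integrableOn_test_smul hφ h.locInt_deriv)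
      (integrableOn_test_smul hφ h'.locInt_deriv),
    smul_add, h.integral_eq φ hφ, h'.integral_eq φ hφ]

lemma HasWeakDeriv.smul {n : ℕ} {α : Fin n → ℕ} {S : Set (E n)} {f g : E n → 𝕜}
    (c : 𝕜) (h : HasWeakDeriv α S f g) : HasWeakDeriv α S (c • f) (c • g) := by
  refine ⟨?_, ?_, fun φ hφ => ?_⟩
  · intro x hx
    obtain ⟨s, hs, hi⟩ := h.locInt x hx
    exact ⟨s, hs, hi.smul c⟩
  · intro x hx
    obtain ⟨s, hs, hi⟩ := h.locInt_deriv x hx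
    exact ⟨s, hs, hi.smul c⟩
  · have := h.integral_eq φ hφ
    simp only [Pi.smul_apply]
    simp_rw [smul_comm _ c]
    rw [integral_smul, integral_smul, this, smul_comm]

end closure

/-- The Sobolev space `W^m(S)`, `S` open: the `f ∈ L²(S)` that have, for every `|α| ≤ m`, a weak
derivative `D^α f ∈ L²(S)`. -/
noncomputable def SobolevSpace (𝕜 : Type*) [RCLike 𝕜] {n : ℕ} (m : ℕ) (S : Set (E n)) :
    Submodule 𝕜 (Lp 𝕜 2 (volume.restrict S)) where
  carrier := {f | ∀ α : Fin n → ℕ, ∑ i, α i ≤ m →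
    ∃ g : E n → 𝕜, HasWeakDeriv α S f g ∧ MemLp g 2 (volume.restrict S)}
  zero_mem' := fun α _ => ⟨fun _ => 0,
    hasWeakDeriv_congr (Lp.coeFn_zero 𝕜 2 (volume.restrict S)).symm (hasWeakDeriv_zero α S),
    MemLp.zero⟩
  add_mem' := by
    intro a b ha hb α hα
    obtain ⟨g, hg, hg2⟩ := ha α hα
    obtain ⟨k, hk, hk2⟩ := hb α hα
    exact ⟨g + k, hasWeakDeriv_congr (Lp.coeFn_add a b).symm (hg.add hk), hg2.add hk2⟩
  smul_mem' := by
    intro c a ha α hα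
    obtain ⟨g, hg, hg2⟩ := ha α hα
    exact ⟨c • g, hasWeakDeriv_congr (Lp.coeFn_smul c a).symm (hg.smul c), hg2.const_smul c⟩

/-! ### Polynomials -/

/-- `P_p`: polynomials in `n` variables of total degree at most `p`. -/
noncomputable abbrev PolySpace (𝕜 : Type*) [RCLike 𝕜] (n p : ℕ) : Submodule 𝕜 (MvPolynomial (Fin n) 𝕜) :=
  MvPolynomial.restrictTotalDegree (Fin n) 𝕜 p

/-- The function on `ℝⁿ` given by a polynomial. -/
noncomputable def polyFun {n : ℕ} (P : MvPolynomial (Fin n) 𝕜) : E n → 𝕜 :=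
  fun x => MvPolynomial.eval (fun i => ((x i : ℝ) : 𝕜)) P

/-! ### Meshes and coverings -/

/-- A mesh of `Ω`: a countable family of non-empty bounded open subsets of `Ω`, pairwise disjoint,
which cover `Ω` up to a null set. -/
structure IsMesh {n : ℕ} (Ω : Set (E n)) (T : Set (Set (E n))) : Prop where
  countable : T.Countable
  nonempty : ∀ K ∈ T, K.Nonempty
  bounded : ∀ K ∈ T, Bornology.IsBounded K
  isOpen : ∀ K ∈ T, IsOpen K
  subset : ∀ K ∈ T, K ⊆ Ω
  disjoint : T.PairwiseDisjoint id
  null : volume (Ω \ ⋃₀ T) = 0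

/-- A (non-degenerate) open simplex in `ℝⁿ`. -/
def IsOpenSimplex {n : ℕ} (S : Set (E n)) : Prop :=
  ∃ v : Fin (n + 1) → E n, AffineIndependent ℝ v ∧ S = interior (convexHull ℝ (range v))

/-- An open cube in `ℝⁿ`: an isometric copy of `(0, s)ⁿ` with `s > 0`. -/
def IsOpenCube {n : ℕ} (S : Set (E n)) : Prop :=
  ∃ (s : ℝ) (e : E n ≃ᵃⁱ[ℝ] E n), 0 < s ∧ S = e '' {x | ∀ i, x i ∈ Ioo 0 s}

/-- A covering of the mesh `T`: a set of open simplices or cubes such that each mesh element is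
contained in one of them. -/
structure IsCovering {n : ℕ} (T Tc : Set (Set (E n))) : Prop where
  shape : ∀ Q ∈ Tc, IsOpenSimplex Q ∨ IsOpenCube Q
  covers : ∀ K ∈ T, ∃ Q ∈ Tc, K ⊆ Q

/-- The supremum of the radii of the balls contained in `S`. -/
noncomputable def inradius {n : ℕ} (S : Set (E n)) : ℝ :=
  sSup {r : ℝ | 0 ≤ r ∧ ∃ x, Metric.ball x r ⊆ S}

/-- The shape regularity parameter of `S`: its diameter divided by its inradius. -/
noncomputable def shapeReg {n : ℕ} (S : Set (E n)) : ℝ :=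
  Metric.diam S / inradius S

end CoverApprox

/-!
The whole estimate concerns one simplex or cube `Q` and one function `U ∈ W^m(Q)`. With
`t = min(m, p + 1)` and the weights `w_j = h^(t - j) / (p + 1)^(m - j)`, it suffices to bound
`‖D^α (U - π U)‖_{L²(Q)} / w_{|α|}` by a multiple of `∑_{t ≤ r ≤ m} |U|_{W^r(Q)}` for all
`|α| ≤ m`: the mesh elements inside `Q` are disjoint, so the squares of the local norms add up to
at most those on `Q` (`tsum_sobolevNorm_sq_le`), and `w_i ≤ max(1, h₀)^m w_j` for `i ≤ j ≤ m`
(`approxWeight_le`).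

*Linearity for free.* The operator `π` is the orthogonal projection for the norm
`(∑_{|α| ≤ m} w_{|α|}^{-2} ‖D^α U‖²)^{1/2}` (`exists_linear_best_approx`, `derivVec`). It is linear,
and up to a factor depending on `n` and `m` its error is at most that of any polynomial. So it is
enough that for every `U` *some* polynomial is good simultaneously for all `j ≤ m`, and `U` may be
assumed to be smooth up to the boundary, since such functions are dense: contract towards an
interior point and mollify (`exists_smooth_approx`, `enorm_derivVec_best_approx_le`).

*Low degree, `p + 1 < m`.* Choose the polynomial of degree `p` for which the mean values of all
derivatives of order at most `p` of the error vanish. The Poincaré inequality on convex sets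
(`poincare_convex`) then gives the powers of `h` (`exists_poly_derivSq_le`), and the powers of
`p + 1 < m` are constants.

*High degree, `p + 1 ≥ m`.* First subtract the polynomial above, of degree less than `m`, which
leaves a function `G` whose derivatives of order at most `m` are bounded in `L²` by those of order
`m` of `U`. Then split `G` by a smooth partition of unity with one member for each corner of `Q`,
which vanishes near the faces opposite to that corner. Seen from its corner, `Q` is an affine image
of a fixed reference corner in the positive orthant (`IsCornerModel`, `HasCornerCharts`). Higher
order reflection in the coordinate hyperplanes extends the piece of `G` to a compactly supported
function on the whole space (`exists_extension`).

For a compactly supported function `W` there is a direct Jackson theorem (`exists_poly_approx_box`).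
Let `q` be a nonnegative polynomial kernel of degree at most `p / n`, concentrated at a distance of
order `1 / (p + 1)` from the origin (`exists_jackson_poly`, built from the polynomial
`T_N(y) / (N y)`, on which `y = sin φ` gives the Dirichlet kernel `sin(N φ) / (N sin φ)` up to
sign). The averages `∫ W(x + k z) q(z) dz`, `k ≥ 1`, are polynomials in `x` near the support of `W`
(`exists_poly_translateAvg`), and `W` minus a suitable combination of them is, up to sign, the
average of the differences `Δ_z^m W(x)`. Each derivative that falls on `W` in the place of a
difference gains a factor `|z|`, so the derivatives of order `j` of the error are of size
`(p + 1)^(j - m)` (`derivSq_diffAvg_le`).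

Carrying this back by the charts costs powers of their norms, which are bounded by the diameter and
by the inverse of the inradius (`chart_norm_le`): this is where the shape regularity enters, through
the factor `max(1, σ)^m`.
-/

namespace CoverApprox

/-! ### Mean square estimates for differences -/

section meanSquare

variable {F : Type*} [NormedAddCommGroup F] [NormedSpace ℝ F]

/-- Jensen's inequality for the square of the norm. -/
lemma enorm_integral_sq_le {α : Type*} [MeasurableSpace α] (μ : Measure α) [IsProbabilityMeasure μ]
    {f : α → F} (hf : AEStronglyMeasurable f μ) :
    ‖∫ x, f x ∂μ‖ₑ ^ 2 ≤ ∫⁻ x, ‖f x‖ₑ ^ 2 ∂μ := by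
  have h1 : ‖∫ x, f x ∂μ‖ₑ ≤ eLpNorm f 1 μ := by
    rw [eLpNorm_one_eq_lintegral_enorm]
    exact enorm_integral_le_lintegral_enorm f
  have h2 := h1.trans (eLpNorm_le_eLpNorm_of_exponent_le (q := 2) (by norm_num) hf)
  calc _ ≤ (eLpNorm f 2 μ) ^ 2 := by gcongr
    _ = _ := by
      rw [eLpNorm_eq_lintegral_rpow_enorm_toReal (by norm_num) (by norm_num),
        ← ENNReal.rpow_natCast, ← ENNReal.rpow_mul]
      norm_num

lemma sum_sq_le_card_sq_mul {ι : Type*} (s : Finset ι) (a : ι → ℝ≥0∞) :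
    (∑ i ∈ s, a i) ^ 2 ≤ (s.card : ℝ≥0∞) ^ 2 * ∑ i ∈ s, a i ^ 2 := by
  rcases s.eq_empty_or_nonempty with rfl | hs
  · simp
  obtain ⟨i₀, hi₀, hm⟩ := s.exists_max_image a hs
  calc (∑ i ∈ s, a i) ^ 2 ≤ (s.card * a i₀) ^ 2 := by
        gcongr
        simpa using Finset.sum_le_card_nsmul s a (a i₀) hm
    _ = (s.card : ℝ≥0∞) ^ 2 * a i₀ ^ 2 := by rw [mul_pow]
    _ ≤ _ := by
        gcongr
        exact Finset.single_le_sum (f := fun i => a i ^ 2) (fun _ _ => zero_le) hi₀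

lemma enorm_add_sq_le {G : Type*} [NormedAddCommGroup G] (a b : G) :
    ‖a + b‖ₑ ^ 2 ≤ 4 * (‖a‖ₑ ^ 2 + ‖b‖ₑ ^ 2) := by
  have := sum_sq_le_card_sq_mul Finset.univ ![‖a‖ₑ, ‖b‖ₑ]
  simp only [Fin.sum_univ_two, Matrix.cons_val_zero, Matrix.cons_val_one, Finset.card_univ,
    Fintype.card_fin] at this
  refine (pow_le_pow_left' (enorm_add_le a b) 2).trans (this.trans_eq ?_)
  norm_num

variable {V : Type*} [NormedAddCommGroup V] [NormedSpace ℝ V]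

/-- The fundamental theorem of calculus along the segment from `x` to `y`, in mean square. -/
lemma enorm_sub_sq_le_lintegral [CompleteSpace F] {f : V → F} (hf : ContDiff ℝ 1 f) (x y : V) :
    ‖f y - f x‖ₑ ^ 2 ≤
      ‖y - x‖ₑ ^ 2 * ∫⁻ t in Icc (0 : ℝ) 1, ‖fderiv ℝ f (x + t • (y - x))‖ₑ ^ 2 := by
  have hc : Continuous fun t : ℝ => fderiv ℝ f (x + t • (y - x)) :=
    (hf.continuous_fderiv (by norm_num)).comp (by fun_prop)
  have hd : ∀ t : ℝ, HasDerivAt (fun t : ℝ => f (x + t • (y - x)))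
      (fderiv ℝ f (x + t • (y - x)) (y - x)) t := by
    intro t
    have h1 : HasDerivAt (fun t : ℝ => x + t • (y - x)) (y - x) t := by
      simpa using ((hasDerivAt_id t).smul_const (y - x)).const_add x
    exact ((hf.differentiable (by norm_num)) _).hasFDerivAt.comp_hasDerivAt t h1
  have h1 : f y - f x = ∫ t in Icc (0 : ℝ) 1, fderiv ℝ f (x + t • (y - x)) (y - x) := by
    rw [integral_Icc_eq_integral_Ioc, ← intervalIntegral.integral_of_le zero_le_one,
      intervalIntegral.integral_eq_sub_of_hasDerivAt (fun t _ => hd t)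
        ((hc.clm_apply continuous_const).intervalIntegrable _ _)]
    simp
  have hp : IsProbabilityMeasure (volume.restrict (Icc (0 : ℝ) 1)) := ⟨by simp⟩
  rw [h1]
  refine (enorm_integral_sq_le _ (hc.clm_apply continuous_const).aestronglyMeasurable).trans ?_
  rw [← lintegral_const_mul' _ _ (by simp)]
  refine lintegral_mono fun t => ?_
  rw [← mul_pow, mul_comm]
  gcongr
  exact ContinuousLinearMap.le_opENorm _ _

variable [FiniteDimensional ℝ V] [MeasurableSpace V] [BorelSpace V] (μ : Measure V)
  [μ.IsAddHaarMeasure]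

/-- A difference `f(x + z) - f(x)` gains a factor `‖z‖` against one derivative in `L²`. -/
lemma lintegral_translate_sub_sq_le [CompleteSpace F] {f : V → F} (hf : ContDiff ℝ 1 f) (z : V) :
    ∫⁻ x, ‖f (x + z) - f x‖ₑ ^ 2 ∂μ ≤ ‖z‖ₑ ^ 2 * ∫⁻ x, ‖fderiv ℝ f x‖ₑ ^ 2 ∂μ := by
  have hc := hf.continuous_fderiv (by norm_num)
  calc ∫⁻ x, ‖f (x + z) - f x‖ₑ ^ 2 ∂μ
      ≤ ∫⁻ x, (‖z‖ₑ ^ 2 * ∫⁻ t in Icc (0 : ℝ) 1, ‖fderiv ℝ f (x + t • z)‖ₑ ^ 2) ∂μ := by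
        refine lintegral_mono fun x => ?_
        simpa using enorm_sub_sq_le_lintegral hf x (x + z)
    _ = ‖z‖ₑ ^ 2 * ∫⁻ t in Icc (0 : ℝ) 1, (∫⁻ x, ‖fderiv ℝ f (x + t • z)‖ₑ ^ 2 ∂μ) := by
        rw [lintegral_const_mul' _ _ (by simp), lintegral_lintegral_swap]
        refine Continuous.aemeasurable ?_
        have : Continuous fun p : V × ℝ => fderiv ℝ f (p.1 + p.2 • z) := hc.comp (by fun_prop)
        unfold Function.uncurry
        fun_prop
    _ = _ := by
        simp_rw [lintegral_add_right_eq_self (μ := μ) (fun x => ‖fderiv ℝ f x‖ₑ ^ 2)]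
        simp

/-- Contracting by the factor `s ≥ 1/2` towards the point `y` of a convex set. -/
lemma lintegral_contract_le {Q : Set V} (hQ : Convex ℝ Q) (hQm : MeasurableSet Q) (G : V → ℝ≥0∞)
    (hG : Measurable G) {y : V} (hy : y ∈ Q) {s : ℝ} (hs : 1 / 2 ≤ s) (hs1 : s ≤ 1) :
    ∫⁻ x in Q, G (s • x + (1 - s) • y) ∂μ
      ≤ 2 ^ (Module.finrank ℝ V) * ∫⁻ x in Q, G x ∂μ := by
  have hs0 : 0 < s := by linarith
  calc ∫⁻ x in Q, G (s • x + (1 - s) • y) ∂μ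
      ≤ ∫⁻ x, Q.indicator G (s • x + (1 - s) • y) ∂μ := by
        rw [← lintegral_indicator hQm]
        refine lintegral_mono fun x => ?_
        by_cases hx : x ∈ Q
        · rw [indicator_of_mem hx, indicator_of_mem]
          exact hQ hx hy hs0.le (by linarith) (by ring)
        · simp [hx]
    _ = ∫⁻ x, Q.indicator G (x + (1 - s) • y) ∂(μ.map (s • ·)) := by
        rw [lintegral_map _ (by fun_prop)]
        exact (hG.indicator hQm).comp (by fun_prop)
    _ = ENNReal.ofReal |(s ^ Module.finrank ℝ V)⁻¹| * ∫⁻ x in Q, G x ∂μ := by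
        rw [Measure.map_addHaar_smul μ hs0.ne', lintegral_smul_measure,
          lintegral_add_right_eq_self (μ := μ) (Q.indicator G), lintegral_indicator hQm]
        rfl
    _ ≤ _ := by
        gcongr
        rw [abs_of_nonneg (by positivity), ENNReal.ofReal_le_iff_le_toReal (by simp)]
        simp only [ENNReal.toReal_pow, ENNReal.toReal_ofNat]
        rw [← inv_pow]
        gcongr
        rw [inv_le_comm₀ hs0 (by norm_num)]
        linarith

/-- The Poincaré inequality on a bounded convex set. The difference `f y - f x` is the integral of
the derivative along the segment, and in the double integral over `x` and `y` the point
`x + t (y - x)` is a contraction of `x` with factor at least `1/2` towards `y` for `t ≤ 1/2`, and of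
`y` towards `x` otherwise. -/
lemma poincare_convex [CompleteSpace F] {Q : Set V} (hQ : Convex ℝ Q) (hQm : MeasurableSet Q)
    (hQ0 : μ Q ≠ 0) (hQt : μ Q ≠ ⊤) {h : ℝ} (hd : ∀ x ∈ Q, ∀ y ∈ Q, ‖y - x‖ ≤ h)
    {f : V → F} (hf : ContDiff ℝ 1 f) (hi : IntegrableOn f Q μ) (h0 : ∫ x in Q, f x ∂μ = 0) :
    ∫⁻ x in Q, ‖f x‖ₑ ^ 2 ∂μ ≤
      2 ^ (Module.finrank ℝ V) * ENNReal.ofReal h ^ 2 * ∫⁻ x in Q, ‖fderiv ℝ f x‖ₑ ^ 2 ∂μ := by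
  set G : V → ℝ≥0∞ := fun x => ‖fderiv ℝ f x‖ₑ ^ 2 with hG
  have hcd := hf.continuous_fderiv (by norm_num)
  have hGc : Continuous G := by fun_prop
  set ν : Measure V := (μ Q)⁻¹ • μ.restrict Q with hν
  have hp : IsProbabilityMeasure ν := by
    refine ⟨?_⟩
    simp [hν, ENNReal.inv_mul_cancel hQ0 hQt]
  have hiν : Integrable f ν := hi.integrable.smul_measure (by simp [hQ0])
  have h0ν : ∫ y, f y ∂ν = 0 := by simp [hν, integral_smul_measure, h0]
  have key : ∀ t ∈ Icc (0 : ℝ) 1, ∫⁻ x in Q, ∫⁻ y in Q, G (x + t • (y - x)) ∂μ ∂μ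
      ≤ 2 ^ (Module.finrank ℝ V) * μ Q * ∫⁻ x in Q, G x ∂μ := by
    intro t ht
    rcases le_total t (1 / 2) with h2 | h2
    · rw [lintegral_lintegral_swap (by unfold Function.uncurry; fun_prop)]
      calc _ ≤ ∫⁻ y in Q, 2 ^ (Module.finrank ℝ V) * ∫⁻ x in Q, G x ∂μ ∂μ := by
            refine setLIntegral_mono' hQm fun y hy => ?_
            convert lintegral_contract_le μ hQ hQm G hGc.measurable hy (s := 1 - t) (by linarith)
              (by linarith [ht.1]) using 4 with x
            module
        _ = _ := by simp; ring
    · calc _ ≤ ∫⁻ y in Q, 2 ^ (Module.finrank ℝ V) * ∫⁻ x in Q, G x ∂μ ∂μ := by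
            refine setLIntegral_mono' hQm fun y hy => ?_
            convert lintegral_contract_le μ hQ hQm G hGc.measurable hy (s := t) (by linarith)
              (by linarith [ht.2]) using 4 with x
            module
        _ = _ := by simp; ring
  calc ∫⁻ x in Q, ‖f x‖ₑ ^ 2 ∂μ
      ≤ ∫⁻ x in Q, ∫⁻ y, ‖f y - f x‖ₑ ^ 2 ∂ν ∂μ := by
        refine lintegral_mono fun x => ?_
        have := enorm_integral_sq_le ν (f := fun y => f y - f x)
          (hiν.1.sub aestronglyMeasurable_const)
        rwa [integral_sub hiν (integrable_const _), h0ν, integral_const, probReal_univ, one_smul,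
          zero_sub, enorm_neg] at this
    _ = (μ Q)⁻¹ * ∫⁻ x in Q, ∫⁻ y in Q, ‖f y - f x‖ₑ ^ 2 ∂μ ∂μ := by
        simp_rw [hν, lintegral_smul_measure, smul_eq_mul]
        rw [lintegral_const_mul' _ _ (by simp [hQ0])]
    _ ≤ (μ Q)⁻¹ * ∫⁻ x in Q, ∫⁻ y in Q,
          (ENNReal.ofReal h ^ 2 * ∫⁻ t in Icc (0 : ℝ) 1, G (x + t • (y - x))) ∂μ ∂μ := by
        gcongr 1
        refine setLIntegral_mono' hQm fun x hx => setLIntegral_mono' hQm fun y hy => ?_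
        refine (enorm_sub_sq_le_lintegral hf x y).trans ?_
        gcongr
        rw [← ofReal_norm]
        exact ENNReal.ofReal_le_ofReal (hd x hx y hy)
    _ = (μ Q)⁻¹ * (ENNReal.ofReal h ^ 2 *
          ∫⁻ t in Icc (0 : ℝ) 1, (∫⁻ x in Q, ∫⁻ y in Q, G (x + t • (y - x)) ∂μ ∂μ)) := by
        have hne : ENNReal.ofReal h ^ 2 ≠ ⊤ := by simp
        simp_rw [lintegral_const_mul' _ _ hne]
        congr 2
        symm
        rw [lintegral_lintegral_swap]
        · refine lintegral_congr fun x => ?_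
          rw [lintegral_lintegral_swap]
          unfold Function.uncurry
          exact (hGc.comp (by fun_prop)).measurable.aemeasurable
        · refine Measurable.aemeasurable ?_
          refine Measurable.lintegral_prod_right' (f := fun p : (ℝ × V) × V =>
            G (p.1.2 + p.1.1 • (p.2 - p.1.2))) ?_
          exact (hGc.comp (by fun_prop)).measurable
    _ ≤ (μ Q)⁻¹ * (ENNReal.ofReal h ^ 2 *
          ∫⁻ _ in Icc (0 : ℝ) 1, (2 ^ (Module.finrank ℝ V) * μ Q * ∫⁻ x in Q, G x ∂μ)) := by
        gcongr 2
        exact setLIntegral_mono' measurableSet_Icc key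
    _ = ((μ Q)⁻¹ * μ Q) *
          (2 ^ (Module.finrank ℝ V) * ENNReal.ofReal h ^ 2 * ∫⁻ x in Q, G x ∂μ) := by
        simp only [lintegral_const, MeasurableSet.univ, Measure.restrict_apply, univ_inter,
          Real.volume_Icc, sub_zero, ENNReal.ofReal_one, mul_one]
        ring
    _ = _ := by rw [ENNReal.inv_mul_cancel hQ0 hQt, one_mul]

end meanSquare

/-! ### Iterated partial derivatives of smooth functions -/

section listDeriv

variable {n : ℕ} {F : Type*} [NormedAddCommGroup F] [NormedSpace ℝ F]

/-- The iterated partial derivative `∂_{i₁} ⋯ ∂_{iₖ} f` along the list `[i₁, …, iₖ]`, for functions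
with values in any normed space. -/
noncomputable def listDeriv (l : List (Fin n)) (f : E n → F) : E n → F :=
  l.foldr (fun i g x => fderiv ℝ g x (EuclideanSpace.single i 1)) f

@[simp] lemma listDeriv_nil (f : E n → F) : listDeriv [] f = f := rfl

lemma listDeriv_cons (i : Fin n) (l : List (Fin n)) (f : E n → F) :
    listDeriv (i :: l) f = fun x => fderiv ℝ (listDeriv l f) x (EuclideanSpace.single i 1) := rfl

lemma listDeriv_append (l l' : List (Fin n)) (f : E n → F) :
    listDeriv (l ++ l') f = listDeriv l (listDeriv l' f) := by
  simp [listDeriv, List.foldr_append]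

lemma contDiff_listDeriv (l : List (Fin n)) {f : E n → F} (hf : ContDiff ℝ ∞ f) :
    ContDiff ℝ ∞ (listDeriv l f) := by
  induction l with
  | nil => exact hf
  | cons i l ih => exact (ih.fderiv_right (m := ∞) (by simp)).clm_apply contDiff_const

lemma listDeriv_add (l : List (Fin n)) {f g : E n → F} (hf : ContDiff ℝ ∞ f)
    (hg : ContDiff ℝ ∞ g) : listDeriv l (f + g) = listDeriv l f + listDeriv l g := by
  induction l with
  | nil => rfl
  | cons i l ih =>
    ext x
    simp only [listDeriv_cons, ih, Pi.add_apply]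
    rw [fderiv_add ((contDiff_listDeriv l hf).differentiable (by simp) x)
      ((contDiff_listDeriv l hg).differentiable (by simp) x)]
    rfl

lemma listDeriv_const_smul {R : Type*} [Ring R] [Module R F] [SMulCommClass ℝ R F]
    [ContinuousConstSMul R F] (l : List (Fin n)) {f : E n → F}
    (hf : ContDiff ℝ ∞ f) (c : R) : listDeriv l (c • f) = c • listDeriv l f := by
  induction l with
  | nil => rfl
  | cons i l ih =>
    ext x
    simp only [listDeriv_cons, ih, Pi.smul_apply]
    rw [fderiv_const_smul ((contDiff_listDeriv l hf).differentiable (by simp) x)]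
    rfl

lemma listDeriv_sub (l : List (Fin n)) {f g : E n → F} (hf : ContDiff ℝ ∞ f)
    (hg : ContDiff ℝ ∞ g) : listDeriv l (f - g) = listDeriv l f - listDeriv l g := by
  have h1 : f - g = f + (-1 : ℝ) • g := by simp [sub_eq_add_neg]
  rw [h1, listDeriv_add l hf (g := (-1 : ℝ) • g) (hg.const_smul _), listDeriv_const_smul l hg]
  simp [sub_eq_add_neg]

lemma listDeriv_perm {l l' : List (Fin n)} (h : l.Perm l') {f : E n → F} (hf : ContDiff ℝ ∞ f) :
    listDeriv l f = listDeriv l' f := by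
  induction h with
  | nil => rfl
  | cons i _ ih => simp only [listDeriv_cons, ih]
  | swap i j l =>
    ext x
    have hg := contDiff_listDeriv l hf
    have hd : DifferentiableAt ℝ (fderiv ℝ (listDeriv l f)) x :=
      (hg.fderiv_right (m := ∞) (by simp)).differentiable (by simp) x
    have hs := (hg.contDiffAt (x := x)).isSymmSndFDerivAt
      (by simpa using WithTop.coe_le_coe.2 (le_top (a := (2 : ℕ∞))))
    simp only [listDeriv_cons]
    rw [fderiv_clm_apply hd (by fun_prop), fderiv_clm_apply hd (by fun_prop)]
    simpa using hs.eq _ _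
  | trans _ _ ih1 ih2 => rw [ih1, ih2]

lemma listDeriv_eq_iteratedFDeriv (l : List (Fin n)) {f : E n → F} (hf : ContDiff ℝ ∞ f)
    (x : E n) : listDeriv l f x =
      iteratedFDeriv ℝ l.length f x (fun s => EuclideanSpace.single (l.get s) 1) := by
  induction l generalizing x with
  | nil => simp
  | cons i l ih =>
    have hd : DifferentiableAt ℝ (iteratedFDeriv ℝ l.length f) x :=
      hf.differentiable_iteratedFDeriv (WithTop.coe_lt_coe.2 (ENat.natCast_lt_top _)) x
    simp only [listDeriv_cons, List.length_cons]
    rw [hd.iteratedFDeriv_succ_apply_left']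
    have : listDeriv l f = fun y => iteratedFDeriv ℝ l.length f y
      (fun s => EuclideanSpace.single (l.get s) 1) := funext ih
    rw [this]
    rfl

lemma enorm_listDeriv_le (l : List (Fin n)) {f : E n → F} (hf : ContDiff ℝ ∞ f) (x : E n) :
    ‖listDeriv l f x‖ₑ ≤ ‖iteratedFDeriv ℝ l.length f x‖ₑ := by
  rw [listDeriv_eq_iteratedFDeriv l hf, enorm_le_iff_norm_le]
  refine (ContinuousMultilinearMap.le_opNorm _ _).trans ?_
  simp

lemma iteratedFDeriv_apply_single {k : ℕ} {f : E n → F} (hf : ContDiff ℝ ∞ f) (x : E n)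
    (r : Fin k → Fin n) : iteratedFDeriv ℝ k f x (fun s => EuclideanSpace.single (r s) 1) =
      listDeriv (List.ofFn r) f x := by
  rw [listDeriv_eq_iteratedFDeriv _ hf]
  have key : ∀ (k' : ℕ) (h : k' = k), iteratedFDeriv ℝ k f x
      (fun s => EuclideanSpace.single (r s) 1) = iteratedFDeriv ℝ k' f x
      (fun s => EuclideanSpace.single (r (Fin.cast h s)) 1) := by
    rintro k' rfl; rfl
  rw [key _ List.length_ofFn]
  congr 1
  ext s
  simp only [List.get_ofFn]

/-- An iterated derivative of a smooth function is a symmetric multilinear form. -/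
lemma iteratedFDeriv_symm {k : ℕ} {f : E n → F} (hf : ContDiff ℝ ∞ f) (x : E n)
    (v : Fin k → E n) (σ : Equiv.Perm (Fin k)) :
    iteratedFDeriv ℝ k f x (v ∘ σ) = iteratedFDeriv ℝ k f x v := by
  have h : ((iteratedFDeriv ℝ k f x).toMultilinearMap.domDomCongr σ) =
      (iteratedFDeriv ℝ k f x).toMultilinearMap := by
    refine Module.Basis.ext_multilinear (fun _ => (EuclideanSpace.basisFun (Fin n) ℝ).toBasis) ?_
    intro r
    have h1 := iteratedFDeriv_apply_single hf x r
    have h2 := iteratedFDeriv_apply_single hf x (r ∘ σ)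
    have h3 : listDeriv (List.ofFn (r ∘ σ)) f = listDeriv (List.ofFn r) f :=
      listDeriv_perm (σ.ofFn_comp_perm r) hf
    simp only [MultilinearMap.domDomCongr_apply, OrthonormalBasis.coe_toBasis,
      EuclideanSpace.basisFun_apply, ContinuousMultilinearMap.coe_coe]
    rw [h1, ← h3, ← h2]
    rfl
  exact DFunLike.congr_fun h v

/-- The list of directions in which `D^α` differentiates. -/
def dirList (α : Fin n → ℕ) : List (Fin n) :=
  (List.finRange n).flatMap fun i => List.replicate (α i) i

lemma length_dirList (α : Fin n → ℕ) : (dirList α).length = ∑ i, α i := by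
  simp [dirList, List.length_flatMap, ← List.ofFn_eq_map, List.sum_ofFn]

lemma count_dirList (α : Fin n → ℕ) (i : Fin n) : (dirList α).count i = α i := by
  rw [dirList, List.count_flatMap]
  have : (List.count i ∘ fun j => List.replicate (α j) j) = fun j => if j = i then α j else 0 := by
    ext j
    simp [List.count_replicate]
  rw [this, ← List.ofFn_eq_map, List.sum_ofFn]
  simp

lemma perm_dirList_count (l : List (Fin n)) : l.Perm (dirList fun i => l.count i) :=
  List.perm_iff_count.2 fun i => (count_dirList (fun i => l.count i) i).symm

lemma multiDeriv_eq_listDeriv (α : Fin n → ℕ) (φ : E n → ℝ) :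
    multiDeriv α φ = listDeriv (dirList α) φ := by
  unfold multiDeriv dirList
  induction List.finRange n with
  | nil => rfl
  | cons i l ih =>
    simp only [List.foldr_cons, List.flatMap_cons, listDeriv_append, ih]
    generalize listDeriv _ φ = ψ
    induction α i with
    | zero => rfl
    | succ k ihk => rw [Function.iterate_succ_apply', ihk, List.replicate_succ, listDeriv_cons]; rfl

/-- The operator norm of `D^k f` is controlled by the partial derivatives of order `k`. -/
lemma enorm_iteratedFDeriv_sq_le {k : ℕ} {f : E n → F} (hf : ContDiff ℝ ∞ f) (x : E n) :
    ‖iteratedFDeriv ℝ k f x‖ₑ ^ 2 ≤ (n : ℝ≥0∞) ^ (3 * k) *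
      ∑ α ∈ Finset.piAntidiag (Finset.univ : Finset (Fin n)) k,
        ‖listDeriv (dirList α) f x‖ₑ ^ 2 := by
  have h1 : ‖iteratedFDeriv ℝ k f x‖ₑ ≤
      ∑ r : Fin k → Fin n, ‖listDeriv (List.ofFn r) f x‖ₑ := by
    have h0 : ‖iteratedFDeriv ℝ k f x‖ ≤ ∑ r : Fin k → Fin n, ‖listDeriv (List.ofFn r) f x‖ := by
      refine ContinuousMultilinearMap.opNorm_le_bound (by positivity) fun v => ?_
      have hv : v = fun s => ∑ i, (v s i) • (EuclideanSpace.single i (1 : ℝ) : E n) := by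
        ext s j
        simp [Pi.single_apply]
      have : iteratedFDeriv ℝ k f x v = ∑ r : Fin k → Fin n, (∏ s, v s (r s)) •
          listDeriv (List.ofFn r) f x := by
        conv_lhs => rw [hv]
        rw [ContinuousMultilinearMap.map_sum]
        refine Finset.sum_congr rfl fun r _ => ?_
        rw [ContinuousMultilinearMap.map_smul_univ, iteratedFDeriv_apply_single hf]
      rw [this, Finset.sum_mul]
      refine (norm_sum_le _ _).trans (Finset.sum_le_sum fun r _ => ?_)
      rw [norm_smul, mul_comm, norm_prod]
      gcongr with s
      exact PiLp.norm_apply_le (v s) (r s)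
    calc _ = ENNReal.ofReal ‖iteratedFDeriv ℝ k f x‖ := (ofReal_norm _).symm
      _ ≤ _ := ENNReal.ofReal_le_ofReal h0
      _ = _ := by
        rw [ENNReal.ofReal_sum_of_nonneg (fun _ _ => norm_nonneg _)]
        simp
  have h2 : ∀ r : Fin k → Fin n, ‖listDeriv (List.ofFn r) f x‖ₑ ^ 2 ≤
      ∑ α ∈ Finset.piAntidiag (Finset.univ : Finset (Fin n)) k,
        ‖listDeriv (dirList α) f x‖ₑ ^ 2 := by
    intro r
    rw [listDeriv_perm (perm_dirList_count (List.ofFn r)) hf]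
    refine Finset.single_le_sum (f := fun α => ‖listDeriv (dirList α) f x‖ₑ ^ 2)
      (fun _ _ => zero_le) ?_
    rw [Finset.mem_piAntidiag]
    refine ⟨?_, by simp⟩
    rw [← length_dirList, ← (perm_dirList_count (List.ofFn r)).length_eq, List.length_ofFn]
  calc _ ≤ (∑ r : Fin k → Fin n, ‖listDeriv (List.ofFn r) f x‖ₑ) ^ 2 := by gcongr
    _ ≤ _ := sum_sq_le_card_sq_mul _ _
    _ ≤ _ * ∑ r : Fin k → Fin n, ∑ α ∈ Finset.piAntidiag (Finset.univ : Finset (Fin n)) k,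
        ‖listDeriv (dirList α) f x‖ₑ ^ 2 := by
      gcongr with r
      exact h2 r
    _ = _ := by
      simp only [Finset.card_univ, Fintype.card_pi, Fintype.card_fin, Finset.prod_const,
        Finset.sum_const, nsmul_eq_mul]
      push_cast
      ring

end listDeriv

/-! ### Polynomials with prescribed mean derivatives -/

section taylor

variable {𝕜 : Type*} [RCLike 𝕜] {n : ℕ}

lemma contDiff_polyFun (P : MvPolynomial (Fin n) 𝕜) : ContDiff ℝ ∞ (polyFun P) := by
  have hX : ∀ i : Fin n, ContDiff ℝ ∞ fun x : E n => ((x i : ℝ) : 𝕜) := fun i =>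
    (RCLike.ofRealCLM (K := 𝕜)).contDiff.comp
      (EuclideanSpace.proj i : E n →L[ℝ] ℝ).contDiff
  induction P using MvPolynomial.induction_on with
  | C a =>
    have : polyFun (n := n) (MvPolynomial.C a) = fun _ => a := by ext; simp [polyFun]
    rw [this]
    exact contDiff_const
  | add p q hp hq =>
    have : polyFun (p + q) = polyFun p + polyFun q := by ext; simp [polyFun]
    rw [this]
    exact hp.add hq
  | mul_X p i hp =>
    have : polyFun (p * MvPolynomial.X i) = fun x => polyFun p x * ((x i : ℝ) : 𝕜) := by
      ext; simp [polyFun]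
    rw [this]
    exact hp.mul (hX i)

lemma polyFun_add (P R : MvPolynomial (Fin n) 𝕜) : polyFun (P + R) = polyFun P + polyFun R := by
  ext; simp [polyFun]

lemma polySpace_mono {p q : ℕ} (h : p ≤ q) : PolySpace 𝕜 n p ≤ PolySpace 𝕜 n q := by
  intro P hP
  rw [MvPolynomial.mem_restrictTotalDegree] at *
  exact hP.trans h

/-- The homogeneous polynomial `x ↦ M(x, …, x) / k!`. -/
noncomputable def diagPoly {k : ℕ} (M : ContinuousMultilinearMap ℝ (fun _ : Fin k => E n) 𝕜) :
    MvPolynomial (Fin n) 𝕜 :=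
  ∑ r : Fin k → Fin n, MvPolynomial.C (((k.factorial : ℝ)⁻¹ : ℝ) •
    M fun s => EuclideanSpace.single (r s) 1) * ∏ s, MvPolynomial.X (r s)

lemma diagPoly_mem {k : ℕ} (M : ContinuousMultilinearMap ℝ (fun _ : Fin k => E n) 𝕜) :
    diagPoly M ∈ PolySpace 𝕜 n k := by
  rw [MvPolynomial.mem_restrictTotalDegree]
  refine MvPolynomial.totalDegree_finsetSum_le fun r _ => ?_
  refine (MvPolynomial.totalDegree_mul _ _).trans ?_
  rw [MvPolynomial.totalDegree_C, zero_add]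
  refine (MvPolynomial.totalDegree_finsetProd _ _).trans ?_
  simp

lemma polyFun_diagPoly {k : ℕ} (M : ContinuousMultilinearMap ℝ (fun _ : Fin k => E n) 𝕜) :
    polyFun (diagPoly M) = ((k.factorial : ℝ)⁻¹ : ℝ) • fun x => M fun _ => x := by
  ext x
  have hv : x = ∑ i, (x i) • (EuclideanSpace.single i (1 : ℝ) : E n) := by
    ext j
    simp [Pi.single_apply]
  have : M (fun _ => x) = ∑ r : Fin k → Fin n, (∏ s, x (r s)) •
      M fun s => EuclideanSpace.single (r s) 1 := by
    conv_lhs => rw [hv]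
    rw [ContinuousMultilinearMap.map_sum]
    exact Finset.sum_congr rfl fun r _ => by rw [ContinuousMultilinearMap.map_smul_univ]
  simp only [polyFun, diagPoly, map_sum, map_mul, map_prod, MvPolynomial.eval_C,
    MvPolynomial.eval_X, Pi.smul_apply]
  rw [this, Finset.smul_sum]
  refine Finset.sum_congr rfl fun r _ => ?_
  rw [smul_comm, RCLike.real_smul_eq_coe_mul (∏ s, x (r s)), mul_comm]
  push_cast
  rfl

/-- For symmetric `M`, the derivative of order `k` of `x ↦ M(x, …, x) / k!` is `M`. -/
lemma iteratedFDeriv_diagPoly {k : ℕ} (M : ContinuousMultilinearMap ℝ (fun _ : Fin k => E n) 𝕜)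
    (hM : ∀ v (σ : Equiv.Perm (Fin k)), M (v ∘ σ) = M v) (x : E n) :
    iteratedFDeriv ℝ k (polyFun (diagPoly M)) x = M := by
  have hc : ContDiff ℝ k fun x : E n => M fun _ => x :=
    M.contDiff.comp (contDiff_pi.2 fun _ => contDiff_id)
  rw [polyFun_diagPoly, iteratedFDeriv_const_smul_apply hc.contDiffAt]
  ext v
  rw [smul_apply, ContinuousMultilinearMap.iteratedFDeriv_comp_diagonal]
  have : ∀ σ : Equiv.Perm (Fin k), M (fun i => v (σ i)) = M v := fun σ => hM v σ
  simp only [this, Finset.sum_const, Finset.card_univ, Fintype.card_perm, Fintype.card_fin]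
  rw [← Nat.cast_smul_eq_nsmul ℝ, smul_smul, inv_mul_cancel₀ (by positivity), one_smul]

lemma iteratedFDeriv_eq_zero_of_const {V F : Type*} [NormedAddCommGroup V] [NormedSpace ℝ V]
    [NormedAddCommGroup F] [NormedSpace ℝ F] {k : ℕ} {f : V → F}
    {M : ContinuousMultilinearMap ℝ (fun _ : Fin k => V) F}
    (h : ∀ x, iteratedFDeriv ℝ k f x = M) {j : ℕ} (hj : k < j) : iteratedFDeriv ℝ j f = 0 := by
  obtain ⟨i, rfl⟩ := Nat.exists_eq_add_of_lt hj
  clear hj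
  induction i with
  | zero =>
    have : iteratedFDeriv ℝ k f = fun _ => M := funext h
    ext1 x
    rw [add_zero, iteratedFDeriv_succ_eq_comp_left]
    simp [this]
    rfl
  | succ i ih =>
    ext1 x
    rw [show k + (i + 1) + 1 = (k + i + 1) + 1 by ring, iteratedFDeriv_succ_eq_comp_left]
    simp [ih]
    rfl

/-- The squared seminorm `∫_S ‖D^j f‖²` of a smooth function. -/
noncomputable def derivSq {V F : Type*} [NormedAddCommGroup V] [NormedSpace ℝ V] [MeasureSpace V]
    [NormedAddCommGroup F] [NormedSpace ℝ F] (j : ℕ) (f : V → F) (S : Set V) : ℝ≥0∞ :=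
  ∫⁻ x in S, ‖iteratedFDeriv ℝ j f x‖ₑ ^ 2

lemma integrableOn_of_continuous {F : Type*} [NormedAddCommGroup F] {Q : Set (E n)}
    (hb : Bornology.IsBounded Q) {f : E n → F} (hf : Continuous f) :
    IntegrableOn f Q :=
  (hf.continuousOn.integrableOn_compact hb.isCompact_closure).mono_set subset_closure

/-- For some polynomial `P` of degree less than `K`, all derivatives of `U - P` of order less than
`K` have mean value zero on `Q`; the homogeneous parts are chosen from the top degree down. For
`K = 0` the truncated degree `K - 1` is harmless: then `P = 0`. -/
lemma exists_poly_mean_eq_zero {Q : Set (E n)} (hb : Bornology.IsBounded Q) (hQ0 : volume Q ≠ 0)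
    (K : ℕ) {U : E n → 𝕜} (hU : ContDiff ℝ ∞ U) :
    ∃ P ∈ PolySpace 𝕜 n (K - 1), (∀ j, K ≤ j → iteratedFDeriv ℝ j (polyFun P) = 0) ∧
      ∀ j < K, ∫ x in Q, iteratedFDeriv ℝ j (U - polyFun P) x = 0 := by
  induction K generalizing U with
  | zero =>
    refine ⟨0, zero_mem _, fun j _ => ?_, by simp⟩
    have : polyFun (0 : MvPolynomial (Fin n) 𝕜) = 0 := by ext; simp [polyFun]
    rw [this]
    ext1 x
    exact congrFun iteratedFDeriv_fun_zero x
  | succ K ih =>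
    have hQt : volume Q ≠ ⊤ := hb.measure_lt_top.ne
    have hle : ∀ j : ℕ, (j : WithTop ℕ∞) ≤ (∞ : ℕ∞ω) := fun j => WithTop.coe_le_coe.2 le_top
    have hci : ∀ (j : ℕ) {f : E n → 𝕜}, ContDiff ℝ ∞ f →
        Integrable (iteratedFDeriv ℝ j f) (volume.restrict Q) := fun j f hf =>
      integrableOn_of_continuous hb (hf.continuous_iteratedFDeriv (hle j))
    -- The top degree part is the mean of the derivative of order `K`.
    set M : ContinuousMultilinearMap ℝ (fun _ : Fin K => E n) 𝕜 :=
      (volume.real Q)⁻¹ • ∫ x in Q, iteratedFDeriv ℝ K U x with hM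
    have hMs : ∀ v (σ : Equiv.Perm (Fin K)), M (v ∘ σ) = M v := by
      intro v σ
      have h1 : ∀ w, M w = (volume.real Q)⁻¹ • ∫ x in Q, iteratedFDeriv ℝ K U x w := by
        intro w
        rw [hM, smul_apply]
        congr 1
        exact ((ContinuousMultilinearMap.apply ℝ (fun _ : Fin K => E n) 𝕜 w).integral_comp_comm
          (hci K hU)).symm
      rw [h1, h1]
      simp_rw [iteratedFDeriv_symm hU]
    have hP1 := iteratedFDeriv_diagPoly M hMs
    obtain ⟨P2, hP2, hP2j, hP2i⟩ := ih (U := U - polyFun (diagPoly M))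
      (hU.sub (contDiff_polyFun _))
    have hle' : ∀ (j : ℕ) {f : E n → 𝕜}, ContDiff ℝ ∞ f → ContDiff ℝ j f :=
      fun j f hf => hf.of_le (hle j)
    have hsum : ∀ j, iteratedFDeriv ℝ j (polyFun (diagPoly M + P2)) =
        iteratedFDeriv ℝ j (polyFun (diagPoly M)) + iteratedFDeriv ℝ j (polyFun P2) := by
      intro j
      rw [polyFun_add, iteratedFDeriv_add (hle' j (contDiff_polyFun _))
        (hle' j (contDiff_polyFun _))]
    refine ⟨diagPoly M + P2, add_mem (diagPoly_mem M) (polySpace_mono (by omega) hP2), ?_, ?_⟩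
    · intro j hj
      rw [hsum, iteratedFDeriv_eq_zero_of_const hP1 (by omega), hP2j j (by omega), add_zero]
    · intro j hj
      rcases Nat.lt_succ_iff_lt_or_eq.1 hj with h | rfl
      · have := hP2i j h
        rwa [sub_sub, ← polyFun_add] at this
      · rw [iteratedFDeriv_sub (hle' j hU) (hle' j (contDiff_polyFun _)), hsum, hP2j j le_rfl,
          add_zero]
        have h2 : iteratedFDeriv ℝ j (polyFun (diagPoly M)) = fun _ => M := funext hP1
        rw [h2]
        simp only [Pi.sub_apply]
        rw [integral_sub (hci j hU) (integrable_const_iff.2 (Or.inr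
          ⟨by simpa using hb.measure_lt_top⟩)), setIntegral_const, hM, smul_smul,
          mul_inv_cancel₀ (by simp [Measure.real, ENNReal.toReal_eq_zero_iff, hQ0, hQt]), one_smul,
          sub_self]

/-- A Deny-Lions estimate on convex sets, with the scaling in the diameter: the Poincaré inequality
is iterated on the derivatives of `U - P`, which have mean value zero. -/
lemma exists_poly_derivSq_le {Q : Set (E n)} (hc : Convex ℝ Q) (hm : MeasurableSet Q)
    (hb : Bornology.IsBounded Q) (hQ0 : volume Q ≠ 0) (K : ℕ) {U : E n → 𝕜}
    (hU : ContDiff ℝ ∞ U) :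
    ∃ P ∈ PolySpace 𝕜 n (K - 1), (∀ j, K ≤ j → iteratedFDeriv ℝ j (polyFun P) = 0) ∧
      ∀ j ≤ K, derivSq j (U - polyFun P) Q ≤
        (2 ^ n * ENNReal.ofReal (Metric.diam Q) ^ 2) ^ (K - j) * derivSq K U Q := by
  obtain ⟨P, hP, hPj, hPi⟩ := exists_poly_mean_eq_zero hb hQ0 K hU
  have hle : ∀ j : ℕ, (j : WithTop ℕ∞) ≤ (∞ : ℕ∞ω) := fun j => WithTop.coe_le_coe.2 le_top
  refine ⟨P, hP, hPj, ?_⟩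
  have hg : ContDiff ℝ ∞ (U - polyFun P) := hU.sub (contDiff_polyFun _)
  have step : ∀ j < K, derivSq j (U - polyFun P) Q ≤
      2 ^ n * ENNReal.ofReal (Metric.diam Q) ^ 2 * derivSq (j + 1) (U - polyFun P) Q := by
    intro j hj
    have hs : ContDiff ℝ 1 (iteratedFDeriv ℝ j (U - polyFun P)) :=
      hg.iteratedFDeriv_right (by exact_mod_cast hle (1 + j))
    have := poincare_convex volume hc hm hQ0 hb.measure_lt_top.ne (h := Metric.diam Q)
      (fun x hx y hy => by
        rw [← dist_eq_norm]; exact Metric.dist_le_diam_of_mem hb hy hx) hs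
      (integrableOn_of_continuous hb hs.continuous) (hPi j hj)
    refine this.trans_eq ?_
    simp only [derivSq, finrank_euclideanSpace, Fintype.card_fin]
    congr 2
    ext x
    rw [← ofReal_norm, ← ofReal_norm, norm_fderiv_iteratedFDeriv]
  have htop : derivSq K (U - polyFun P) Q = derivSq K U Q := by
    have : iteratedFDeriv ℝ K (U - polyFun P) = iteratedFDeriv ℝ K U := by
      rw [iteratedFDeriv_sub (hU.of_le (hle K)) ((contDiff_polyFun _).of_le (hle K)),
        hPj K le_rfl, sub_zero]
    simp only [derivSq, this]
  intro j hj
  obtain ⟨i, rfl⟩ := Nat.exists_eq_add_of_le hj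
  rw [Nat.add_sub_cancel_left, ← htop]
  have : ∀ k ≤ i, derivSq (j + i - k) (U - polyFun P) Q ≤
      (2 ^ n * ENNReal.ofReal (Metric.diam Q) ^ 2) ^ k * derivSq (j + i) (U - polyFun P) Q := by
    intro k hk
    induction k with
    | zero => simp
    | succ k ihk =>
      have h1 := step (j + i - (k + 1)) (by omega)
      rw [show j + i - (k + 1) + 1 = j + i - k by omega] at h1
      rw [pow_succ' (2 ^ n * ENNReal.ofReal (Metric.diam Q) ^ 2) k]
      refine (h1.trans (mul_le_mul_right (ihk (by omega)) _)).trans_eq ?_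
      ring
  simpa using this i le_rfl

end taylor

/-! ### Affine changes of variables -/

section affine

variable {V V' F : Type*} [NormedAddCommGroup V] [NormedSpace ℝ V] [NormedAddCommGroup V']
  [NormedSpace ℝ V'] [NormedAddCommGroup F] [NormedSpace ℝ F]

lemma iteratedFDeriv_comp_affine (L : V →L[ℝ] V') (c : V') (j : ℕ) {f : V' → F}
    (hf : ContDiff ℝ j f) (t : V) : iteratedFDeriv ℝ j (fun t => f (L t + c)) t =
      (iteratedFDeriv ℝ j f (L t + c)).compContinuousLinearMap fun _ => L := by
  have h1 : (fun t => f (L t + c)) = (fun x => f (x + c)) ∘ L := rfl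
  have h2 : ContDiff ℝ j fun x => f (x + c) := hf.comp (contDiff_id.add contDiff_const)
  rw [h1, L.iteratedFDeriv_comp_right h2 t le_rfl, iteratedFDeriv_comp_add_right]

lemma enorm_iteratedFDeriv_comp_affine_le (L : V →L[ℝ] V') (c : V') (j : ℕ) {f : V' → F}
    (hf : ContDiff ℝ j f) (t : V) : ‖iteratedFDeriv ℝ j (fun t => f (L t + c)) t‖ₑ ≤
      ‖L‖ₑ ^ j * ‖iteratedFDeriv ℝ j f (L t + c)‖ₑ := by
  rw [iteratedFDeriv_comp_affine L c j hf, ← enorm_norm L, ← enorm_pow, ← enorm_norm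
    (iteratedFDeriv ℝ j f (L t + c)), ← enorm_mul, enorm_le_iff_norm_le]
  refine (ContinuousMultilinearMap.norm_compContinuousLinearMap_le _ _).trans ?_
  simp [mul_comm]

variable [MeasureSpace V] [BorelSpace V] [MeasureSpace V'] [BorelSpace V']

/-- Affine changes of variables. Of the Jacobian `κ` only finiteness and positivity are needed. -/
lemma exists_lintegral_comp_affine [(volume : Measure V).IsAddHaarMeasure] [FiniteDimensional ℝ V']
    [(volume : Measure V').IsAddHaarMeasure] (L : V ≃L[ℝ] V') (c : V') :
    ∃ κ : ℝ≥0∞, κ ≠ 0 ∧ κ ≠ ⊤ ∧ ∀ g : V' → ℝ≥0∞, ∫⁻ t, g (L t + c) = κ * ∫⁻ x, g x := by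
  have h : (Measure.map L (volume : Measure V)).IsAddHaarMeasure := L.isAddHaarMeasure_map _
  have h1 := Measure.isAddLeftInvariant_eq_smul (Measure.map L (volume : Measure V))
    (volume : Measure V')
  set κ := Measure.addHaarScalarFactor (Measure.map L (volume : Measure V)) (volume : Measure V')
  refine ⟨κ, ?_, ENNReal.coe_ne_top, fun g => ?_⟩
  · intro h0
    rw [ENNReal.coe_eq_zero] at h0
    rw [h0, zero_smul] at h1
    exact (NeZero.ne (Measure.map L (volume : Measure V))) h1
  · have := lintegral_map_equiv (μ := (volume : Measure V)) (fun x => g (x + c))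
      L.toHomeomorph.toMeasurableEquiv
    simp only [Homeomorph.toMeasurableEquiv_coe, ContinuousLinearEquiv.coe_toHomeomorph] at this
    rw [← this, h1]
    simp only [lintegral_smul_measure]
    rw [lintegral_add_right_eq_self (μ := (volume : Measure V')) g]
    rfl

lemma derivSq_comp_affine_le (L : V ≃L[ℝ] V') (c : V') {κ : ℝ≥0∞}
    (hκ : ∀ g : V' → ℝ≥0∞, ∫⁻ t, g (L t + c) = κ * ∫⁻ x, g x) (j : ℕ) {f : V' → F}
    (hf : ContDiff ℝ j f) {S : Set V'} (hS : MeasurableSet S) :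
    derivSq j (fun t => f (L t + c)) ((fun t => L t + c) ⁻¹' S) ≤
      ‖(L : V →L[ℝ] V')‖ₑ ^ (2 * j) * κ * derivSq j f S := by
  have hm : MeasurableSet ((fun t => L t + c) ⁻¹' S) :=
    (by fun_prop : Measurable fun t => L t + c) hS
  calc derivSq j (fun t => f (L t + c)) ((fun t => L t + c) ⁻¹' S)
      ≤ ∫⁻ t in ((fun t => L t + c) ⁻¹' S),
          ‖(L : V →L[ℝ] V')‖ₑ ^ (2 * j) * ‖iteratedFDeriv ℝ j f (L t + c)‖ₑ ^ 2 := by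
        refine lintegral_mono fun t => ?_
        rw [mul_comm 2, pow_mul, ← mul_pow]
        gcongr
        exact enorm_iteratedFDeriv_comp_affine_le (L : V →L[ℝ] V') c j hf t
    _ = ‖(L : V →L[ℝ] V')‖ₑ ^ (2 * j) *
          ∫⁻ t, S.indicator (fun x => ‖iteratedFDeriv ℝ j f x‖ₑ ^ 2) (L t + c) := by
        rw [lintegral_const_mul' _ _ (by simp), ← lintegral_indicator hm]
        rfl
    _ = _ := by
        rw [hκ, lintegral_indicator hS, mul_assoc]
        rfl

end affine

/-! ### Extension by reflection -/

section reflection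

universe u v

/-- A function whose derivatives of order at most `m` vanish on a hyperplane can be cut off there
without losing `C^m`. -/
lemma contDiff_indicator_halfSpace {V : Type u} {F : Type (max u v)} [NormedAddCommGroup V]
    [NormedSpace ℝ V] [NormedAddCommGroup F] [NormedSpace ℝ F] (ℓ : V →L[ℝ] ℝ) (m : ℕ)
    {d : V → F} (hd : ContDiff ℝ m d)
    (h : ∀ i ≤ m, ∀ x, ℓ x = 0 → iteratedFDeriv ℝ i d x = 0) :
    ContDiff ℝ m ({x | ℓ x < 0}.indicator d) := by
  induction m generalizing F with
  | zero =>
    have h0 : ∀ x, ℓ x = 0 → d x = 0 := fun x hx => by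
      have := h 0 le_rfl x hx
      rw [← norm_eq_zero, norm_iteratedFDeriv_zero, norm_eq_zero] at this
      exact this
    rw [Nat.cast_zero, contDiff_zero]
    exact continuous_indicator
      (fun x hx => h0 x (frontier_lt_subset_eq ℓ.continuous continuous_const hx))
      hd.continuous.continuousOn
  | succ m ih =>
    have h0 : ∀ x, ℓ x = 0 → d x = 0 := fun x hx => by
      have := h 0 (by omega) x hx
      rw [← norm_eq_zero, norm_iteratedFDeriv_zero, norm_eq_zero] at this
      exact this
    have hdiff : Differentiable ℝ d := hd.differentiable (by simp)
    have h1 : ∀ x, ℓ x = 0 → fderiv ℝ d x = 0 := fun x hx => by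
      have h2 : ‖iteratedFDeriv ℝ 0 (fderiv ℝ d) x‖ = ‖iteratedFDeriv ℝ 1 d x‖ :=
        norm_iteratedFDeriv_fderiv
      rw [norm_iteratedFDeriv_zero, h 1 (by omega) x hx, norm_zero] at h2
      exact norm_eq_zero.1 h2
    have key : ∀ x, HasFDerivAt ({x | ℓ x < 0}.indicator d)
        ({x | ℓ x < 0}.indicator (fderiv ℝ d) x) x := by
      intro x
      rcases lt_trichotomy (ℓ x) 0 with hx | hx | hx
      · rw [indicator_of_mem (by exact hx)]
        refine (hdiff x).hasFDerivAt.congr_of_eventuallyEq ?_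
        filter_upwards [(isOpen_lt ℓ.continuous continuous_const).mem_nhds hx] with y hy
        exact indicator_of_mem (by exact hy) _
      · have hn : x ∉ {x | ℓ x < 0} := by simp [hx]
        rw [indicator_of_notMem hn]
        have h2 := (hdiff x).hasFDerivAt
        rw [h1 x hx] at h2
        refine HasFDerivAt.of_isLittleO ((Asymptotics.IsBigO.of_bound' ?_).trans_isLittleO
          h2.isLittleO)
        refine Filter.Eventually.of_forall fun y => ?_
        rw [indicator_of_notMem hn, h0 x hx]
        simpa using norm_indicator_le_norm_self d y
      · have hn : x ∉ {x | ℓ x < 0} := by simp [hx.le]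
        rw [indicator_of_notMem hn]
        refine (hasFDerivAt_const (0 : F) x).congr_of_eventuallyEq ?_
        filter_upwards [(isOpen_lt continuous_const ℓ.continuous).mem_nhds hx] with y hy
        exact indicator_of_notMem (by simpa using (le_of_lt hy)) _
    rw [Nat.cast_succ, contDiff_succ_iff_fderiv]
    refine ⟨fun x => (key x).differentiableAt, by simp, ?_⟩
    have hf : fderiv ℝ ({x | ℓ x < 0}.indicator d) = {x | ℓ x < 0}.indicator (fderiv ℝ d) :=
      funext fun x => (key x).fderiv
    rw [hf]
    refine ih (hd.fderiv_right (m := m) (by simp)) fun i hi x hx => ?_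
    rw [← norm_eq_zero, norm_iteratedFDeriv_fderiv, h (i + 1) (by omega) x hx, norm_zero]

variable {V F : Type*} [NormedAddCommGroup V] [NormedSpace ℝ V]
  [NormedAddCommGroup F] [NormedSpace ℝ F]

/-- The weights of the higher order reflection: extrapolation from the nodes `-2, …, -(m + 2)`
to `0`. -/
lemma exists_reflection_weights (m : ℕ) : ∃ a : Fin (m + 1) → ℝ, ∀ s ≤ m,
    ∑ k, a k * (-((k : ℝ) + 1) - 1) ^ s = if s = 0 then 1 else 0 := by
  set v : Fin (m + 1) → ℝ := fun k => -((k : ℝ) + 1) - 1 with hv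
  have hinj : Function.Injective v := by
    intro i j hij
    simp only [hv] at hij
    have : (i : ℝ) = j := by linarith
    exact Fin.ext (by exact_mod_cast this)
  refine ⟨fun k => (Lagrange.basis Finset.univ v k).eval 0, fun s hs => ?_⟩
  have h := Lagrange.eq_interpolate_of_eval_eq (s := Finset.univ) (v := v)
    (f := (Polynomial.X ^ s : Polynomial ℝ)) (fun k => v k ^ s) hinj.injOn
    (by rw [Polynomial.degree_X_pow]; simp; exact_mod_cast Nat.lt_succ_of_le hs)
    (fun i _ => by simp)
  have h2 := congrArg (Polynomial.eval 0) h
  rw [Lagrange.interpolate_apply, Polynomial.eval_finsetSum] at h2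
  simp only [Polynomial.eval_pow, Polynomial.eval_X, Polynomial.eval_mul, Polynomial.eval_C] at h2
  rw [← zero_pow_eq, h2]
  exact Finset.sum_congr rfl fun _ _ => mul_comm _ _

/-- If the moments `∑ aₖ bₖˢ` vanish for `1 ≤ s ≤ i` and equal `1` for `s = 0`, then averaging a
multilinear form over the maps `v ↦ v + bₖ ℓ(v) e` reproduces it. -/
lemma sum_multilinear_shear {ι : Type*} [Fintype ι] (a b : ι → ℝ) {i : ℕ}
    (hab : ∀ s ≤ i, ∑ k, a k * b k ^ s = if s = 0 then 1 else 0) (ℓ : V →L[ℝ] ℝ) (e : V)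
    (M : ContinuousMultilinearMap ℝ (fun _ : Fin i => V) F) (v : Fin i → V) :
    ∑ k, a k • M (fun s => v s + b k • ℓ (v s) • e) = M v := by
  have h1 : ∀ k, M (fun s => v s + b k • ℓ (v s) • e) =
      ∑ T : Finset (Fin i), b k ^ (Tᶜ.card) • M (T.piecewise v fun s => ℓ (v s) • e) := by
    intro k
    have := M.toMultilinearMap.map_add_univ v fun s => b k • ℓ (v s) • e
    refine this.trans (Finset.sum_congr rfl fun T _ => ?_)
    have h2 := M.toMultilinearMap.map_piecewise_smul (fun _ => b k)
      (T.piecewise v fun s => ℓ (v s) • e) Tᶜ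
    rw [Finset.prod_const] at h2
    refine Eq.trans ?_ h2
    congr 1
    ext s
    by_cases hs : s ∈ T <;> simp [hs]
  simp_rw [h1, Finset.smul_sum, smul_smul]
  rw [Finset.sum_comm]
  simp_rw [← Finset.sum_smul]
  rw [Finset.sum_eq_single Finset.univ]
  · rw [hab _ (by simp)]
    simp
  · intro T _ hT
    rw [hab _ ((Finset.card_le_univ _).trans (by simp)), if_neg, zero_smul]
    simpa [Finset.card_eq_zero] using hT
  · simp

end reflection

section orthant

variable {n : ℕ} {F : Type*} [NormedAddCommGroup F] [NormedSpace ℝ F]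

/-- The set where all coordinates outside `s` are nonnegative; the closed orthant for `s = ∅`. -/
def partialOrthant (s : Finset (Fin n)) : Set (Fin n → ℝ) := {t | ∀ i ∉ s, 0 ≤ t i}

lemma measurableSet_partialOrthant (s : Finset (Fin n)) : MeasurableSet (partialOrthant s) := by
  have : partialOrthant s = ⋂ i : Fin n, ⋂ _ : i ∉ s, {t : Fin n → ℝ | 0 ≤ t i} := by
    ext; simp [partialOrthant]
  rw [this]
  exact MeasurableSet.iInter fun i => MeasurableSet.iInter fun _ =>
    measurableSet_le measurable_const (measurable_pi_apply i)

/-- The map `t ↦ t + (c - 1) t_l e_l`, which multiplies the coordinate `l` by `c`. -/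
noncomputable def scaleCoordMap (l : Fin n) (c : ℝ) : (Fin n → ℝ) →L[ℝ] (Fin n → ℝ) :=
  ContinuousLinearMap.id ℝ _ +
    (c - 1) • (ContinuousLinearMap.proj (R := ℝ) (φ := fun _ : Fin n => ℝ) l).smulRight
      (Pi.single l (1 : ℝ))

lemma scaleCoordMap_apply (l : Fin n) (c : ℝ) (t : Fin n → ℝ) (i : Fin n) :
    scaleCoordMap l c t i = if i = l then c * t l else t i := by
  by_cases h : i = l
  · subst h; simp [scaleCoordMap]; ring
  · simp [scaleCoordMap, h]

/-- Multiplication of the coordinate `l` by `c ≠ 0`, as an equivalence. -/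
noncomputable def scaleCoord (l : Fin n) (c : ℝ) (hc : c ≠ 0) : (Fin n → ℝ) ≃L[ℝ] (Fin n → ℝ) :=
  ContinuousLinearEquiv.equivOfInverse (scaleCoordMap l c) (scaleCoordMap l c⁻¹)
    (fun t => by ext i; by_cases h : i = l <;> simp [scaleCoordMap_apply, h, hc])
    (fun t => by ext i; by_cases h : i = l <;> simp [scaleCoordMap_apply, h, hc])

lemma scaleCoord_apply (l : Fin n) (c : ℝ) (hc : c ≠ 0) (t : Fin n → ℝ) (i : Fin n) :
    scaleCoord l c hc t i = if i = l then c * t l else t i := scaleCoordMap_apply l c t i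

lemma volume_coord_eq_zero (l : Fin n) : volume {t : Fin n → ℝ | t l = 0} = 0 := by
  have := Measure.addHaar_submodule (volume : Measure (Fin n → ℝ))
    (LinearMap.ker (LinearMap.proj l : (Fin n → ℝ) →ₗ[ℝ] ℝ)) (by
      intro h
      have h1 : (Pi.single l 1 : Fin n → ℝ) ∈
          LinearMap.ker (LinearMap.proj l : (Fin n → ℝ) →ₗ[ℝ] ℝ) := by rw [h]; trivial
      simp at h1)
  exact this

/-- Higher order reflection in one coordinate: for `t_l < 0` the extension is
`∑ₖ aₖ w(t₁, …, -(k + 1) t_l, …, tₙ)`, and the moment conditions on the weights `aₖ` make its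
derivatives of order at most `m` match those of `w` on the hyperplane `t_l = 0`. Only the values of
`w` on the partial orthant enter the bounds. -/
lemma exists_extension_step (m : ℕ) (l : Fin n) : ∃ C : ℝ≥0∞, C ≠ ⊤ ∧ ∀ s : Finset (Fin n),
    l ∉ s → ∀ w : (Fin n → ℝ) → F, ContDiff ℝ m w →
    (∀ t ∈ partialOrthant s, (∃ i, 1 < |t i|) → w t = 0) →
    ∃ W : (Fin n → ℝ) → F, ContDiff ℝ m W ∧ (∀ t ∈ partialOrthant s, W t = w t) ∧
      (∀ t ∈ partialOrthant (insert l s), (∃ i, 1 < |t i|) → W t = 0) ∧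
      derivSq m W (partialOrthant (insert l s)) ≤ C * derivSq m w (partialOrthant s) := by
  obtain ⟨a, ha⟩ := exists_reflection_weights m
  have hc : ∀ k : Fin (m + 1), -((k : ℝ) + 1) ≠ 0 := fun k => by
    have : (0 : ℝ) ≤ k := by positivity
    linarith
  set S : Fin (m + 1) → ((Fin n → ℝ) ≃L[ℝ] (Fin n → ℝ)) :=
    fun k => scaleCoord l (-((k : ℝ) + 1)) (hc k) with hS
  choose κ hκ0 hκt hκ using fun k => exists_lintegral_comp_affine (S k) 0
  set ℓ : (Fin n → ℝ) →L[ℝ] ℝ := ContinuousLinearMap.proj (R := ℝ) (φ := fun _ : Fin n => ℝ) l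
    with hℓ
  set D : ℝ≥0∞ := ∑ k, ‖a k‖ₑ ^ 2 * (‖(S k : (Fin n → ℝ) →L[ℝ] (Fin n → ℝ))‖ₑ ^ (2 * m) * κ k)
    with hD
  have hDt : D ≠ ⊤ := by
    refine ENNReal.sum_ne_top.2 fun k _ => ENNReal.mul_ne_top (by simp)
      (ENNReal.mul_ne_top (by simp) (hκt k))
  refine ⟨1 + ((m + 1 : ℕ) : ℝ≥0∞) ^ 2 * D, ENNReal.add_ne_top.2 ⟨by simp,
    ENNReal.mul_ne_top (by simp) hDt⟩, fun s hls w hw hv => ?_⟩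
  have hSk : ∀ k, ContDiff ℝ m fun t => w (S k t + 0) := fun k =>
    hw.comp ((S k).contDiff.add contDiff_const)
  set R : (Fin n → ℝ) → F := fun t => ∑ k, a k • w (S k t + 0) with hR
  have hRc : ContDiff ℝ m R := ContDiff.sum fun k _ => (hSk k).const_smul _
  have hRi : ∀ i : ℕ, i ≤ m → ∀ x, iteratedFDeriv ℝ i R x =
      ∑ k, a k • iteratedFDeriv ℝ i (fun t => w (S k t + 0)) x := by
    intro i hi x
    have hi' : (i : ℕ∞ω) ≤ m := by exact_mod_cast hi
    rw [hR, iteratedFDeriv_fun_sum_apply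
      (fun k _ => (((hSk k).const_smul (a k)).of_le hi').contDiffAt)]
    refine Finset.sum_congr rfl fun k _ => ?_
    exact iteratedFDeriv_const_smul_apply (a := a k) ((hSk k).of_le hi').contDiffAt
  have hSmem : ∀ k, ∀ t ∈ partialOrthant (insert l s), t l < 0 →
      S k t + 0 ∈ partialOrthant s := by
    intro k t ht htl i hi
    rw [add_zero, hS, scaleCoord_apply]
    split_ifs with h
    · have : (0 : ℝ) ≤ k := by positivity
      nlinarith
    · exact ht i (by simp [h, hi])
  -- `R` is the reflected function; `W` equals `w` for `t_l ≥ 0` and `R` for `t_l < 0`.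
  set W : (Fin n → ℝ) → F := w + {t | ℓ t < 0}.indicator (R - w) with hW
  have hWpos : ∀ t, 0 ≤ t l → W t = w t := fun t ht => by
    have : t ∉ {t | ℓ t < 0} := by simpa [hℓ] using ht
    rw [hW, Pi.add_apply, indicator_of_notMem this, add_zero]
  have hWneg : ∀ t, t l < 0 → W t = R t := fun t ht => by
    have : t ∈ {t | ℓ t < 0} := by simpa [hℓ] using ht
    rw [hW, Pi.add_apply, indicator_of_mem this, Pi.sub_apply, add_sub_cancel]
  refine ⟨W, ?_, fun t ht => hWpos t (ht l hls), ?_, ?_⟩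
  · refine hw.add (contDiff_indicator_halfSpace ℓ m (hRc.sub hw) fun i hi x hx => ?_)
    have hi' : (i : ℕ∞ω) ≤ m := by exact_mod_cast hi
    have hx' : x l = 0 := hx
    rw [iteratedFDeriv_sub_apply (hRc.of_le hi').contDiffAt (hw.of_le hi').contDiffAt,
      hRi i hi, sub_eq_zero]
    have hfix : ∀ k, S k x + 0 = x := fun k => by
      ext j
      rw [add_zero, hS, scaleCoord_apply]
      split_ifs with h
      · rw [h, hx']; simp
      · rfl
    ext v
    rw [sum_apply,
      ← sum_multilinear_shear a (fun k : Fin (m + 1) => -((k : ℝ) + 1) - 1)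
        (fun s hs => ha s (hs.trans hi)) ℓ (Pi.single l 1) (iteratedFDeriv ℝ i w x) v]
    refine Finset.sum_congr rfl fun k _ => ?_
    have := iteratedFDeriv_comp_affine (S k : (Fin n → ℝ) →L[ℝ] (Fin n → ℝ)) 0 i (hw.of_le hi') x
    simp only [ContinuousLinearEquiv.coe_coe] at this
    rw [smul_apply, this, hfix]
    rw [ContinuousMultilinearMap.compContinuousLinearMap_apply]
    rfl
  · rintro t ht ⟨i, hi⟩
    rcases le_or_gt 0 (t l) with h | h
    · rw [hWpos t h]
      refine hv t (fun j hj => ?_) ⟨i, hi⟩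
      by_cases hjl : j = l
      · rwa [hjl]
      · exact ht j (by simp [hjl, hj])
    · rw [hWneg t h]
      refine Finset.sum_eq_zero fun k _ => ?_
      rw [hv _ (hSmem k t ht h) ⟨i, ?_⟩, smul_zero]
      rw [add_zero, hS, scaleCoord_apply]
      split_ifs with h1
      · subst h1
        rw [abs_mul, abs_neg, abs_of_pos (by positivity : (0 : ℝ) < (k : ℝ) + 1)]
        have : (0 : ℝ) ≤ k := by positivity
        nlinarith
      · exact hi
  · set H := partialOrthant (insert l s) with hH
    have hHm : MeasurableSet H := measurableSet_partialOrthant _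
    have hp : MeasurableSet {t : Fin n → ℝ | 0 < t l} :=
      measurableSet_lt measurable_const (measurable_pi_apply l)
    have hn : MeasurableSet {t : Fin n → ℝ | t l < 0} :=
      measurableSet_lt (measurable_pi_apply l) measurable_const
    have hsub : H ⊆ (H ∩ {t | 0 < t l} ∪ H ∩ {t | t l < 0}) ∪ {t | t l = 0} := by
      intro t ht
      rcases lt_trichotomy (t l) 0 with h | h | h
      · exact Or.inl (Or.inr ⟨ht, h⟩)
      · exact Or.inr h
      · exact Or.inl (Or.inl ⟨ht, h⟩)
    have h0 : ∫⁻ x in {t : Fin n → ℝ | t l = 0}, ‖iteratedFDeriv ℝ m W x‖ₑ ^ 2 = 0 :=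
      setLIntegral_measure_zero _ _ (volume_coord_eq_zero l)
    have h1 : ∫⁻ x in H ∩ {t | 0 < t l}, ‖iteratedFDeriv ℝ m W x‖ₑ ^ 2 ≤
        derivSq m w (partialOrthant s) := by
      calc _ = ∫⁻ x in H ∩ {t | 0 < t l}, ‖iteratedFDeriv ℝ m w x‖ₑ ^ 2 := by
            refine setLIntegral_congr_fun (hHm.inter hp) fun t ht => ?_
            have : W =ᶠ[nhds t] w := by
              filter_upwards [(isOpen_lt continuous_const (continuous_apply l)).mem_nhds ht.2]
                with y hy
              exact hWpos y (le_of_lt hy)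
            rw [(this.iteratedFDeriv ℝ m).eq_of_nhds]
        _ ≤ _ := by
            refine lintegral_mono_set fun t ht i hi => ?_
            by_cases hil : i = l
            · rw [hil]; exact ht.2.le
            · exact ht.1 i (by simp [hil, hi])
    have h2 : ∫⁻ x in H ∩ {t | t l < 0}, ‖iteratedFDeriv ℝ m W x‖ₑ ^ 2 ≤
        ((m + 1 : ℕ) : ℝ≥0∞) ^ 2 * D * derivSq m w (partialOrthant s) := by
      calc _ = ∫⁻ x in H ∩ {t | t l < 0}, ‖iteratedFDeriv ℝ m R x‖ₑ ^ 2 := by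
            refine setLIntegral_congr_fun (hHm.inter hn) fun t ht => ?_
            have : W =ᶠ[nhds t] R := by
              filter_upwards [(isOpen_lt (continuous_apply l) continuous_const).mem_nhds ht.2]
                with y hy
              exact hWneg y hy
            rw [(this.iteratedFDeriv ℝ m).eq_of_nhds]
        _ ≤ ∫⁻ x in H ∩ {t | t l < 0}, ((m + 1 : ℕ) : ℝ≥0∞) ^ 2 *
              ∑ k, ‖a k‖ₑ ^ 2 * ‖iteratedFDeriv ℝ m (fun t => w (S k t + 0)) x‖ₑ ^ 2 := by
            refine lintegral_mono fun t => ?_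
            simp only
            rw [hRi m le_rfl]
            calc _ ≤ (∑ k, ‖a k • iteratedFDeriv ℝ m (fun t => w (S k t + 0)) t‖ₑ) ^ 2 := by
                  gcongr
                  exact enorm_sum_le Finset.univ fun k =>
                    a k • iteratedFDeriv ℝ m (fun t => w (S k t + 0)) t
              _ ≤ _ := sum_sq_le_card_sq_mul _ _
              _ = _ := by simp [enorm_smul, mul_pow]
        _ = ((m + 1 : ℕ) : ℝ≥0∞) ^ 2 * ∑ k, ‖a k‖ₑ ^ 2 *
              ∫⁻ x in H ∩ {t | t l < 0}, ‖iteratedFDeriv ℝ m (fun t => w (S k t + 0)) x‖ₑ ^ 2 := by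
            rw [lintegral_const_mul' _ _ (by simp), lintegral_finsetSum']
            · congr 2
              ext k
              rw [lintegral_const_mul' _ _ (by simp)]
            · intro k _
              have := (hSk k).continuous_iteratedFDeriv le_rfl
              fun_prop
        _ ≤ ((m + 1 : ℕ) : ℝ≥0∞) ^ 2 * ∑ k, ‖a k‖ₑ ^ 2 *
              (‖(S k : (Fin n → ℝ) →L[ℝ] (Fin n → ℝ))‖ₑ ^ (2 * m) * κ k *
                derivSq m w (partialOrthant s)) := by
            gcongr with k
            refine le_trans (lintegral_mono_set fun t ht => ?_) (derivSq_comp_affine_le (S k) 0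
              (hκ k) m hw (measurableSet_partialOrthant s))
            exact hSmem k t ht.1 ht.2
        _ = _ := by
            rw [hD, mul_assoc, Finset.sum_mul]
            simp only [mul_assoc]
    calc derivSq m W H
        ≤ ∫⁻ x in (H ∩ {t | 0 < t l} ∪ H ∩ {t | t l < 0}) ∪ {t | t l = 0},
          ‖iteratedFDeriv ℝ m W x‖ₑ ^ 2 := lintegral_mono_set hsub
      _ ≤ ((∫⁻ x in H ∩ {t | 0 < t l}, ‖iteratedFDeriv ℝ m W x‖ₑ ^ 2) +
          ∫⁻ x in H ∩ {t | t l < 0}, ‖iteratedFDeriv ℝ m W x‖ₑ ^ 2) +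
          ∫⁻ x in {t | t l = 0}, ‖iteratedFDeriv ℝ m W x‖ₑ ^ 2 := by
        exact (lintegral_union_le _ _ _).trans (add_le_add_left (lintegral_union_le _ _ _) _)
      _ ≤ _ := by
        rw [h0, add_zero, add_mul, one_mul]
        exact add_le_add h1 h2

/-- Extension of a function on the closed orthant to the whole space by successive reflections. -/
lemma exists_extension (F : Type*) [NormedAddCommGroup F] [NormedSpace ℝ F] (n m : ℕ) :
    ∃ C : ℝ≥0∞, C ≠ ⊤ ∧ ∀ w : (Fin n → ℝ) → F, ContDiff ℝ m w →
    (∀ t ∈ partialOrthant ∅, (∃ i, 1 < |t i|) → w t = 0) →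
    ∃ W : (Fin n → ℝ) → F, ContDiff ℝ m W ∧ (∀ t ∈ partialOrthant ∅, W t = w t) ∧
      (∀ t, (∃ i, 1 < |t i|) → W t = 0) ∧
      derivSq m W univ ≤ C * derivSq m w (partialOrthant ∅) := by
  have key : ∀ s : Finset (Fin n), ∃ C : ℝ≥0∞, C ≠ ⊤ ∧ ∀ w : (Fin n → ℝ) → F, ContDiff ℝ m w →
      (∀ t ∈ partialOrthant ∅, (∃ i, 1 < |t i|) → w t = 0) →
      ∃ W : (Fin n → ℝ) → F, ContDiff ℝ m W ∧ (∀ t ∈ partialOrthant ∅, W t = w t) ∧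
      (∀ t ∈ partialOrthant s, (∃ i, 1 < |t i|) → W t = 0) ∧
      derivSq m W (partialOrthant s) ≤ C * derivSq m w (partialOrthant ∅) := by
    intro s
    induction s using Finset.induction_on with
    | empty => exact ⟨1, by simp, fun w hw hv => ⟨w, hw, fun _ _ => rfl, hv, by simp⟩⟩
    | insert l s hl ih =>
      obtain ⟨C, hC, h⟩ := ih
      obtain ⟨C', hC', h'⟩ := exists_extension_step (F := F) m l
      refine ⟨C' * C, ENNReal.mul_ne_top hC' hC, fun w hw hv => ?_⟩
      obtain ⟨W, hW, hWw, hWv, hWd⟩ := h w hw hv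
      obtain ⟨W', hW', hWw', hWv', hWd'⟩ := h' s hl W hW hWv
      refine ⟨W', hW', fun t ht => ?_, hWv', hWd'.trans ?_⟩
      · rw [hWw' t fun i _ => ht i (by simp), hWw t ht]
      · rw [mul_assoc]
        gcongr
  obtain ⟨C, hC, h⟩ := key Finset.univ
  have hu : partialOrthant (Finset.univ : Finset (Fin n)) = univ := by ext; simp [partialOrthant]
  refine ⟨C, hC, fun w hw hv => ?_⟩
  obtain ⟨W, hW, hWw, hWv, hWd⟩ := h w hw hv
  rw [hu] at hWd
  exact ⟨W, hW, hWw, fun t ht => hWv t (by simp [hu]) ht, hWd⟩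

end orthant

/-! ### A polynomial kernel of Jackson type -/

section kernel

open Polynomial in
lemma abs_eval_T_sin (M : ℕ) (φ : ℝ) :
    |(Chebyshev.T ℝ (2 * M + 1 : ℕ)).eval (Real.sin φ)| = |Real.sin ((2 * M + 1 : ℕ) * φ)| := by
  rw [← Real.cos_pi_div_two_sub, Chebyshev.T_real_cos]
  have : (((2 * M + 1 : ℕ) : ℤ) : ℝ) * (Real.pi / 2 - φ) =
      (Real.pi / 2 - (2 * M + 1 : ℕ) * φ) + M * Real.pi := by push_cast; ring
  rw [this, Real.cos_add_nat_mul_pi, Real.cos_pi_div_two_sub, abs_mul, abs_pow]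
  simp

open Polynomial in
/-- The polynomial `T_N(y) / (N y)` for odd `N = 2 M + 1`. -/
noncomputable def dirichletPoly (M : ℕ) : ℝ[X] :=
  C ((2 * M + 1 : ℕ) : ℝ)⁻¹ * (Chebyshev.T ℝ (2 * M + 1 : ℕ)).divX

open Polynomial in
lemma natDegree_dirichletPoly_le (M : ℕ) : (dirichletPoly M).natDegree ≤ 2 * M := by
  refine (natDegree_C_mul_le _ _).trans ?_
  rw [natDegree_divX_eq_natDegree_tsub_one, Chebyshev.natDegree_T]
  omega

open Polynomial in
lemma mul_eval_dirichletPoly (M : ℕ) (y : ℝ) : (2 * M + 1 : ℕ) * y * (dirichletPoly M).eval y =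
    (Chebyshev.T ℝ (2 * M + 1 : ℕ)).eval y := by
  have h0 : (Chebyshev.T ℝ (2 * M + 1 : ℕ)).coeff 0 = 0 := by
    rw [coeff_zero_eq_eval_zero, ← abs_eq_zero, ← Real.sin_zero, abs_eval_T_sin]
    simp
  conv_rhs => rw [← divX_mul_X_add (Chebyshev.T ℝ (2 * M + 1 : ℕ)), h0]
  have : ((2 * M + 1 : ℕ) : ℝ) ≠ 0 := by positivity
  simp only [dirichletPoly, eval_mul, eval_C, eval_add, eval_X]
  field_simp
  simp

lemma exists_sin_eq {y : ℝ} (hy : y ∈ Icc (-1 : ℝ) 1) :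
    ∃ φ, Real.sin φ = y ∧ |φ| ≤ Real.pi / 2 * |y| := by
  refine ⟨Real.arcsin y, Real.sin_arcsin hy.1 hy.2, ?_⟩
  have hpos : ∀ z ∈ Icc (0 : ℝ) 1, Real.arcsin z ≤ Real.pi / 2 * z := by
    intro z hz
    have h1 := Real.mul_le_sin (Real.arcsin_nonneg.2 hz.1) (Real.arcsin_le_pi_div_two z)
    rw [Real.sin_arcsin (by linarith [hz.1]) hz.2] at h1
    calc Real.arcsin z = Real.pi / 2 * (2 / Real.pi * Real.arcsin z) := by
          field_simp
      _ ≤ _ := by gcongr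
  rcases le_total 0 y with h | h
  · rw [abs_of_nonneg h, abs_of_nonneg (Real.arcsin_nonneg.2 h)]
    exact hpos y ⟨h, hy.2⟩
  · rw [abs_of_nonpos h, abs_of_nonpos (Real.arcsin_nonpos.2 h), ← Real.arcsin_neg]
    exact hpos (-y) ⟨by linarith, by linarith [hy.1]⟩

/-- The kernel is bounded near the origin and decays like `1 / (N y)`. -/
lemma dirichletPoly_upper (M : ℕ) {y : ℝ} (hy : y ∈ Icc (-1 : ℝ) 1) :
    (1 + ((2 * M + 1 : ℕ) * y) ^ 2) * (dirichletPoly M).eval y ^ 2 ≤ 4 := by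
  set N : ℝ := ((2 * M + 1 : ℕ) : ℝ) with hN
  have hN0 : 0 < N := by rw [hN]; positivity
  have key : ∀ y ∈ Icc (-1 : ℝ) 1, y ≠ 0 →
      (1 + (N * y) ^ 2) * (dirichletPoly M).eval y ^ 2 ≤ 4 := by
    intro y hy hy0
    obtain ⟨φ, hφ, hφy⟩ := exists_sin_eq hy
    have h1 : |N * y * (dirichletPoly M).eval y| = |Real.sin (N * φ)| := by
      rw [hN, mul_eval_dirichletPoly, ← hφ, abs_eval_T_sin]
    have h2 : (N * y * (dirichletPoly M).eval y) ^ 2 ≤ 1 := by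
      rw [← sq_abs, h1, sq_abs]
      exact Real.sin_sq_le_one _
    have h3 : |(dirichletPoly M).eval y| ≤ Real.pi / 2 := by
      have h4 : N * |y| * |(dirichletPoly M).eval y| ≤ N * |y| * (Real.pi / 2) := by
        calc N * |y| * |(dirichletPoly M).eval y| = |N * y * (dirichletPoly M).eval y| := by
              rw [abs_mul, abs_mul, abs_of_pos hN0]
          _ = |Real.sin (N * φ)| := h1
          _ ≤ |N * φ| := Real.abs_sin_le_abs
          _ = N * |φ| := by rw [abs_mul, abs_of_pos hN0]
          _ ≤ N * (Real.pi / 2 * |y|) := by gcongr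
          _ = _ := by ring
      exact le_of_mul_le_mul_left h4 (by positivity)
    have h4 : (dirichletPoly M).eval y ^ 2 ≤ 3 := by
      rw [← sq_abs]
      have := Real.pi_lt_d2
      nlinarith [abs_nonneg ((dirichletPoly M).eval y)]
    nlinarith
  by_cases hy0 : y = 0
  · subst hy0
    have hc : Continuous fun y : ℝ => (1 + (N * y) ^ 2) * (dirichletPoly M).eval y ^ 2 := by
      fun_prop
    refine le_of_tendsto (hc.continuousWithinAt (s := {0}ᶜ) (x := 0)) ?_
    have h1 : Icc (-1 : ℝ) 1 ∈ nhdsWithin (0 : ℝ) {0}ᶜ :=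
      mem_nhdsWithin_of_mem_nhds (Icc_mem_nhds (by norm_num) (by norm_num))
    filter_upwards [h1, self_mem_nhdsWithin] with z hz hz0
    exact key z hz hz0
  · exact key y hy hy0

lemma dirichletPoly_lower (M : ℕ) {y : ℝ} (hy0 : 0 < y) (hy : (2 * M + 1 : ℕ) * y ≤ 1) :
    (2 / Real.pi) ^ 2 ≤ (dirichletPoly M).eval y ^ 2 := by
  set N : ℝ := ((2 * M + 1 : ℕ) : ℝ) with hN
  have hN1 : 1 ≤ N := by rw [hN]; push_cast; linarith [(Nat.cast_nonneg M : (0 : ℝ) ≤ M)]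
  have hy1 : y ≤ 1 := by nlinarith
  obtain ⟨φ, hφ, hφy⟩ := exists_sin_eq (y := y) ⟨by linarith, hy1⟩
  rw [abs_of_pos hy0] at hφy
  have h1 : |N * y * (dirichletPoly M).eval y| = |Real.sin (N * φ)| := by
    rw [hN, mul_eval_dirichletPoly, ← hφ, abs_eval_T_sin]
  have hs : ∀ ψ : ℝ, |ψ| ≤ Real.pi / 2 → 2 / Real.pi * |ψ| ≤ |Real.sin ψ| := by
    intro ψ hψ
    rcases le_total 0 ψ with h | h
    · rw [abs_of_nonneg h] at *
      exact (Real.mul_le_sin h hψ).trans (le_abs_self _)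
    · rw [abs_of_nonpos h] at *
      have := Real.mul_le_sin (x := -ψ) (by linarith) hψ
      rw [Real.sin_neg] at this
      exact this.trans (neg_le_abs _)
  have h2 : 2 / Real.pi * |N * φ| ≤ |Real.sin (N * φ)| := by
    refine hs _ ?_
    rw [abs_mul, abs_of_pos (by linarith)]
    calc N * |φ| ≤ N * (Real.pi / 2 * y) := by gcongr
      _ = Real.pi / 2 * (N * y) := by ring
      _ ≤ Real.pi / 2 * 1 := by gcongr
      _ = _ := mul_one _
  have h3 : y ≤ |φ| := by
    rw [← hφ]
    exact (le_abs_self _).trans Real.abs_sin_le_abs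
  have h4 : N * y * (2 / Real.pi) ≤ N * y * |(dirichletPoly M).eval y| := by
    calc N * y * (2 / Real.pi) ≤ N * |φ| * (2 / Real.pi) := by gcongr
      _ = 2 / Real.pi * |N * φ| := by rw [abs_mul, abs_of_pos (by linarith : 0 < N)]; ring
      _ ≤ |Real.sin (N * φ)| := h2
      _ = _ := by rw [← h1, abs_mul, abs_of_pos (by positivity : 0 < N * y)]
  have h5 := le_of_mul_le_mul_left h4 (by positivity)
  rw [← sq_abs ((dirichletPoly M).eval y)]
  gcongr

/-- A nonnegative polynomial kernel of degree proportional to `M` on `[-2, 2]`, concentrated at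
distance `1 / (2 M + 1)` from the origin. -/
lemma exists_jackson_poly (m : ℕ) : ∃ C : ℝ, 0 < C ∧ ∀ M : ℕ, ∃ q : Polynomial ℝ,
    q.natDegree ≤ 4 * M * (m + 1) ∧ (∀ z, 0 ≤ q.eval z) ∧
    ∫ z in Icc (-2 : ℝ) 2, q.eval z = 1 ∧
    ∀ r ≤ m, ∫ z in Icc (-2 : ℝ) 2, z ^ (2 * r) * q.eval z ≤ C / (2 * M + 1 : ℕ) ^ (2 * r) := by
  refine ⟨4 ^ m * (4 ^ (m + 1) * Real.pi * (Real.pi / 2) ^ (2 * (m + 1))), by positivity,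
    fun M => ?_⟩
  set N : ℝ := ((2 * M + 1 : ℕ) : ℝ) with hN
  have hN1 : 1 ≤ N := by rw [hN]; push_cast; linarith [(Nat.cast_nonneg M : (0 : ℝ) ≤ M)]
  -- The power `2 (m + 1)` gives the decay `(N y)^(-2 (m + 1))`, enough for moments up to `2 m`.
  set w : ℝ → ℝ := fun y => (dirichletPoly M).eval y ^ (2 * (m + 1)) with hw
  have hwc : Continuous w := by fun_prop
  have hw0 : ∀ y, 0 ≤ w y := fun y => (even_two_mul _).pow_nonneg _
  set Z : ℝ := ∫ y in (-1 : ℝ)..1, w y with hZ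
  -- The mass in `[0, 1 / N]` bounds the normalization constant from below.
  have hZl : (2 / Real.pi) ^ (2 * (m + 1)) / N ≤ Z := by
    calc (2 / Real.pi) ^ (2 * (m + 1)) / N
        = ∫ _ in (0 : ℝ)..(1 / N), (2 / Real.pi) ^ (2 * (m + 1)) := by
          rw [intervalIntegral.integral_const, smul_eq_mul]; ring
      _ ≤ ∫ y in (0 : ℝ)..(1 / N), w y := by
          refine intervalIntegral.integral_mono_on_of_le_Ioo (by positivity) (by simp)
            (hwc.intervalIntegrable _ _) fun y hy => ?_
          rw [hw]
          simp only [pow_mul]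
          have h2 : N * y ≤ 1 := by
            have := hy.2.le
            rw [le_div_iff₀ (by linarith)] at this
            linarith
          exact pow_le_pow_left₀ (by positivity) (dirichletPoly_lower M hy.1 h2) _
      _ ≤ Z := by
          refine intervalIntegral.integral_mono_interval (by norm_num) (by positivity) ?_
            (Filter.Eventually.of_forall fun y => hw0 y) (hwc.intervalIntegrable _ _)
          rw [div_le_one (by linarith)]
          exact hN1
  have hZ0 : 0 < Z := lt_of_lt_of_le (by positivity) hZl
  have hmom : ∀ r ≤ m, ∫ y in (-1 : ℝ)..1, (N * y) ^ (2 * r) * w y ≤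
      4 ^ (m + 1) * Real.pi / N := by
    intro r hr
    have hint : Integrable fun y : ℝ => (1 + (N * y) ^ 2)⁻¹ :=
      integrable_inv_one_add_sq.comp_mul_left' (by linarith : N ≠ 0)
    calc ∫ y in (-1 : ℝ)..1, (N * y) ^ (2 * r) * w y
        ≤ ∫ y in (-1 : ℝ)..1, 4 ^ (m + 1) * (1 + (N * y) ^ 2)⁻¹ := by
          refine intervalIntegral.integral_mono_on (by norm_num)
            (Continuous.intervalIntegrable (by fun_prop) _ _)
            (hint.const_mul _).intervalIntegrable fun y hy => ?_
          have h1 := dirichletPoly_upper M hy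
          rw [← hN] at h1
          set A := 1 + (N * y) ^ 2 with hA
          have hA1 : 1 ≤ A := by rw [hA]; nlinarith [sq_nonneg (N * y)]
          have h2 : (dirichletPoly M).eval y ^ 2 ≤ 4 / A := by
            rw [le_div_iff₀ (by linarith)]; linarith
          calc (N * y) ^ (2 * r) * w y ≤ A ^ m * (4 / A) ^ (m + 1) := by
                rw [hw]
                simp only [pow_mul]
                gcongr
                calc ((N * y) ^ 2) ^ r ≤ A ^ r := by
                      gcongr; rw [hA]; linarith
                  _ ≤ A ^ m := pow_le_pow_right₀ hA1 hr
            _ = 4 ^ (m + 1) * A⁻¹ := by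
                rw [div_pow, pow_succ A]
                field_simp
      _ ≤ ∫ y : ℝ, 4 ^ (m + 1) * (1 + (N * y) ^ 2)⁻¹ := by
          rw [intervalIntegral.integral_of_le (by norm_num)]
          exact setIntegral_le_integral (hint.const_mul _)
            (Filter.Eventually.of_forall fun y => by positivity)
      _ = _ := by
          rw [integral_const_mul, Measure.integral_comp_mul_left (fun y => (1 + y ^ 2)⁻¹) N,
            integral_univ_inv_one_add_sq, abs_of_pos (by positivity), smul_eq_mul]
          ring
  set q : Polynomial ℝ := Polynomial.C (2 * Z)⁻¹ *
    ((dirichletPoly M).comp (Polynomial.C 2⁻¹ * Polynomial.X)) ^ (2 * (m + 1)) with hq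
  have hqe : ∀ z, q.eval z = (2 * Z)⁻¹ * w (z / 2) := by
    intro z
    simp only [hq, hw, Polynomial.eval_mul, Polynomial.eval_C, Polynomial.eval_pow,
      Polynomial.eval_comp, Polynomial.eval_X]
    rw [(by ring : (2 : ℝ)⁻¹ * z = z / 2)]
  refine ⟨q, ?_, fun z => ?_, ?_, fun r hr => ?_⟩
  · refine (Polynomial.natDegree_C_mul_le _ _).trans ((Polynomial.natDegree_pow_le).trans ?_)
    have h1 : ((dirichletPoly M).comp (Polynomial.C 2⁻¹ * Polynomial.X)).natDegree ≤ 2 * M := by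
      rw [Polynomial.natDegree_comp, Polynomial.natDegree_C_mul_X _ (by norm_num), mul_one]
      exact natDegree_dirichletPoly_le M
    calc _ ≤ 2 * (m + 1) * (2 * M) := by gcongr
      _ = _ := by ring
  · rw [hqe]
    have := hw0 (z / 2)
    positivity
  · rw [integral_Icc_eq_integral_Ioc, ← intervalIntegral.integral_of_le (by norm_num)]
    simp_rw [hqe]
    rw [intervalIntegral.integral_const_mul, intervalIntegral.integral_comp_div w (by norm_num)]
    norm_num
    rw [← hZ]
    field_simp
  · rw [integral_Icc_eq_integral_Ioc, ← intervalIntegral.integral_of_le (by norm_num)]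
    have h1 : ∀ z, z ^ (2 * r) * q.eval z = (2 * Z)⁻¹ * (2 / N) ^ (2 * r) *
        (fun y => (N * y) ^ (2 * r) * w y) (z / 2) := by
      intro z
      rw [hqe]
      simp only
      have : z ^ (2 * r) = (2 / N) ^ (2 * r) * (N * (z / 2)) ^ (2 * r) := by
        rw [← mul_pow]; congr 1; field_simp
      rw [this]; ring
    simp_rw [h1]
    rw [intervalIntegral.integral_const_mul,
      intervalIntegral.integral_comp_div (fun y => (N * y) ^ (2 * r) * w y) (by norm_num)]
    have h3 := hmom r hr
    norm_num only [smul_eq_mul] at h3 ⊢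
    calc (2 * Z)⁻¹ * (2 / N) ^ (2 * r) * (2 * ∫ y in (-1 : ℝ)..1, (N * y) ^ (2 * r) * w y)
        = (2 / N) ^ (2 * r) * ((∫ y in (-1 : ℝ)..1, (N * y) ^ (2 * r) * w y) / Z) := by
          field_simp
      _ ≤ (2 / N) ^ (2 * r) *
          ((4 ^ (m + 1) * Real.pi / N) / ((2 / Real.pi) ^ (2 * (m + 1)) / N)) := by
          gcongr
      _ = 4 ^ r * (4 ^ (m + 1) * Real.pi * (Real.pi / 2) ^ (2 * (m + 1))) / N ^ (2 * r) := by
          rw [div_pow 2 N, pow_mul 2 2 r, div_pow 2 Real.pi, div_pow Real.pi 2]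
          norm_num only
          field_simp
      _ ≤ _ := by
          gcongr
          norm_num

end kernel

/-! ### Averages of translates and of higher differences -/

section average

universe u v

/-- The average `x ↦ ∫ f(x + c z) dμ(z)`. -/
noncomputable def translateAvg {V F : Type*} [NormedAddCommGroup V] [NormedSpace ℝ V]
    [MeasurableSpace V] [NormedAddCommGroup F] [NormedSpace ℝ F] (μ : Measure V) (c : ℝ)
    (f : V → F) : V → F := fun x => ∫ z, f (x + c • z) ∂μ

lemma hasFDerivAt_translateAvg {V F : Type*} [NormedAddCommGroup V] [NormedSpace ℝ V]
    [MeasurableSpace V] [BorelSpace V] [SecondCountableTopology V] [NormedAddCommGroup F]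
    [NormedSpace ℝ F] (μ : Measure V) [IsFiniteMeasure μ] (c : ℝ) {f : V → F}
    (hf : ContDiff ℝ 1 f) (hs : HasCompactSupport f) (x : V) :
    HasFDerivAt (translateAvg μ c f) (translateAvg μ c (fderiv ℝ f) x) x := by
  have hd := hf.continuous_fderiv (by norm_num)
  obtain ⟨B, hB⟩ := hd.bounded_above_of_compact_support (hs.fderiv (𝕜 := ℝ))
  obtain ⟨B', hB'⟩ := hf.continuous.bounded_above_of_compact_support hs
  refine hasFDerivAt_integral_of_dominated_of_fderiv_le (bound := fun _ => B) (s := univ)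
    (F' := fun x z => fderiv ℝ f (x + c • z)) Filter.univ_mem
    (Filter.Eventually.of_forall fun y => ?_) ?_ ?_ ?_ ?_ ?_
  · exact (hf.continuous.comp (by fun_prop)).aestronglyMeasurable
  · exact (integrable_const B').mono' (hf.continuous.comp (by fun_prop)).aestronglyMeasurable
      (Filter.Eventually.of_forall fun z => hB' _)
  · exact (hd.comp (by fun_prop)).aestronglyMeasurable
  · exact Filter.Eventually.of_forall fun z y _ => hB _
  · exact integrable_const B
  · refine Filter.Eventually.of_forall fun z y _ => ?_
    have h1 := ((hf.differentiable (by norm_num)) (y + c • z)).hasFDerivAt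
    exact h1.comp y ((hasFDerivAt_id y).add_const (c • z))

lemma contDiff_translateAvg {V : Type u} {F : Type (max u v)} [NormedAddCommGroup V]
    [NormedSpace ℝ V] [MeasurableSpace V] [BorelSpace V] [SecondCountableTopology V]
    [NormedAddCommGroup F] [NormedSpace ℝ F] (μ : Measure V) [IsFiniteMeasure μ] (c : ℝ) (j : ℕ)
    {f : V → F} (hf : ContDiff ℝ j f) (hs : HasCompactSupport f) :
    ContDiff ℝ j (translateAvg μ c f) ∧
      iteratedFDeriv ℝ j (translateAvg μ c f) = translateAvg μ c (iteratedFDeriv ℝ j f) := by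
  induction j generalizing F with
  | zero =>
    refine ⟨?_, ?_⟩
    · rw [Nat.cast_zero, contDiff_zero]
      obtain ⟨B', hB'⟩ := hf.continuous.bounded_above_of_compact_support hs
      refine continuous_of_dominated (bound := fun _ => B')
        (fun y => (hf.continuous.comp (by fun_prop)).aestronglyMeasurable)
        (fun y => Filter.Eventually.of_forall fun z => hB' _) (integrable_const B')
        (Filter.Eventually.of_forall fun z => hf.continuous.comp (by fun_prop))
    · ext1 x
      simp only [iteratedFDeriv_zero_eq_comp, translateAvg, Function.comp_apply]
      exact ((continuousMultilinearCurryFin0 ℝ V F).symm.toContinuousLinearEquiv.integral_comp_comm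
        _).symm
  | succ j ih =>
    have h1 : ContDiff ℝ 1 f := hf.of_le (by exact_mod_cast Nat.le_add_left 1 j)
    have hfd : fderiv ℝ (translateAvg μ c f) = translateAvg μ c (fderiv ℝ f) :=
      funext fun x => (hasFDerivAt_translateAvg μ c h1 hs x).fderiv
    obtain ⟨h2, h3⟩ := ih (hf.fderiv_right (m := j) (by simp)) (hs.fderiv (𝕜 := ℝ))
    refine ⟨?_, ?_⟩
    · rw [Nat.cast_succ, contDiff_succ_iff_fderiv]
      exact ⟨fun x => (hasFDerivAt_translateAvg μ c h1 hs x).differentiableAt, by simp,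
        hfd ▸ h2⟩
    · ext1 x
      rw [iteratedFDeriv_succ_eq_comp_right, Function.comp_apply]
      simp only [hfd, h3]
      simp only [translateAvg, iteratedFDeriv_succ_eq_comp_right, Function.comp_apply]
      let I : ContinuousMultilinearMap ℝ (fun _ : Fin j => V) (V →L[ℝ] F) ≃L[ℝ]
          ContinuousMultilinearMap ℝ (fun _ : Fin (j + 1) => V) F :=
        (continuousMultilinearCurryRightEquiv' ℝ j V F).symm.toContinuousLinearEquiv
      exact (ContinuousLinearEquiv.integral_comp_comm (𝕜 := ℝ) (μ := μ)
        (E := ContinuousMultilinearMap ℝ (fun _ : Fin j => V) (V →L[ℝ] F))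
        (F := ContinuousMultilinearMap ℝ (fun _ : Fin (j + 1) => V) F) I _).symm

variable {V F : Type*} [NormedAddCommGroup V] [NormedSpace ℝ V] [NormedAddCommGroup F]
  [NormedSpace ℝ F]

lemma contDiff_fwdDiff_iter {k : ℕ∞ω} (z : V) (r : ℕ) {g : V → F} (hg : ContDiff ℝ k g) :
    ContDiff ℝ k ((fwdDiff z)^[r] g) := by
  induction r with
  | zero => exact hg
  | succ r ih =>
    rw [Function.iterate_succ_apply']
    exact (ih.comp (contDiff_id.add contDiff_const)).sub ih

lemma fderiv_fwdDiff_iter (z : V) (r : ℕ) {g : V → F} (hg : ContDiff ℝ 1 g) :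
    fderiv ℝ ((fwdDiff z)^[r] g) = (fwdDiff z)^[r] (fderiv ℝ g) := by
  induction r with
  | zero => rfl
  | succ r ih =>
    have hd := (contDiff_fwdDiff_iter z r hg).differentiable (by norm_num)
    rw [Function.iterate_succ_apply', Function.iterate_succ_apply', ← ih]
    ext1 x
    have : fwdDiff z ((fwdDiff z)^[r] g) =
        (fun x => ((fwdDiff z)^[r] g) (x + z)) - (fwdDiff z)^[r] g := rfl
    have h1 : DifferentiableAt ℝ (fun x => ((fwdDiff z)^[r] g) (x + z)) x :=
      (hd _).comp x (differentiableAt_id.add_const z)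
    rw [this, fderiv_sub h1 (hd x), fderiv_comp_add_right]
    rfl

/-- Differences commute with additive maps. -/
lemma fwdDiff_iter_map {A B : Type*} [AddCommGroup A] [AddCommGroup B] {I : A → B}
    (hI : ∀ a b, I (a - b) = I a - I b) {V : Type*} [AddCommGroup V] (z : V) (r : ℕ) (g : V → A) :
    (fwdDiff z)^[r] (fun x => I (g x)) = fun x => I ((fwdDiff z)^[r] g x) := by
  induction r with
  | zero => rfl
  | succ r ih =>
    rw [Function.iterate_succ_apply', Function.iterate_succ_apply', ih]
    ext1 x
    simp [fwdDiff, hI]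

variable [MeasureSpace V] [BorelSpace V]

/-- The average of the differences `Δ_z^m f(x)` over `z`. -/
noncomputable def diffAvg {V : Type*} [NormedAddCommGroup V] [MeasurableSpace V] (μ : Measure V)
    (m : ℕ) (f : V → F) : V → F :=
  fun x => ∫ z, (fwdDiff z)^[m] f x ∂μ

/-- The average of the `m`-th differences as a combination of averages of translates. -/
lemma diffAvg_eq_sum [SecondCountableTopology V] {μ : Measure V} [IsFiniteMeasure μ] (m : ℕ)
    {f : V → F} (hf : Continuous f) (hs : HasCompactSupport f) :
    diffAvg μ m f = fun x => ∑ k ∈ Finset.range (m + 1),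
      (((-1 : ℤ) ^ (m - k) * m.choose k : ℤ) : ℝ) • translateAvg μ k f x := by
  obtain ⟨B, hB⟩ := hf.bounded_above_of_compact_support hs
  ext1 x
  have h : ∀ z, (fwdDiff z)^[m] f x = ∑ k ∈ Finset.range (m + 1),
      (((-1 : ℤ) ^ (m - k) * m.choose k : ℤ) : ℝ) • f (x + (k : ℝ) • z) := by
    intro z
    rw [fwdDiff_iter_eq_sum_shift]
    refine Finset.sum_congr rfl fun k _ => ?_
    rw [← Int.cast_smul_eq_zsmul ℝ, ← Nat.cast_smul_eq_nsmul ℝ]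
  simp only [diffAvg, h, translateAvg]
  rw [integral_finsetSum]
  · exact Finset.sum_congr rfl fun k _ => integral_smul _ _
  · intro k _
    refine Integrable.smul _ ((integrable_const B).mono'
      (hf.comp (by fun_prop)).aestronglyMeasurable (Filter.Eventually.of_forall fun z => hB _))

lemma continuous_fwdDiff_iter_uncurry {V F : Type*} [NormedAddCommGroup V]
    [NormedAddCommGroup F] (m : ℕ) {f : V → F} (hf : Continuous f) :
    Continuous fun p : V × V => (fwdDiff p.2)^[m] f p.1 := by
  simp only [fwdDiff_iter_eq_sum_shift]
  refine continuous_finsetSum _ fun k _ => ?_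
  have h : Continuous fun p : V × V => f (p.1 + k • p.2) := hf.comp (by fun_prop)
  exact h.const_smul (((-1 : ℤ) ^ (m - k) * m.choose k : ℤ))

variable [(volume : Measure V).IsAddHaarMeasure]

/-- The difference operators are bounded on `L²`. -/
lemma lintegral_fwdDiff_iter_bounded {g : V → F} (hg : Continuous g) (z : V) (r : ℕ) :
    ∫⁻ x, ‖(fwdDiff z)^[r] g x‖ₑ ^ 2 ≤ 8 ^ r * ∫⁻ x, ‖g x‖ₑ ^ 2 := by
  induction r with
  | zero => simp
  | succ r ih =>
    have hc : Continuous ((fwdDiff z)^[r] g) :=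
      contDiff_zero.1 (contDiff_fwdDiff_iter z r (contDiff_zero.2 hg))
    rw [Function.iterate_succ_apply']
    set f := (fwdDiff z)^[r] g with hf
    calc ∫⁻ x, ‖fwdDiff z f x‖ₑ ^ 2 ≤ ∫⁻ x, 4 * (‖f (x + z)‖ₑ ^ 2 + ‖f x‖ₑ ^ 2) := by
          refine lintegral_mono fun x => ?_
          have := enorm_add_sq_le (f (x + z)) (-f x)
          rwa [enorm_neg, ← sub_eq_add_neg] at this
      _ = 4 * ((∫⁻ x, ‖f x‖ₑ ^ 2) + ∫⁻ x, ‖f x‖ₑ ^ 2) := by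
          rw [lintegral_const_mul' _ _ (by simp), lintegral_add_left]
          · rw [lintegral_add_right_eq_self (fun x => ‖f x‖ₑ ^ 2)]
          · have : Continuous fun x => f (x + z) := hc.comp (by fun_prop)
            exact ((ENNReal.continuous_pow 2).comp this.enorm).measurable
      _ = 8 * ∫⁻ x, ‖f x‖ₑ ^ 2 := by ring
      _ ≤ 8 * (8 ^ r * ∫⁻ x, ‖g x‖ₑ ^ 2) := by gcongr
      _ = _ := by ring

variable [FiniteDimensional ℝ V] [CompleteSpace F]

/-- A difference of order `r` gains a factor `‖z‖^r` against `r` derivatives. -/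
lemma lintegral_fwdDiff_iter_le {m : ℕ} {W : V → F} (hW : ContDiff ℝ m W) (z : V) (r j : ℕ)
    (h : j + r ≤ m) :
    ∫⁻ x, ‖(fwdDiff z)^[r] (iteratedFDeriv ℝ j W) x‖ₑ ^ 2 ≤
      ‖z‖ₑ ^ (2 * r) * derivSq (j + r) W univ := by
  induction r generalizing j with
  | zero => simp [derivSq]
  | succ r ih =>
    have h1 : ContDiff ℝ 1 (iteratedFDeriv ℝ j W) :=
      hW.iteratedFDeriv_right (by exact_mod_cast (by omega : 1 + j ≤ m))
    rw [Function.iterate_succ_apply']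
    refine (lintegral_translate_sub_sq_le volume (contDiff_fwdDiff_iter z r h1) z).trans ?_
    have h2 : ∀ x, ‖fderiv ℝ ((fwdDiff z)^[r] (iteratedFDeriv ℝ j W)) x‖ₑ =
        ‖(fwdDiff z)^[r] (iteratedFDeriv ℝ (j + 1) W) x‖ₑ := by
      intro x
      rw [fderiv_fwdDiff_iter z r h1, fderiv_iteratedFDeriv]
      have h3 := congrFun (fwdDiff_iter_map
        (I := continuousMultilinearCurryLeftEquiv ℝ (fun _ : Fin (j + 1) => V) F)
        (fun a b => by ext; rfl) z r (iteratedFDeriv ℝ (j + 1) W)) x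
      refine (congrArg enorm h3).trans ?_
      rw [← ofReal_norm, LinearIsometryEquiv.norm_map, ofReal_norm]
    simp_rw [h2]
    refine (mul_le_mul_right (ih (j + 1) (by omega)) _).trans_eq ?_
    rw [show j + 1 + r = j + (r + 1) by ring]
    ring

/-- Averages of `m`-th differences with respect to a concentrated measure are small in all
derivatives of order at most `m`: of the `m` differences, `m - j` are estimated by derivatives and
the other `j` by boundedness. -/
lemma derivSq_diffAvg_le {V : Type u} {F : Type (max u v)} [NormedAddCommGroup V] [NormedSpace ℝ V]
    [FiniteDimensional ℝ V] [MeasureSpace V] [BorelSpace V] [(volume : Measure V).IsAddHaarMeasure]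
    [NormedAddCommGroup F] [NormedSpace ℝ F] [CompleteSpace F]
    (μ : Measure V) [IsProbabilityMeasure μ] {m j : ℕ} (hj : j ≤ m) {W : V → F}
    (hW : ContDiff ℝ m W) (hs : HasCompactSupport W) :
    ContDiff ℝ m (diffAvg μ m W) ∧ derivSq j (diffAvg μ m W) univ ≤
      8 ^ j * (∫⁻ z, ‖z‖ₑ ^ (2 * (m - j)) ∂μ) * derivSq m W univ := by
  have hWj : ContDiff ℝ j W := hW.of_le (by exact_mod_cast hj)
  have hc : Continuous (iteratedFDeriv ℝ j W) := hWj.continuous_iteratedFDeriv le_rfl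
  have hcs : HasCompactSupport (iteratedFDeriv ℝ j W) := hs.iteratedFDeriv j
  have hder : iteratedFDeriv ℝ j (diffAvg μ m W) = diffAvg μ m (iteratedFDeriv ℝ j W) := by
    have hsm : ∀ k ∈ Finset.range (m + 1), ∀ x, ContDiffAt ℝ j (fun x =>
        (((-1 : ℤ) ^ (m - k) * m.choose k : ℤ) : ℝ) • translateAvg μ k W x) x := fun k _ x =>
      ((contDiff_translateAvg μ k j hWj hs).1.const_smul _).contDiffAt
    ext1 x
    rw [diffAvg_eq_sum m hW.continuous hs, diffAvg_eq_sum m hc hcs,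
      iteratedFDeriv_fun_sum_apply fun k hk => hsm k hk x]
    refine Finset.sum_congr rfl fun k _ => ?_
    have h1 := contDiff_translateAvg μ k j hWj hs
    rw [← h1.2]
    exact iteratedFDeriv_const_smul_apply h1.1.contDiffAt
  refine ⟨?_, ?_⟩
  · rw [diffAvg_eq_sum m hW.continuous hs]
    exact ContDiff.sum fun k _ => (contDiff_translateAvg μ k m hW hs).1.const_smul _
  have hunc := continuous_fwdDiff_iter_uncurry m hc
  calc derivSq j (diffAvg μ m W) univ
      = ∫⁻ x, ‖∫ z, (fwdDiff z)^[m] (iteratedFDeriv ℝ j W) x ∂μ‖ₑ ^ 2 := by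
        rw [derivSq, hder, Measure.restrict_univ]
        rfl
    _ ≤ ∫⁻ x, ∫⁻ z, ‖(fwdDiff z)^[m] (iteratedFDeriv ℝ j W) x‖ₑ ^ 2 ∂μ := by
        refine lintegral_mono fun x => enorm_integral_sq_le μ ?_
        exact (hunc.comp (by fun_prop : Continuous fun z => (x, z))).aestronglyMeasurable
    _ = ∫⁻ z, (∫⁻ x, ‖(fwdDiff z)^[m] (iteratedFDeriv ℝ j W) x‖ₑ ^ 2) ∂μ := by
        rw [lintegral_lintegral_swap]
        exact ((ENNReal.continuous_pow 2).comp hunc.enorm).measurable.aemeasurable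
    _ ≤ ∫⁻ z, 8 ^ j * derivSq m W univ * ‖z‖ₑ ^ (2 * (m - j)) ∂μ := by
        refine lintegral_mono fun z => ?_
        have h1 : (fwdDiff z)^[m] (iteratedFDeriv ℝ j W) =
            (fwdDiff z)^[j] ((fwdDiff z)^[m - j] (iteratedFDeriv ℝ j W)) := by
          rw [← Function.iterate_add_apply, Nat.add_sub_cancel' hj]
        have hc' : Continuous ((fwdDiff z)^[m - j] (iteratedFDeriv ℝ j W)) :=
          contDiff_zero.1 (contDiff_fwdDiff_iter z _ (contDiff_zero.2 hc))
        rw [h1]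
        refine (lintegral_fwdDiff_iter_bounded hc' z j).trans ?_
        have := lintegral_fwdDiff_iter_le hW z (m - j) j (by omega)
        rw [Nat.add_sub_cancel' hj] at this
        refine (mul_le_mul_right this _).trans_eq ?_
        ring
    _ = _ := by
        rw [lintegral_const_mul]
        · ring
        · exact ((ENNReal.continuous_pow _).comp continuous_enorm).measurable

end average

/-! ### Polynomial approximation of compactly supported functions -/

section jackson

variable {n : ℕ}

/-- The measure on `[-2, 2]ⁿ` with density `∏ q(zᵢ)`. -/
noncomputable def kernelMeasure (n : ℕ) (q : Polynomial ℝ) : Measure (Fin n → ℝ) :=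
  volume.withDensity fun z => ENNReal.ofReal (∏ i, (Icc (-2 : ℝ) 2).indicator q.eval (z i))

lemma measurable_kernelDensity (q : Polynomial ℝ) :
    Measurable fun z : Fin n → ℝ => ∏ i, (Icc (-2 : ℝ) 2).indicator q.eval (z i) := by
  refine Finset.measurable_prod _ fun i _ => ?_
  exact (q.continuous.measurable.indicator measurableSet_Icc).comp (measurable_pi_apply i)

lemma integrable_indicator_pow_mul (q : Polynomial ℝ) (r : ℕ) :
    Integrable fun z : ℝ => z ^ r * (Icc (-2 : ℝ) 2).indicator q.eval z := by
  have h : (fun z : ℝ => z ^ r * (Icc (-2 : ℝ) 2).indicator q.eval z) =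
      (Icc (-2 : ℝ) 2).indicator fun z => z ^ r * q.eval z := by
    ext z
    by_cases hz : z ∈ Icc (-2 : ℝ) 2
    · rw [indicator_of_mem hz, indicator_of_mem hz]
    · rw [indicator_of_notMem hz, indicator_of_notMem hz, mul_zero]
  rw [h, integrable_indicator_iff measurableSet_Icc]
  exact (Continuous.continuousOn (by fun_prop)).integrableOn_Icc

/-- The moments of the kernel measure in one coordinate. -/
lemma lintegral_kernelMeasure_pow {q : Polynomial ℝ} (hq0 : ∀ z, 0 ≤ q.eval z)
    (hq1 : ∫ z in Icc (-2 : ℝ) 2, q.eval z = 1) (l : Fin n) (r : ℕ) :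
    ∫⁻ z, ‖z l‖ₑ ^ (2 * r) ∂(kernelMeasure n q) =
      ENNReal.ofReal (∫ z in Icc (-2 : ℝ) 2, z ^ (2 * r) * q.eval z) := by
  set ρ : ℝ → ℝ := (Icc (-2 : ℝ) 2).indicator q.eval with hρ
  have hρ0 : ∀ z, 0 ≤ ρ z := fun z => indicator_nonneg (fun z _ => hq0 z) z
  set f : Fin n → ℝ → ℝ := fun i z => if i = l then z ^ (2 * r) * ρ z else ρ z with hf
  have hfi : ∀ i, Integrable (f i) := by
    intro i
    by_cases h : i = l
    · simpa [hf, h] using integrable_indicator_pow_mul q (2 * r)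
    · simpa [hf, h] using integrable_indicator_pow_mul q 0
  have hf0 : ∀ i z, 0 ≤ f i z := by
    intro i z
    simp only [hf]
    split_ifs
    · exact mul_nonneg ((even_two_mul r).pow_nonneg z) (hρ0 z)
    · exact hρ0 z
  have hprod : ∀ z : Fin n → ℝ, ∏ i, f i (z i) = z l ^ (2 * r) * ∏ i, ρ (z i) := by
    intro z
    rw [← Finset.mul_prod_erase _ _ (Finset.mem_univ l),
      ← Finset.mul_prod_erase Finset.univ (fun i => ρ (z i)) (Finset.mem_univ l)]
    simp only [hf, if_true, mul_assoc]
    congr 2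
    exact Finset.prod_congr rfl fun i hi => by simp [Finset.ne_of_mem_erase hi]
  have hint : ∫ z : Fin n → ℝ, ∏ i, f i (z i) =
      ∫ z in Icc (-2 : ℝ) 2, z ^ (2 * r) * q.eval z := by
    rw [integral_fintype_prod_volume_eq_prod, ← Finset.mul_prod_erase _ _ (Finset.mem_univ l)]
    have h1 : ∏ i ∈ Finset.univ.erase l, ∫ z, f i z = 1 := by
      refine Finset.prod_eq_one fun i hi => ?_
      simp only [hf, if_neg (Finset.ne_of_mem_erase hi), hρ]
      rw [integral_indicator measurableSet_Icc, hq1]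
    rw [h1, mul_one]
    simp only [hf, if_true, hρ]
    rw [← integral_indicator measurableSet_Icc]
    congr 1
    ext z
    by_cases hz : z ∈ Icc (-2 : ℝ) 2
    · rw [indicator_of_mem hz, indicator_of_mem hz]
    · rw [indicator_of_notMem hz, indicator_of_notMem hz, mul_zero]
  have hI : Integrable fun z : Fin n → ℝ => ∏ i, f i (z i) := Integrable.fintype_prod hfi
  rw [kernelMeasure, lintegral_withDensity_eq_lintegral_mul _
    (measurable_kernelDensity q).ennreal_ofReal (by fun_prop), ← hint,
    ofReal_integral_eq_lintegral_ofReal hI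
      (Filter.Eventually.of_forall fun z => Finset.prod_nonneg fun i _ => hf0 i _)]
  refine lintegral_congr fun z => ?_
  rw [hprod, Pi.mul_apply, mul_comm, ENNReal.ofReal_mul ((even_two_mul r).pow_nonneg _)]
  congr 1
  rw [← enorm_pow, Real.enorm_of_nonneg ((even_two_mul r).pow_nonneg _)]

lemma isProbabilityMeasure_kernelMeasure (hn : 0 < n) {q : Polynomial ℝ}
    (hq0 : ∀ z, 0 ≤ q.eval z) (hq1 : ∫ z in Icc (-2 : ℝ) 2, q.eval z = 1) :
    IsProbabilityMeasure (kernelMeasure n q) := by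
  refine ⟨?_⟩
  have := lintegral_kernelMeasure_pow hq0 hq1 (⟨0, hn⟩ : Fin n) 0
  simpa [hq1] using this

lemma lintegral_norm_kernelMeasure_le (hn : 0 < n) {q : Polynomial ℝ} (hq0 : ∀ z, 0 ≤ q.eval z)
    (hq1 : ∫ z in Icc (-2 : ℝ) 2, q.eval z = 1) (r : ℕ) :
    ∫⁻ z, ‖z‖ₑ ^ (2 * r) ∂(kernelMeasure n q) ≤
      n * ENNReal.ofReal (∫ z in Icc (-2 : ℝ) 2, z ^ (2 * r) * q.eval z) := by
  have : Nonempty (Fin n) := ⟨⟨0, hn⟩⟩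
  calc _ ≤ ∫⁻ z, ∑ l, ‖z l‖ₑ ^ (2 * r) ∂(kernelMeasure n q) := by
        refine lintegral_mono fun z => ?_
        obtain ⟨l, hl⟩ := Finite.exists_max fun i => ‖z i‖
        have : ‖z‖ₑ ≤ ‖z l‖ₑ := by
          rw [enorm_le_iff_norm_le]
          exact (pi_norm_le_iff_of_nonneg (norm_nonneg _)).2 hl
        refine (pow_le_pow_left' this _).trans ?_
        exact Finset.single_le_sum (f := fun l => ‖z l‖ₑ ^ (2 * r)) (fun _ _ => zero_le)
          (Finset.mem_univ l)
    _ = _ := by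
        rw [lintegral_finsetSum _ fun l _ => by fun_prop]
        simp [lintegral_kernelMeasure_pow hq0 hq1]

variable {𝕜 : Type*} [RCLike 𝕜]

/-- For a function `W` supported in the unit box, the average `∫ W(x + k z) dμ(z)` against the
kernel measure is a polynomial in `x` on the box: it is `k⁻ⁿ ∫ W(y) ∏ᵢ q((yᵢ - xᵢ) / k) dy`. The
restriction of the kernel to `[-2, 2]ⁿ` is invisible, as `|yᵢ - xᵢ| ≤ 2` there. -/
lemma exists_poly_translateAvg {q : Polynomial ℝ} (hq0 : ∀ z, 0 ≤ q.eval z) {d : ℕ}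
    (hd : q.natDegree ≤ d) {W : (Fin n → ℝ) → 𝕜} (hW : Continuous W)
    (hs : ∀ t, (∃ i, 1 < |t i|) → W t = 0) (hcs : HasCompactSupport W) {k : ℕ} (hk : 1 ≤ k) :
    ∃ Φ ∈ PolySpace 𝕜 n (n * d), ∀ x : Fin n → ℝ, (∀ i, |x i| < 1) →
      translateAvg (kernelMeasure n q) k W x =
        MvPolynomial.eval (fun i => ((x i : ℝ) : 𝕜)) Φ := by
  have hk0 : (0 : ℝ) < k := by exact_mod_cast hk
  -- Taylor coefficients of `x ↦ q((y - x) / k)`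
  set c : ℕ → ℝ → ℝ := fun a y => (Polynomial.hasseDeriv a q).eval (y / k) * (-(1 / k : ℝ)) ^ a
    with hc
  have hcc : ∀ a, Continuous (c a) := fun a => by
    simp only [hc]; fun_prop
  have htaylor : ∀ y x : ℝ, q.eval ((y - x) / k) = ∑ a ∈ Finset.range (d + 1), c a y * x ^ a := by
    intro y x
    have h1 : (y - x) / k = -(1 / k) * x + y / k := by ring
    rw [h1, ← Polynomial.taylor_eval, Polynomial.eval_eq_sum_range'
      (n := d + 1) (by rw [Polynomial.natDegree_taylor]; omega)]
    refine Finset.sum_congr rfl fun a _ => ?_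
    rw [Polynomial.taylor_coeff, mul_pow]
    ring
  set A : (Fin n → ℕ) → 𝕜 := fun α => ∫ y : Fin n → ℝ, (∏ i, c (α i) (y i)) • W y with hA
  have hint : ∀ α : Fin n → ℕ, Integrable fun y : Fin n → ℝ => (∏ i, c (α i) (y i)) • W y := by
    intro α
    have hcont : Continuous fun y : Fin n → ℝ => ∏ i, c (α i) (y i) :=
      continuous_finsetProd _ fun i _ => (hcc (α i)).comp (continuous_apply i)
    exact (hcont.smul hW).integrable_of_hasCompactSupport hcs.smul_left
  refine ⟨∑ α ∈ Fintype.piFinset fun _ : Fin n => Finset.range (d + 1),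
    MvPolynomial.C (|((k : ℝ) ^ n)⁻¹| • A α) * ∏ i, MvPolynomial.X i ^ α i, ?_, fun x hx => ?_⟩
  · rw [MvPolynomial.mem_restrictTotalDegree]
    refine MvPolynomial.totalDegree_finsetSum_le fun α hα => ?_
    refine (MvPolynomial.totalDegree_mul _ _).trans ?_
    rw [MvPolynomial.totalDegree_C, zero_add]
    refine (MvPolynomial.totalDegree_finsetProd _ _).trans ?_
    calc _ ≤ ∑ _i : Fin n, d := by
          refine Finset.sum_le_sum fun i _ => ?_
          rw [MvPolynomial.totalDegree_X_pow]
          have := Finset.mem_range.1 (Fintype.mem_piFinset.1 hα i)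
          omega
      _ = n * d := by simp
  · set f : (Fin n → ℝ) → 𝕜 := fun y => (∏ i, q.eval ((y i - x i) / k)) • W y with hf
    have h1 : translateAvg (kernelMeasure n q) k W x = ∫ z, f (x + (k : ℝ) • z) := by
      rw [translateAvg, kernelMeasure, integral_withDensity_eq_integral_toReal_smul
        (measurable_kernelDensity q).ennreal_ofReal (by simp)]
      refine integral_congr_ae (Filter.Eventually.of_forall fun z => ?_)
      simp only [hf]
      by_cases hz : W (x + (k : ℝ) • z) = 0
      · simp [hz]
      · have hz' : ∀ i, |(x + (k : ℝ) • z) i| ≤ 1 := by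
          by_contra! h
          exact hz (hs _ h)
        congr 1
        rw [ENNReal.toReal_ofReal (Finset.prod_nonneg fun i _ =>
          indicator_nonneg (fun z _ => hq0 z) _)]
        refine Finset.prod_congr rfl fun i _ => ?_
        rw [indicator_of_mem]
        · congr 1
          simp only [Pi.add_apply, Pi.smul_apply, smul_eq_mul]
          field_simp
          ring
        · have h2 := hz' i
          have h3 := hx i
          simp only [Pi.add_apply, Pi.smul_apply, smul_eq_mul] at h2
          rw [abs_le] at h2
          rw [abs_lt] at h3
          have hk1 : (1 : ℝ) ≤ k := by exact_mod_cast hk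
          constructor <;> nlinarith
    have h2 : ∫ z, f (x + (k : ℝ) • z) = |((k : ℝ) ^ n)⁻¹| • ∫ y, f y := by
      have := Measure.integral_comp_smul (volume : Measure (Fin n → ℝ)) (fun y => f (x + y)) (k : ℝ)
      rw [this, integral_add_left_eq_self f x]
      simp
    have h3 : ∀ y, f y = ∑ α ∈ Fintype.piFinset fun _ : Fin n => Finset.range (d + 1),
        (∏ i, x i ^ α i) • (∏ i, c (α i) (y i)) • W y := by
      intro y
      simp only [hf, htaylor]
      rw [Finset.prod_univ_sum, Finset.sum_smul]
      refine Finset.sum_congr rfl fun α _ => ?_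
      rw [smul_smul, ← Finset.prod_mul_distrib]
      congr 1
      exact Finset.prod_congr rfl fun i _ => mul_comm _ _
    rw [h1, h2]
    simp_rw [h3]
    have hI : ∀ α ∈ Fintype.piFinset fun _ : Fin n => Finset.range (d + 1), Integrable
        fun y : Fin n → ℝ => (∏ i, x i ^ α i) • (∏ i, c (α i) (y i)) • W y :=
      fun α _ => (hint α).smul (∏ i, x i ^ α i)
    rw [integral_finsetSum _ hI]
    simp only [integral_smul, map_sum, map_mul, map_prod, map_pow, MvPolynomial.eval_C,
      MvPolynomial.eval_X, Finset.smul_sum]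
    refine Finset.sum_congr rfl fun α _ => ?_
    rw [smul_comm, RCLike.real_smul_eq_coe_mul (∏ i, x i ^ α i), mul_comm]
    push_cast
    rfl

/-- Jackson's theorem for functions supported in the unit box, simultaneously for all derivatives
of order at most `m`. -/
theorem exists_poly_approx_box (𝕜 : Type*) [RCLike 𝕜] {n : ℕ} (hn : 0 < n) (m : ℕ) :
    ∃ C : ℝ≥0∞, C ≠ ⊤ ∧ ∀ W : (Fin n → ℝ) → 𝕜, ContDiff ℝ m W →
    (∀ t, (∃ i, 1 < |t i|) → W t = 0) → ∀ p : ℕ, ∃ Φ ∈ PolySpace 𝕜 n p, ∀ j ≤ m,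
      derivSq j (fun t => W t - MvPolynomial.eval (fun i => ((t i : ℝ) : 𝕜)) Φ)
          {t | ∀ i, |t i| < 1} ≤
        C * ((p : ℝ≥0∞) + 1)⁻¹ ^ (2 * (m - j)) * derivSq m W univ := by
  obtain ⟨C, hC, hq⟩ := exists_jackson_poly m
  -- The kernel with parameter `M` gives polynomials of degree `b M`, whence the choice `M = p / b`.
  set b : ℕ := 4 * n * (m + 1) with hb
  have hb0 : 0 < b := by positivity
  refine ⟨8 ^ m * (n * ENNReal.ofReal C) * (b : ℝ≥0∞) ^ (2 * m), by finiteness, fun W hW hs p => ?_⟩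
  have hcs : HasCompactSupport W := by
    refine HasCompactSupport.intro (K := Icc (fun _ => -1) (fun _ => 1)) isCompact_Icc
      fun t ht => ?_
    apply hs
    by_contra! h
    exact ht ⟨fun i => (abs_le.1 (h i)).1, fun i => (abs_le.1 (h i)).2⟩
  obtain ⟨q, hqd, hq0, hq1, hqm⟩ := hq (p / b)
  set μ := kernelMeasure n q with hμ
  have hp : IsProbabilityMeasure μ := isProbabilityMeasure_kernelMeasure hn hq0 hq1
  have hdeg : n * (4 * (p / b) * (m + 1)) ≤ p := by
    calc n * (4 * (p / b) * (m + 1)) = p / b * b := by rw [hb]; ring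
      _ ≤ p := Nat.div_mul_le_self p b
  choose! Φ hΦ hΦe using fun (k : ℕ) (hk : 1 ≤ k) =>
    exists_poly_translateAvg hq0 hqd hW.continuous hs hcs hk
  refine ⟨-∑ k ∈ Finset.Icc 1 m, ((-1 : 𝕜) ^ k * m.choose k) • Φ k,
    neg_mem (sum_mem fun k hk => Submodule.smul_mem _ _
      (polySpace_mono hdeg (hΦ k (Finset.mem_Icc.1 hk).1))), fun j hj => ?_⟩
  obtain ⟨-, hD⟩ := derivSq_diffAvg_le μ hj hW hcs
  have hopen : IsOpen {t : Fin n → ℝ | ∀ i, |t i| < 1} := by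
    simp only [ofPred_forall]
    exact isOpen_iInter_of_finite fun i => isOpen_lt (by fun_prop) continuous_const
  -- On the box, `W` minus the polynomial is the average of the `m`-th differences, up to sign.
  have heq : EqOn (fun t => W t - MvPolynomial.eval (fun i => ((t i : ℝ) : 𝕜))
      (-∑ k ∈ Finset.Icc 1 m, ((-1 : 𝕜) ^ k * m.choose k) • Φ k))
      ((-1 : ℝ) ^ m • diffAvg μ m W) {t | ∀ i, |t i| < 1} := by
    intro t ht
    -- The term `k = 0` of the differences is `W` itself, since `μ` is a probability measure.
    have h0 : translateAvg μ (0 : ℕ) W t = W t := by simp [translateAvg]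
    simp only [Pi.smul_apply]
    rw [diffAvg_eq_sum m hW.continuous hcs]
    simp only
    rw [Finset.range_eq_Ico, Finset.sum_eq_sum_Ico_succ_bot (by omega), h0,
      show Finset.Ico (0 + 1) (m + 1) = Finset.Icc 1 m from rfl, smul_add, Finset.smul_sum,
      sub_eq_add_neg]
    congr 1
    · rw [smul_smul]
      have : (-1 : ℝ) ^ m * (((-1 : ℤ) ^ (m - 0) * m.choose 0 : ℤ) : ℝ) = 1 := by
        push_cast
        simp [← pow_add, ← two_mul]
      rw [this, one_smul]
    · rw [map_neg, neg_neg, map_sum]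
      refine Finset.sum_congr rfl fun k hk => ?_
      obtain ⟨hk1, hkm⟩ := Finset.mem_Icc.1 hk
      rw [hΦe k hk1 t ht, smul_smul, MvPolynomial.smul_eval, RCLike.real_smul_eq_coe_mul]
      congr 1
      push_cast
      rw [← mul_assoc, ← pow_add]
      congr 1
      rw [show m + (m - k) = k + 2 * (m - k) by omega, pow_add, pow_mul]
      simp
  calc _ = derivSq j ((-1 : ℝ) ^ m • diffAvg μ m W) {t | ∀ i, |t i| < 1} := by
        refine setLIntegral_congr_fun hopen.measurableSet fun t ht => ?_
        have := heq.eventuallyEq_of_mem (hopen.mem_nhds ht)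
        rw [(this.iteratedFDeriv ℝ j).eq_of_nhds]
    _ ≤ derivSq j (diffAvg μ m W) univ := by
        refine (lintegral_mono_set (subset_univ _)).trans_eq ?_
        refine lintegral_congr fun t => ?_
        rcases neg_one_pow_eq_or ℝ m with h | h
        · rw [h, one_smul]
        · rw [h, neg_one_smul, iteratedFDeriv_neg, Pi.neg_apply, enorm_neg]
    _ ≤ 8 ^ j * (∫⁻ z, ‖z‖ₑ ^ (2 * (m - j)) ∂μ) * derivSq m W univ := hD
    _ ≤ 8 ^ m * (n * ENNReal.ofReal (C / (2 * (p / b) + 1 : ℕ) ^ (2 * (m - j)))) *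
          derivSq m W univ := by
        gcongr
        · norm_num
        · refine (lintegral_norm_kernelMeasure_le hn hq0 hq1 (m - j)).trans ?_
          gcongr
          exact hqm (m - j) (by omega)
    _ ≤ 8 ^ m * (n * (ENNReal.ofReal C *
          ((b : ℝ≥0∞) ^ (2 * m) * ((p : ℝ≥0∞) + 1)⁻¹ ^ (2 * (m - j))))) * derivSq m W univ := by
        gcongr
        have hb1 : (1 : ℝ) ≤ b := by exact_mod_cast hb0
        have hreal : C / (2 * (p / b) + 1 : ℕ) ^ (2 * (m - j)) ≤
            C * ((b : ℝ) ^ (2 * m) * ((p : ℝ) + 1)⁻¹ ^ (2 * (m - j))) := by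
          rw [div_eq_mul_inv, ← inv_pow]
          gcongr
          calc (((2 * (p / b) + 1 : ℕ) : ℝ))⁻¹ ^ (2 * (m - j))
              ≤ ((b : ℝ) * ((p : ℝ) + 1)⁻¹) ^ (2 * (m - j)) := by
                gcongr
                rw [inv_le_comm₀ (by positivity) (by positivity), mul_inv, inv_inv,
                  inv_mul_le_iff₀ (by positivity)]
                have h1 : p + 1 ≤ b * (2 * (p / b) + 1) := by
                  have := Nat.div_add_mod p b
                  have := Nat.mod_lt p hb0
                  nlinarith
                exact_mod_cast h1
            _ = (b : ℝ) ^ (2 * (m - j)) * ((p : ℝ) + 1)⁻¹ ^ (2 * (m - j)) := mul_pow _ _ _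
            _ ≤ _ := by
                gcongr
                omega
        refine (ENNReal.ofReal_le_ofReal hreal).trans_eq ?_
        rw [ENNReal.ofReal_mul hC.le, ENNReal.ofReal_mul (by positivity),
          ENNReal.ofReal_pow (by positivity), ENNReal.ofReal_pow (by positivity),
          ENNReal.ofReal_inv_of_pos (by positivity), ENNReal.ofReal_add (by positivity) (by simp)]
        simp
    _ = _ := by ring

end jackson

/-! ### Approximation on domains covered by corners -/

section corner

variable {n : ℕ} {𝕜 : Type*} [RCLike 𝕜]

/-- A reference corner: a domain `D` in the unit cube, with a smooth cut-off function `χ` which, in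
the positive orthant, is supported in `D`. The cut-off need not vanish near the coordinate
hyperplanes. -/
structure IsCornerModel (D : Set (Fin n → ℝ)) (χ : (Fin n → ℝ) → ℝ) : Prop where
  isOpen : IsOpen D
  subset : ∀ t ∈ D, ∀ i, 0 < t i ∧ t i < 1
  smooth : ContDiff ℝ ∞ χ
  support : ∀ t, (∀ i, 0 < t i) → t ∈ tsupport χ → t ∈ D
  eq_zero : ∀ t, (∀ i, 0 ≤ t i) → (∃ i, 1 < |t i|) → χ t = 0

lemma coe_le_infty (j : ℕ) : (j : ℕ∞ω) ≤ (∞ : ℕ∞ω) := WithTop.coe_le_coe.2 le_top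

/-- The Leibniz rule in mean square. -/
lemma exists_derivSq_smul_le {D : Set (Fin n → ℝ)} (hD : Bornology.IsBounded D)
    {χ : (Fin n → ℝ) → ℝ} (hχ : ContDiff ℝ ∞ χ) (m : ℕ) :
    ∃ C : ℝ≥0∞, C ≠ ⊤ ∧ ∀ g : (Fin n → ℝ) → 𝕜, ContDiff ℝ ∞ g →
      derivSq m (fun t => χ t • g t) D ≤ C * ∑ i ∈ Finset.range (m + 1), derivSq i g D := by
  have hB : ∀ i : ℕ, ∃ B : ℝ, ∀ t ∈ D, ‖iteratedFDeriv ℝ i χ t‖ ≤ B := by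
    intro i
    obtain ⟨B, hB⟩ := hD.isCompact_closure.exists_bound_of_continuousOn
      (hχ.continuous_iteratedFDeriv (coe_le_infty i)).continuousOn
    exact ⟨B, fun t ht => hB t (subset_closure ht)⟩
  choose B hB using hB
  set A : ℝ≥0∞ := ∑ i ∈ Finset.range (m + 1),
    ((m + 1 : ℕ) : ℝ≥0∞) ^ 2 * ENNReal.ofReal (m.choose i * B i) ^ 2 with hA
  have hAt : A ≠ ⊤ := ENNReal.sum_ne_top.2 fun i _ => by finiteness
  refine ⟨A, hAt, fun g hg => ?_⟩
  have hgc : ∀ i, Measurable fun t => ‖iteratedFDeriv ℝ i g t‖ₑ ^ 2 := fun i =>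
    ((ENNReal.continuous_pow 2).comp
      (hg.continuous_iteratedFDeriv (coe_le_infty i)).enorm).measurable
  -- The pointwise product rule, with squares.
  have hpt : ∀ t ∈ D, ‖iteratedFDeriv ℝ m (fun t => χ t • g t) t‖ₑ ^ 2 ≤
      A * ∑ i ∈ Finset.range (m + 1), ‖iteratedFDeriv ℝ i g t‖ₑ ^ 2 := by
    intro t ht
    have h1 : ‖iteratedFDeriv ℝ m (fun t => χ t • g t) t‖ₑ ≤ ∑ i ∈ Finset.range (m + 1),
        ENNReal.ofReal (m.choose i * B i) * ‖iteratedFDeriv ℝ (m - i) g t‖ₑ := by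
      rw [← ofReal_norm]
      have h2 := norm_iteratedFDeriv_smul_le hχ hg t (n := m) (coe_le_infty m)
      refine (ENNReal.ofReal_le_ofReal h2).trans ?_
      rw [ENNReal.ofReal_sum_of_nonneg fun i _ => by positivity]
      refine Finset.sum_le_sum fun i _ => ?_
      rw [ENNReal.ofReal_mul (by positivity), ofReal_norm]
      gcongr
      exact hB i t ht
    calc _ ≤ (∑ i ∈ Finset.range (m + 1),
          ENNReal.ofReal (m.choose i * B i) * ‖iteratedFDeriv ℝ (m - i) g t‖ₑ) ^ 2 := by gcongr
      _ ≤ _ := sum_sq_le_card_sq_mul _ _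
      _ = ∑ i ∈ Finset.range (m + 1), (((m + 1 : ℕ) : ℝ≥0∞) ^ 2 *
          ENNReal.ofReal (m.choose i * B i) ^ 2) * ‖iteratedFDeriv ℝ (m - i) g t‖ₑ ^ 2 := by
        rw [Finset.card_range, Finset.mul_sum]
        exact Finset.sum_congr rfl fun i _ => by rw [mul_pow, mul_assoc]
      _ ≤ ∑ i ∈ Finset.range (m + 1), (((m + 1 : ℕ) : ℝ≥0∞) ^ 2 *
          ENNReal.ofReal (m.choose i * B i) ^ 2) *
            ∑ k ∈ Finset.range (m + 1), ‖iteratedFDeriv ℝ k g t‖ₑ ^ 2 := by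
        refine Finset.sum_le_sum fun i _ => ?_
        gcongr
        exact Finset.single_le_sum (f := fun k => ‖iteratedFDeriv ℝ k g t‖ₑ ^ 2)
          (fun _ _ => zero_le) (Finset.mem_range.2 (by omega))
      _ = _ := by rw [← Finset.sum_mul]
  calc derivSq m (fun t => χ t • g t) D
      ≤ ∫⁻ t in D, A * ∑ i ∈ Finset.range (m + 1), ‖iteratedFDeriv ℝ i g t‖ₑ ^ 2 := by
        refine setLIntegral_mono (Measurable.const_mul
          (Finset.measurable_sum _ fun i _ => hgc i) _) hpt
    _ = _ := by
        rw [lintegral_const_mul' _ _ hAt, lintegral_finsetSum _ fun i _ => hgc i]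
        rfl

/-- Approximation of a cut-off function on a reference corner: reflection makes it compactly
supported, and then Jackson's theorem applies. -/
lemma IsCornerModel.exists_approx (hn : 0 < n) {D : Set (Fin n → ℝ)} {χ : (Fin n → ℝ) → ℝ}
    (hM : IsCornerModel D χ) (m : ℕ) :
    ∃ C : ℝ≥0∞, C ≠ ⊤ ∧ ∀ g : (Fin n → ℝ) → 𝕜, ContDiff ℝ ∞ g → ∀ p : ℕ,
      ∃ Φ ∈ PolySpace 𝕜 n p, ∀ j ≤ m,
      derivSq j (fun t => χ t • g t - MvPolynomial.eval (fun i => ((t i : ℝ) : 𝕜)) Φ) D ≤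
        C * ((p : ℝ≥0∞) + 1)⁻¹ ^ (2 * (m - j)) * ∑ i ∈ Finset.range (m + 1), derivSq i g D := by
  obtain ⟨C₁, hC₁, h₁⟩ := exists_extension 𝕜 n m
  obtain ⟨C₂, hC₂, h₂⟩ := exists_poly_approx_box 𝕜 hn m
  have hbd : Bornology.IsBounded D := by
    refine (Metric.isBounded_Icc (0 : Fin n → ℝ) 1).subset fun t ht => ?_
    exact ⟨fun i => (hM.subset t ht i).1.le, fun i => (hM.subset t ht i).2.le⟩
  obtain ⟨C₃, hC₃, h₃⟩ := exists_derivSq_smul_le (𝕜 := 𝕜) hbd hM.smooth m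
  refine ⟨C₂ * C₁ * C₃, by finiteness, fun g hg p => ?_⟩
  set w : (Fin n → ℝ) → 𝕜 := fun t => χ t • g t with hw
  have hwc : ContDiff ℝ ∞ w := hM.smooth.smul hg
  obtain ⟨W, hW, hWw, hWv, hWd⟩ := h₁ w (hwc.of_le (coe_le_infty m)) fun t ht hi => by
    simp [hw, hM.eq_zero t (fun i => ht i (by simp)) hi]
  obtain ⟨Φ, hΦ, hΦd⟩ := h₂ W hW hWv p
  refine ⟨Φ, hΦ, fun j hj => ?_⟩
  -- In the orthant `w` is supported in `D`, up to the coordinate hyperplanes.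
  have horth : derivSq m w (partialOrthant ∅) ≤ derivSq m w D := by
    have hsub : partialOrthant (∅ : Finset (Fin n)) ⊆
        {t | ∀ i, 0 < t i} ∪ ⋃ i : Fin n, {t | t i = 0} := by
      intro t ht
      by_cases h : ∀ i, 0 < t i
      · exact Or.inl h
      · push Not at h
        obtain ⟨i, hi⟩ := h
        exact Or.inr (mem_iUnion.2 ⟨i, le_antisymm hi (ht i (by simp))⟩)
    have hnull : volume (⋃ i : Fin n, {t : Fin n → ℝ | t i = 0}) = 0 :=
      measure_iUnion_null fun i => volume_coord_eq_zero i
    have hpos : MeasurableSet {t : Fin n → ℝ | ∀ i, 0 < t i} := by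
      simp only [ofPred_forall]
      exact MeasurableSet.iInter fun i => measurableSet_lt measurable_const (measurable_pi_apply i)
    calc derivSq m w (partialOrthant ∅)
        ≤ (∫⁻ t in {t | ∀ i, 0 < t i}, ‖iteratedFDeriv ℝ m w t‖ₑ ^ 2) +
          ∫⁻ t in ⋃ i : Fin n, {t | t i = 0}, ‖iteratedFDeriv ℝ m w t‖ₑ ^ 2 :=
          (lintegral_mono_set hsub).trans (lintegral_union_le _ _ _)
      _ = ∫⁻ t in {t | ∀ i, 0 < t i}, ‖iteratedFDeriv ℝ m w t‖ₑ ^ 2 := by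
          rw [setLIntegral_measure_zero _ _ hnull, add_zero]
      _ ≤ derivSq m w D := by
          rw [derivSq, ← lintegral_indicator hpos, ← lintegral_indicator hM.isOpen.measurableSet]
          refine lintegral_mono fun t => ?_
          by_cases ht : ∀ i, 0 < t i
          · rw [indicator_of_mem (by exact ht)]
            by_cases htD : t ∈ D
            · rw [indicator_of_mem htD]
            · have h1 : t ∉ tsupport w := fun h => htD (hM.support t ht
                (closure_mono (fun s hs => by
                  contrapose! hs
                  simp only [Function.mem_support, not_not] at hs ⊢
                  simp [hw, hs]) h))
              have h2 : iteratedFDeriv ℝ m w t = 0 := by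
                by_contra h
                exact h1 (support_iteratedFDeriv_subset m h)
              have h3 : ‖iteratedFDeriv ℝ m w t‖ₑ = 0 := by
                rw [← ofReal_norm, h2, norm_zero, ENNReal.ofReal_zero]
              rw [h3]
              simp
          · rw [indicator_of_notMem (by exact ht)]
            exact zero_le
  have hsubD : D ⊆ {t | ∀ i, |t i| < 1} := fun t ht i => by
    have := hM.subset t ht i
    rw [abs_lt]
    constructor <;> linarith
  calc derivSq j (fun t => χ t • g t - MvPolynomial.eval (fun i => ((t i : ℝ) : 𝕜)) Φ) D
      = derivSq j (fun t => W t - MvPolynomial.eval (fun i => ((t i : ℝ) : 𝕜)) Φ) D := by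
        refine setLIntegral_congr_fun hM.isOpen.measurableSet fun t ht => ?_
        have : (fun t => χ t • g t - MvPolynomial.eval (fun i => ((t i : ℝ) : 𝕜)) Φ) =ᶠ[nhds t]
            (fun t => W t - MvPolynomial.eval (fun i => ((t i : ℝ) : 𝕜)) Φ) := by
          filter_upwards [hM.isOpen.mem_nhds ht] with s hs
          rw [hWw s fun i _ => (hM.subset s hs i).1.le]
        rw [(this.iteratedFDeriv ℝ j).eq_of_nhds]
    _ ≤ _ := lintegral_mono_set hsubD
    _ ≤ C₂ * ((p : ℝ≥0∞) + 1)⁻¹ ^ (2 * (m - j)) * derivSq m W univ := hΦd j hj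
    _ ≤ C₂ * ((p : ℝ≥0∞) + 1)⁻¹ ^ (2 * (m - j)) *
          (C₁ * (C₃ * ∑ i ∈ Finset.range (m + 1), derivSq i g D)) := by
        gcongr
        refine hWd.trans ?_
        gcongr
        exact horth.trans (h₃ g hg)
    _ = _ := by ring

/-- An affine change of variables does not raise the total degree of a polynomial. -/
lemma exists_polyFun_comp_affine (A : E n →L[ℝ] (Fin n → ℝ)) (d : Fin n → ℝ) {p : ℕ}
    {Φ : MvPolynomial (Fin n) 𝕜} (hΦ : Φ ∈ PolySpace 𝕜 n p) :
    ∃ P ∈ PolySpace 𝕜 n p, ∀ x,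
      polyFun P x = MvPolynomial.eval (fun i => (((A x + d) i : ℝ) : 𝕜)) Φ := by
  rw [MvPolynomial.mem_restrictTotalDegree] at hΦ
  set ℓ : Fin n → MvPolynomial (Fin n) 𝕜 := fun i =>
    (∑ k, MvPolynomial.C ((A (EuclideanSpace.single k 1) i : ℝ) : 𝕜) * MvPolynomial.X k) +
      MvPolynomial.C ((d i : ℝ) : 𝕜) with hℓ
  have hdeg : ∀ i, (ℓ i).totalDegree ≤ 1 := by
    intro i
    refine (MvPolynomial.totalDegree_add _ _).trans (max_le ?_ (by simp))
    refine MvPolynomial.totalDegree_finsetSum_le fun k _ => ?_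
    refine (MvPolynomial.totalDegree_mul _ _).trans ?_
    simp
  have hev : ∀ i (x : E n), MvPolynomial.eval (fun i => ((x i : ℝ) : 𝕜)) (ℓ i) =
      (((A x + d) i : ℝ) : 𝕜) := by
    intro i x
    have hv : x = ∑ k, (x k) • (EuclideanSpace.single k (1 : ℝ) : E n) := by
      ext j
      simp [Pi.single_apply]
    have : A x i = ∑ k, A (EuclideanSpace.single k 1) i * x k := by
      conv_lhs => rw [hv]
      simp [map_sum, Finset.sum_apply, mul_comm]
    simp [hℓ, this]
  refine ⟨∑ α ∈ Φ.support, MvPolynomial.C (Φ.coeff α) * ∏ i, ℓ i ^ α i, ?_, fun x => ?_⟩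
  · rw [MvPolynomial.mem_restrictTotalDegree]
    refine MvPolynomial.totalDegree_finsetSum_le fun α hα => ?_
    refine (MvPolynomial.totalDegree_mul _ _).trans ?_
    rw [MvPolynomial.totalDegree_C, zero_add]
    refine (MvPolynomial.totalDegree_finsetProd _ _).trans ?_
    calc _ ≤ ∑ i, α i := by
          refine Finset.sum_le_sum fun i _ => (MvPolynomial.totalDegree_pow _ _).trans ?_
          simpa using Nat.mul_le_mul_left (α i) (hdeg i)
      _ = α.sum fun _ e => e := (Finsupp.sum_fintype α (fun _ e => e) fun _ => rfl).symm
      _ ≤ p := (MvPolynomial.le_totalDegree hα).trans hΦ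
  · rw [MvPolynomial.eval_eq']
    simp only [polyFun, map_sum, map_mul, map_prod, map_pow, MvPolynomial.eval_C, hev]

end corner

/-! ### Smooth functions on a convex set covered by affine corners -/

section charts

variable {n : ℕ} {𝕜 : Type*} [RCLike 𝕜]

lemma derivSq_sum_le {ι : Type*} [Fintype ι] {S : Set (E n)} (f : ι → E n → 𝕜)
    (hf : ∀ v, ContDiff ℝ ∞ (f v)) (j : ℕ) :
    derivSq j (fun x => ∑ v, f v x) S ≤
      (Fintype.card ι : ℝ≥0∞) ^ 2 * ∑ v, derivSq j (f v) S := by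
  have hm : ∀ v, Measurable fun x => ‖iteratedFDeriv ℝ j (f v) x‖ₑ ^ 2 := fun v =>
    ((ENNReal.continuous_pow 2).comp
      ((hf v).continuous_iteratedFDeriv (coe_le_infty j)).enorm).measurable
  have hN : (Fintype.card ι : ℝ≥0∞) ^ 2 ≠ ⊤ := by finiteness
  simp only [derivSq]
  rw [← lintegral_finsetSum _ fun v _ => hm v, ← lintegral_const_mul' _ _ hN]
  refine lintegral_mono fun x => ?_
  have h1 : iteratedFDeriv ℝ j (fun x => ∑ v, f v x) x = ∑ v, iteratedFDeriv ℝ j (f v) x := by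
    exact iteratedFDeriv_fun_sum_apply fun v _ => ((hf v).of_le (coe_le_infty j)).contDiffAt
  rw [h1]
  calc _ ≤ (∑ v, ‖iteratedFDeriv ℝ j (f v) x‖ₑ) ^ 2 := by
        gcongr
        exact enorm_sum_le _ _
    _ ≤ _ := by
        simpa using sum_sq_le_card_sq_mul Finset.univ fun v => ‖iteratedFDeriv ℝ j (f v) x‖ₑ

/-- Polynomial approximation of smooth functions on a convex set `Q` each of whose corners is an
affine image of a reference corner, the cut-off functions forming a partition of unity on `Q`. A
polynomial of degree less than `m` is subtracted beforehand, so that all the terms in the Leibniz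
rule for the cut-off functions are controlled by the derivatives of order `m`. The Jacobians of a
chart and its inverse cancel. -/
lemma IsCornerModel.exists_poly_derivSq_le (hn : 0 < n) {D : Set (Fin n → ℝ)}
    {χ : (Fin n → ℝ) → ℝ} (hM : IsCornerModel D χ) (ι : Type*) [Fintype ι] (m : ℕ) :
    ∃ C : ℝ≥0∞, C ≠ ⊤ ∧ ∀ Q : Set (E n), Convex ℝ Q → IsOpen Q → Bornology.IsBounded Q →
      Q.Nonempty → ∀ (L : ι → (Fin n → ℝ) ≃L[ℝ] E n) (c : ι → E n),
      (∀ v, (fun t => L v t + c v) ⁻¹' Q = D) →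
      (∀ x ∈ Q, ∑ v, χ ((L v).symm (x - c v)) = 1) →
      (∀ v, ‖(L v : (Fin n → ℝ) →L[ℝ] E n)‖ₑ ≤ n * ENNReal.ofReal (Metric.diam Q)) →
      ∀ β : ℝ≥0∞, 1 ≤ β →
      (∀ v, ‖((L v).symm : E n →L[ℝ] (Fin n → ℝ))‖ₑ * ENNReal.ofReal (Metric.diam Q) ≤ β) →
      ∀ p : ℕ, m ≤ p + 1 → ∀ U : E n → 𝕜, ContDiff ℝ ∞ U →
      ∃ P ∈ PolySpace 𝕜 n p, ∀ j ≤ m, derivSq j (U - polyFun P) Q ≤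
        C * β ^ (2 * m) * (ENNReal.ofReal (Metric.diam Q) * ((p : ℝ≥0∞) + 1)⁻¹) ^ (2 * (m - j)) *
          derivSq m U Q := by
  obtain ⟨C₀, hC₀, h₀⟩ := hM.exists_approx (𝕜 := 𝕜) hn m
  refine ⟨(Fintype.card ι : ℝ≥0∞) ^ 3 * (C₀ * (((m + 1 : ℕ) : ℝ≥0∞) *
    ((n : ℝ≥0∞) ^ (2 * m) * (2 ^ n) ^ m))), by finiteness, ?_⟩
  intro Q hc ho hb hne L c hQ hsum hL β hβ hLs p hp U hU
  set H := ENNReal.ofReal (Metric.diam Q) with hH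
  set X := derivSq m U Q with hX
  have hn1 : (1 : ℝ≥0∞) ≤ n := by exact_mod_cast hn
  have h2n : (1 : ℝ≥0∞) ≤ 2 ^ n := one_le_pow_of_one_le' (by norm_num) n
  obtain ⟨P₀, hP₀, -, hP₀d⟩ := CoverApprox.exists_poly_derivSq_le hc ho.measurableSet hb
    (ho.measure_pos volume hne).ne' m hU
  set G : E n → 𝕜 := U - polyFun P₀ with hG
  have hGc : ContDiff ℝ ∞ G := hU.sub (contDiff_polyFun P₀)
  -- The local approximations.
  have hloc : ∀ v, ∃ P ∈ PolySpace 𝕜 n p, ∀ j ≤ m,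
      derivSq j (fun x => χ ((L v).symm (x - c v)) • G x - polyFun P x) Q ≤
        C₀ * (((m + 1 : ℕ) : ℝ≥0∞) * ((n : ℝ≥0∞) ^ (2 * m) * (2 ^ n) ^ m)) * β ^ (2 * m) *
          (H * ((p : ℝ≥0∞) + 1)⁻¹) ^ (2 * (m - j)) * X := by
    intro v
    obtain ⟨κ, hκ0, hκt, hκ⟩ := exists_lintegral_comp_affine (L v) (c v)
    have hgc : ContDiff ℝ ∞ fun t => G (L v t + c v) :=
      hGc.comp ((L v).contDiff.add contDiff_const)
    obtain ⟨Φ, hΦ, hΦd⟩ := h₀ (fun t => G (L v t + c v)) hgc p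
    obtain ⟨P, hP, hPe⟩ := exists_polyFun_comp_affine ((L v).symm : E n →L[ℝ] (Fin n → ℝ))
      (-(L v).symm (c v)) hΦ
    refine ⟨P, hP, fun j hj => ?_⟩
    set Fv : (Fin n → ℝ) → 𝕜 := fun t => χ t • G (L v t + c v) -
      MvPolynomial.eval (fun i => ((t i : ℝ) : 𝕜)) Φ with hFv
    have hpull : ∀ x, (L v).symm x + -(L v).symm (c v) = (L v).symm (x - c v) := fun x => by
      rw [map_sub, sub_eq_add_neg]
    have hκ' : ∀ g : (Fin n → ℝ) → ℝ≥0∞,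
        ∫⁻ x, g ((L v).symm x + -(L v).symm (c v)) = κ⁻¹ * ∫⁻ t, g t := by
      intro g
      have := hκ fun x => g ((L v).symm x + -(L v).symm (c v))
      simp only [hpull, add_sub_cancel_right, ContinuousLinearEquiv.symm_apply_apply] at this ⊢
      rw [this, ← mul_assoc, ENNReal.inv_mul_cancel hκ0 hκt, one_mul]
    have hQ' : (fun x => (L v).symm x + -(L v).symm (c v)) ⁻¹' D = Q := by
      ext x
      rw [← hQ v]
      simp [hpull]
    have hFc : ContDiff ℝ ∞ Fv := by
      refine (hM.smooth.smul hgc).sub ?_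
      have h1 := (contDiff_polyFun Φ).comp
        (EuclideanSpace.equiv (Fin n) ℝ).symm.contDiff
      exact h1
    have hfun : (fun x => χ ((L v).symm (x - c v)) • G x - polyFun P x) =
        fun x => Fv ((L v).symm x + -(L v).symm (c v)) := by
      funext x
      rw [hPe]
      simp only [hFv, ContinuousLinearEquiv.coe_coe, hpull,
        ContinuousLinearEquiv.apply_symm_apply, sub_add_cancel]
    have hback : derivSq j (fun x => χ ((L v).symm (x - c v)) • G x - polyFun P x) Q ≤
        ‖((L v).symm : E n →L[ℝ] (Fin n → ℝ))‖ₑ ^ (2 * j) * κ⁻¹ * derivSq j Fv D := by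
      have h1 := derivSq_comp_affine_le (L v).symm (-(L v).symm (c v)) hκ' j
        (hFc.of_le (coe_le_infty j)) hM.isOpen.measurableSet
      rw [hQ'] at h1
      rw [hfun]
      exact h1
    have hforw : ∀ i ∈ Finset.range (m + 1), derivSq i (fun t => G (L v t + c v)) D ≤
        (n : ℝ≥0∞) ^ (2 * m) * (2 ^ n) ^ m * (κ * H ^ (2 * m) * X) := by
      intro i hi
      have him : i ≤ m := Nat.lt_succ_iff.1 (Finset.mem_range.1 hi)
      have h1 := derivSq_comp_affine_le (L v) (c v) hκ i
        (hGc.of_le (coe_le_infty i)) ho.measurableSet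
      rw [hQ v] at h1
      calc _ ≤ _ := h1
        _ ≤ (n * H) ^ (2 * i) * κ * ((2 ^ n * H ^ 2) ^ (m - i) * X) := by
            gcongr
            · exact hL v
            · exact hP₀d i him
        _ = (n : ℝ≥0∞) ^ (2 * i) * (2 ^ n) ^ (m - i) * (κ * H ^ (2 * m) * X) := by
            have : H ^ (2 * m) = H ^ (2 * i) * H ^ (2 * (m - i)) := by
              rw [← pow_add]; congr 1; omega
            rw [this, mul_pow, mul_pow, ← pow_mul H]
            ring
        _ ≤ _ := by
            have him' : 2 * i ≤ 2 * m := by omega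
            have hmi : m - i ≤ m := by omega
            gcongr
    have hcancel : H ^ (2 * m) = H ^ (2 * j) * H ^ (2 * (m - j)) := by
      rw [← pow_add]; congr 1; omega
    calc _ ≤ _ := hback
      _ ≤ ‖((L v).symm : E n →L[ℝ] (Fin n → ℝ))‖ₑ ^ (2 * j) * κ⁻¹ *
          (C₀ * ((p : ℝ≥0∞) + 1)⁻¹ ^ (2 * (m - j)) * (((m + 1 : ℕ) : ℝ≥0∞) *
            ((n : ℝ≥0∞) ^ (2 * m) * (2 ^ n) ^ m * (κ * H ^ (2 * m) * X)))) := by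
          gcongr
          refine (hΦd j hj).trans ?_
          gcongr
          refine (Finset.sum_le_card_nsmul _ _ _ hforw).trans ?_
          rw [Finset.card_range, nsmul_eq_mul]
      _ = C₀ * (((m + 1 : ℕ) : ℝ≥0∞) * ((n : ℝ≥0∞) ^ (2 * m) * (2 ^ n) ^ m)) *
          (‖((L v).symm : E n →L[ℝ] (Fin n → ℝ))‖ₑ * H) ^ (2 * j) *
          (H * ((p : ℝ≥0∞) + 1)⁻¹) ^ (2 * (m - j)) * X * (κ⁻¹ * κ) := by
          rw [hcancel, mul_pow, mul_pow]
          ring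
      _ ≤ C₀ * (((m + 1 : ℕ) : ℝ≥0∞) * ((n : ℝ≥0∞) ^ (2 * m) * (2 ^ n) ^ m)) *
          β ^ (2 * m) * (H * ((p : ℝ≥0∞) + 1)⁻¹) ^ (2 * (m - j)) * X := by
          rw [ENNReal.inv_mul_cancel hκ0 hκt, mul_one]
          have hβj : (‖((L v).symm : E n →L[ℝ] (Fin n → ℝ))‖ₑ * H) ^ (2 * j) ≤ β ^ (2 * m) :=
            (pow_le_pow_left₀ zero_le (hLs v) _).trans (pow_le_pow_right₀ hβ (by omega))
          exact mul_le_mul_left (mul_le_mul_left (mul_le_mul_right hβj _) _) _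
  choose P hP hPd using hloc
  refine ⟨P₀ + ∑ v, P v, ?_, fun j hj => ?_⟩
  · exact Submodule.add_mem _ (polySpace_mono (by omega) hP₀)
      (Submodule.sum_mem _ fun v _ => hP v)
  set f : ι → E n → 𝕜 := fun v x => χ ((L v).symm (x - c v)) • G x - polyFun (P v) x with hf
  have hfc : ∀ v, ContDiff ℝ ∞ (f v) := fun v =>
    ((hM.smooth.comp ((L v).symm.contDiff.comp (contDiff_id.sub contDiff_const))).smul hGc).sub
      (contDiff_polyFun _)
  have heq : ∀ x ∈ Q, (U - polyFun (P₀ + ∑ v, P v)) x = ∑ v, f v x := by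
    intro x hx
    have h1 : polyFun (P₀ + ∑ v, P v) x = polyFun P₀ x + ∑ v, polyFun (P v) x := by
      simp [polyFun]
    simp only [hf, Finset.sum_sub_distrib, ← Finset.sum_smul, hsum x hx, one_smul, Pi.sub_apply,
      h1, hG]
    ring
  calc derivSq j (U - polyFun (P₀ + ∑ v, P v)) Q = derivSq j (fun x => ∑ v, f v x) Q := by
        refine setLIntegral_congr_fun ho.measurableSet fun x hx => ?_
        have : (U - polyFun (P₀ + ∑ v, P v)) =ᶠ[nhds x] fun x => ∑ v, f v x := by
          filter_upwards [ho.mem_nhds hx] with y hy using heq y hy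
        rw [(this.iteratedFDeriv ℝ j).eq_of_nhds]
    _ ≤ _ := derivSq_sum_le f hfc j
    _ ≤ (Fintype.card ι : ℝ≥0∞) ^ 2 * (Fintype.card ι * (C₀ * (((m + 1 : ℕ) : ℝ≥0∞) *
          ((n : ℝ≥0∞) ^ (2 * m) * (2 ^ n) ^ m)) * β ^ (2 * m) *
          (H * ((p : ℝ≥0∞) + 1)⁻¹) ^ (2 * (m - j)) * X)) := by
        gcongr
        refine (Finset.sum_le_card_nsmul _ _ _ fun v _ => hPd v j hj).trans ?_
        rw [Finset.card_univ, nsmul_eq_mul]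
    _ = _ := by ring

end charts

/-! ### Corner charts of simplices and cubes -/

section models

variable {n : ℕ}

/-- The set `Q` is, from each of its corners, an affine image of the reference corner `D`, and the
cut-off functions `χ` carried to the corners form a partition of unity on `Q`. -/
def HasCornerCharts (D : Set (Fin n → ℝ)) (χ : (Fin n → ℝ) → ℝ) (ι : Type*) [Fintype ι]
    (Q : Set (E n)) : Prop :=
  ∃ (L : ι → (Fin n → ℝ) ≃L[ℝ] E n) (c : ι → E n),
    (∀ v, (fun t => L v t + c v) ⁻¹' Q = D) ∧ ∀ x ∈ Q, ∑ v, χ ((L v).symm (x - c v)) = 1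

/-- The reference corner of a simplex: the open unit simplex at the origin. -/
def refSimplex (n : ℕ) : Set (Fin n → ℝ) := {t | (∀ i, 0 < t i) ∧ ∑ i, t i < 1}

/-- The reference corner of a cube: the open unit cube. -/
def refCube (n : ℕ) : Set (Fin n → ℝ) := {t | ∀ i, t i ∈ Ioo 0 1}

lemma smoothTransition_add_one_sub (x : ℝ) :
    Real.smoothTransition x + Real.smoothTransition (1 - x) = 1 := by
  have h := (Real.smoothTransition.pos_denom x).ne'
  unfold Real.smoothTransition
  rw [sub_sub_cancel, add_comm (expNegInvGlue (1 - x)), ← add_div, div_self h]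

/-- A smooth function of a barycentric coordinate `s`, which vanishes for small `s`. The threshold
`1 / (2 (n + 1))` is below the largest of `n + 1` barycentric coordinates, so that the weights of a
point never all vanish. -/
noncomputable def simplexWeight (n : ℕ) (s : ℝ) : ℝ :=
  Real.smoothTransition (s - 1 / (2 * (n + 1)))

lemma contDiff_simplexWeight : ContDiff ℝ ∞ (simplexWeight n) :=
  Real.smoothTransition.contDiff.comp (contDiff_id.sub contDiff_const)

lemma simplexWeight_nonneg (s : ℝ) : 0 ≤ simplexWeight n s := Real.smoothTransition.nonneg _

lemma simplexWeight_sum_pos {a : Fin (n + 1) → ℝ} (ha : ∑ i, a i = 1) :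
    0 < ∑ i, simplexWeight n (a i) := by
  have hn : (0 : ℝ) < n + 1 := by positivity
  obtain ⟨i, hi⟩ : ∃ i, 1 / (2 * ((n : ℝ) + 1)) < a i := by
    by_contra! h
    have : ∑ i, a i ≤ ∑ _i : Fin (n + 1), 1 / (2 * ((n : ℝ) + 1)) :=
      Finset.sum_le_sum fun i _ => h i
    rw [ha, Finset.sum_const, Finset.card_univ, Fintype.card_fin, nsmul_eq_mul] at this
    push_cast at this
    field_simp at this
    linarith
  exact Finset.sum_pos' (fun i _ => simplexWeight_nonneg _)
    ⟨i, Finset.mem_univ _, Real.smoothTransition.pos_of_pos (by linarith)⟩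

/-- The cut-off function of the simplex corner: the normalized weight of the barycentric coordinate
`1 - ∑ tᵢ` which belongs to the corner at the origin. -/
noncomputable def simplexCutoff (n : ℕ) (t : Fin n → ℝ) : ℝ :=
  simplexWeight n (1 - ∑ i, t i) /
    (simplexWeight n (1 - ∑ i, t i) + ∑ i, simplexWeight n (t i))

/-- The cut-off function of the cube corner: a product of functions that are `1` for `tᵢ ≤ 1/3` and
`0` for `tᵢ ≥ 2/3`, and whose sum with the mirror image under `tᵢ ↦ 1 - tᵢ` is `1`. -/
noncomputable def cubeCutoff (n : ℕ) (t : Fin n → ℝ) : ℝ :=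
  ∏ i, (1 - Real.smoothTransition (3 * t i - 1))

lemma simplexCutoff_eq_zero {t : Fin n → ℝ} (h : 1 - ∑ i, t i ≤ 1 / (2 * (n + 1))) :
    simplexCutoff n t = 0 := by
  have : simplexWeight n (1 - ∑ i, t i) = 0 :=
    Real.smoothTransition.zero_of_nonpos (by linarith)
  simp [simplexCutoff, this]

lemma isCornerModel_simplex : IsCornerModel (refSimplex n) (simplexCutoff n) where
  isOpen := by
    have h1 : IsOpen {t : Fin n → ℝ | ∑ i, t i < 1} := isOpen_lt (by fun_prop) continuous_const
    have h2 : IsOpen {t : Fin n → ℝ | ∀ i, 0 < t i} := by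
      simp only [ofPred_forall]
      exact isOpen_iInter_of_finite fun i => isOpen_lt continuous_const (continuous_apply i)
    exact h2.inter h1
  subset t ht i := ⟨ht.1 i, (Finset.single_le_sum (fun j _ => (ht.1 j).le)
    (Finset.mem_univ i)).trans_lt ht.2⟩
  smooth := by
    have h1 : ContDiff ℝ ∞ fun t : Fin n → ℝ => simplexWeight n (1 - ∑ i, t i) :=
      contDiff_simplexWeight.comp (by fun_prop)
    refine h1.div (h1.add (ContDiff.sum fun i _ => contDiff_simplexWeight.comp (by fun_prop)))
      fun t => ?_
    have := simplexWeight_sum_pos (a := Fin.cons (1 - ∑ i, t i) t)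
      (by rw [Fin.sum_univ_succ]; simp)
    rw [Fin.sum_univ_succ] at this
    simpa using this.ne'
  support t ht hts := by
    refine ⟨ht, ?_⟩
    have hcl : IsClosed {t : Fin n → ℝ | 1 / (2 * ((n : ℝ) + 1)) ≤ 1 - ∑ i, t i} :=
      isClosed_le continuous_const (by fun_prop)
    have h1 : 1 / (2 * ((n : ℝ) + 1)) ≤ 1 - ∑ i, t i :=
      closure_minimal (fun s hs => by
        by_contra h
        exact hs (simplexCutoff_eq_zero (not_le.1 h).le)) hcl hts
    have : 0 < 1 / (2 * ((n : ℝ) + 1)) := by positivity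
    linarith
  eq_zero t ht hti := by
    obtain ⟨i, hi⟩ := hti
    rw [abs_of_nonneg (ht i)] at hi
    have h1 := Finset.single_le_sum (fun j _ => ht j) (Finset.mem_univ i)
    have : 0 < 1 / (2 * ((n : ℝ) + 1)) := by positivity
    exact simplexCutoff_eq_zero (by linarith)

lemma isCornerModel_cube : IsCornerModel (refCube n) (cubeCutoff n) where
  isOpen := by
    unfold refCube
    simp only [ofPred_forall]
    exact isOpen_iInter_of_finite fun i => isOpen_Ioo.preimage (continuous_apply i)
  subset t ht i := ht i
  smooth := contDiff_prod fun i _ => contDiff_const.sub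
    (Real.smoothTransition.contDiff.comp (by fun_prop))
  support t ht hts i := by
    refine ⟨ht i, ?_⟩
    have hcl : IsClosed {t : Fin n → ℝ | t i ≤ 2 / 3} :=
      isClosed_le (continuous_apply i) continuous_const
    have h1 : t i ≤ 2 / 3 :=
      closure_minimal (fun s hs => by
        by_contra h
        refine hs (Finset.prod_eq_zero (Finset.mem_univ i) ?_)
        rw [Real.smoothTransition.one_of_one_le, sub_self]
        have : 2 / 3 < s i := not_le.1 h
        linarith) hcl hts
    linarith
  eq_zero t ht hti := by
    obtain ⟨i, hi⟩ := hti
    rw [abs_of_nonneg (ht i)] at hi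
    refine Finset.prod_eq_zero (Finset.mem_univ i) ?_
    rw [Real.smoothTransition.one_of_one_le (by linarith), sub_self]

/-- Charts of a simplex: for each vertex `v`, the edge vectors at `v` are the images of the unit
vectors, and the chart coordinates are the barycentric coordinates of the other vertices. -/
lemma IsOpenSimplex.hasCornerCharts {Q : Set (E n)} (hQ : IsOpenSimplex Q) :
    HasCornerCharts (refSimplex n) (simplexCutoff n) (Fin (n + 1)) Q := by
  obtain ⟨w, hw, rfl⟩ := hQ
  have htop : affineSpan ℝ (range w) = ⊤ :=
    (hw.affineSpan_eq_top_iff_card_eq_finrank_add_one).2 (by simp)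
  set b : AffineBasis (Fin (n + 1)) ℝ (E n) := ⟨w, hw, htop⟩ with hb
  have hint : interior (convexHull ℝ (range w)) = {x | ∀ i, 0 < b.coord i x} :=
    b.interior_convexHull
  set B : Fin (n + 1) → Module.Basis (Fin n) ℝ (E n) := fun v =>
    (b.basisOf v).reindex (finSuccAboveEquiv v).symm with hB
  set L : Fin (n + 1) → (Fin n → ℝ) ≃L[ℝ] E n := fun v =>
    (B v).equivFun.symm.toContinuousLinearEquiv with hL
  have hBv : ∀ v i, B v i = b (v.succAbove i) - b v := fun v i => by
    simp only [hB, Module.Basis.reindex_apply, Equiv.symm_symm, AffineBasis.basisOf_apply,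
      vsub_eq_sub]
    rfl
  -- The chart coordinates are the barycentric coordinates.
  have hcoord : ∀ v t i, b.coord (v.succAbove i) (L v t + b v) = t i := by
    intro v t i
    have h1 : L v t = ∑ k, t k • (b (v.succAbove k) - b v) := by
      simp only [hL, LinearEquiv.coe_toContinuousLinearEquiv', Module.Basis.equivFun_symm_apply,
        hBv]
    have h2 : b.coord (v.succAbove i) (L v t + b v) =
        (b.coord (v.succAbove i)).linear (L v t) + b.coord (v.succAbove i) (b v) :=
      (b.coord (v.succAbove i)).map_vadd (b v) (L v t)
    have h3 : ∀ k, (b.coord (v.succAbove i)).linear (b (v.succAbove k) - b v) =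
        if i = k then 1 else 0 := by
      intro k
      have := (b.coord (v.succAbove i)).linearMap_vsub (b (v.succAbove k)) (b v)
      rw [vsub_eq_sub] at this
      rw [this, b.coord_apply, b.coord_apply]
      simp
    rw [h2, h1, map_sum, b.coord_apply_ne (Fin.succAbove_ne v i)]
    simp only [map_smul, h3, smul_eq_mul, mul_ite, mul_one, mul_zero, Finset.sum_ite_eq,
      Finset.mem_univ, if_true, add_zero]
  have hcoord0 : ∀ v t, b.coord v (L v t + b v) = 1 - ∑ i, t i := by
    intro v t
    have := b.sum_coord_apply_eq_one (L v t + b v)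
    rw [Fin.sum_univ_succAbove _ v] at this
    simp only [hcoord] at this
    linarith
  refine ⟨L, fun v => b v, fun v => ?_, fun x hx => ?_⟩
  · ext t
    rw [mem_preimage, hint, mem_ofPred_eq, Fin.forall_iff_succAbove v]
    simp only [hcoord, hcoord0, refSimplex, mem_ofPred_eq, sub_pos]
    exact and_comm
  · have hpos := simplexWeight_sum_pos (b.sum_coord_apply_eq_one x)
    have h1 : ∀ v, simplexCutoff n ((L v).symm (x - b v)) =
        simplexWeight n (b.coord v x) / ∑ i, simplexWeight n (b.coord i x) := by
      intro v
      have hx' : L v ((L v).symm (x - b v)) + b v = x := by simp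
      have h2 := hcoord v ((L v).symm (x - b v))
      have h3 := hcoord0 v ((L v).symm (x - b v))
      rw [hx'] at h2 h3
      rw [simplexCutoff, ← h3, Fin.sum_univ_succAbove _ v]
      simp only [h2]
    simp only [h1, ← Finset.sum_div]
    exact div_self hpos.ne'

/-- Charts of a cube: each corner is reached from the corner at the origin by reversing some of the
coordinates, namely those `i` with `v i = true`. -/
lemma IsOpenCube.hasCornerCharts {Q : Set (E n)} (hQ : IsOpenCube Q) :
    HasCornerCharts (refCube n) (cubeCutoff n) (Fin n → Bool) Q := by
  obtain ⟨s, e, hs, rfl⟩ := hQ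
  set a : Bool → ℝ := fun b => if b then -s else s with ha
  have ha0 : ∀ b, a b ≠ 0 := fun b => by cases b <;> simp [ha, hs.ne']
  set d : Bool → ℝ := fun b => if b then s else 0 with hd
  set M : (Fin n → Bool) → (Fin n → ℝ) ≃L[ℝ] (Fin n → ℝ) := fun v =>
    ContinuousLinearEquiv.piCongrRight fun i =>
      ContinuousLinearEquiv.unitsEquivAut ℝ (Units.mk0 (a (v i)) (ha0 (v i))) with hM
  set L : (Fin n → Bool) → (Fin n → ℝ) ≃L[ℝ] E n := fun v =>
    ((M v).trans (EuclideanSpace.equiv (Fin n) ℝ).symm).trans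
      e.linearIsometryEquiv.toContinuousLinearEquiv with hL
  set c : (Fin n → Bool) → E n := fun v => e (WithLp.toLp 2 fun i => d (v i)) with hc
  have hchart : ∀ v t, L v t + c v = e (WithLp.toLp 2 fun i => t i * a (v i) + d (v i)) := by
    intro v t
    have h1 : L v t = e.linearIsometryEquiv (WithLp.toLp 2 fun i => t i * a (v i)) := by
      rfl
    have h2 := e.toAffineEquiv.toAffineMap.map_vadd (WithLp.toLp 2 fun i => d (v i))
      (WithLp.toLp 2 fun i => t i * a (v i))
    rw [h1]
    exact h2.symm
  have hcoord : ∀ (b : Bool) (r : ℝ), r * a b + d b ∈ Ioo 0 s ↔ r ∈ Ioo (0 : ℝ) 1 := by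
    intro b r
    cases b
    · simp only [ha, hd, mem_Ioo]
      simp [hs]
    · simp only [ha, hd, mem_Ioo]
      simp only [if_true]
      constructor
      · rintro ⟨h1, h2⟩
        constructor <;> nlinarith
      · rintro ⟨h1, h2⟩
        constructor <;> nlinarith
  refine ⟨L, c, fun v => ?_, fun x hx => ?_⟩
  · ext t
    rw [mem_preimage, hchart, e.injective.mem_set_image]
    simp only [mem_ofPred_eq, refCube, hcoord]
  · obtain ⟨y, -, rfl⟩ := hx
    have h1 : ∀ v, (L v).symm (e y - c v) = fun i => (y i - d (v i)) / a (v i) := by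
      intro v
      rw [ContinuousLinearEquiv.symm_apply_eq, sub_eq_iff_eq_add, hchart]
      congr 1
      ext i
      simp [div_mul_cancel₀ _ (ha0 (v i))]
    have h2 : ∀ i, ∑ b : Bool, (1 - Real.smoothTransition (3 * ((y i - d b) / a b) - 1)) = 1 := by
      intro i
      rw [Fintype.sum_bool]
      simp only [ha, hd, if_true, Bool.false_eq_true, if_false]
      have h3 : 3 * ((y i - s) / -s) - 1 = 1 - (3 * ((y i - 0) / s) - 1) := by
        field_simp
        ring
      have h4 := smoothTransition_add_one_sub (3 * ((y i - 0) / s) - 1)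
      rw [h3]
      linarith
    simp only [h1, cubeCutoff]
    have h5 := Finset.prod_univ_sum (fun _ : Fin n => (Finset.univ : Finset Bool))
      fun i b => (1 - Real.smoothTransition (3 * ((y i - d b) / a b) - 1))
    simp only [h2, Finset.prod_const_one] at h5
    rw [Fintype.piFinset_univ] at h5
    exact h5.symm

end models

/-! ### Approximation of smooth functions on simplices and cubes -/

section smooth

variable {n : ℕ} {𝕜 : Type*} [RCLike 𝕜]

lemma radius_le_diam (hn : 0 < n) {Q : Set (E n)} (hb : Bornology.IsBounded Q) {x : E n} {r : ℝ}
    (h : Metric.ball x r ⊆ Q) : r ≤ Metric.diam Q := by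
  refine le_of_forall_lt_imp_le_of_dense fun a ha => ?_
  rcases le_or_gt a 0 with h0 | h0
  · exact h0.trans Metric.diam_nonneg
  have h1 : dist (x + a • EuclideanSpace.single ⟨0, hn⟩ (1 : ℝ)) x = a := by
    simp [norm_smul, abs_of_pos h0]
  rw [← h1]
  refine Metric.dist_le_diam_of_mem hb (h ?_) (h (Metric.mem_ball_self (h0.trans ha)))
  rw [Metric.mem_ball, h1]
  exact ha

lemma bddAbove_radii (hn : 0 < n) {Q : Set (E n)} (hb : Bornology.IsBounded Q) :
    BddAbove {r : ℝ | 0 ≤ r ∧ ∃ x, Metric.ball x r ⊆ Q} :=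
  ⟨Metric.diam Q, fun _ ⟨_, _, hx⟩ => radius_le_diam hn hb hx⟩

lemma inradius_pos (hn : 0 < n) {Q : Set (E n)} (hb : Bornology.IsBounded Q) (ho : IsOpen Q)
    (hne : Q.Nonempty) : 0 < inradius Q := by
  obtain ⟨x, hx⟩ := hne
  obtain ⟨r, hr, hxr⟩ := Metric.isOpen_iff.1 ho x hx
  exact hr.trans_le (le_csSup (bddAbove_radii hn hb) ⟨hr.le, x, hxr⟩)

lemma diam_pos (hn : 0 < n) {Q : Set (E n)} (hb : Bornology.IsBounded Q) (ho : IsOpen Q)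
    (hne : Q.Nonempty) : 0 < Metric.diam Q := by
  obtain ⟨x, hx⟩ := hne
  obtain ⟨r, hr, hxr⟩ := Metric.isOpen_iff.1 ho x hx
  exact hr.trans_le (radius_le_diam hn hb hxr)

/-- The properties of a reference corner which control the charts by the diameter and the inradius
of their image. The last one says that `D` contains segments parallel to the axes of any length less
than `1`. -/
structure IsRefCorner (D : Set (Fin n → ℝ)) : Prop where
  nonempty : D.Nonempty
  convex : Convex ℝ D
  exists_add_single : ∀ (i : Fin n) (a : ℝ), 0 < a → a < 1 → ∃ t ∈ D, t + Pi.single i a ∈ D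

lemma isRefCorner_simplex : IsRefCorner (refSimplex n) := by
  have hmem : ∀ a : ℝ, 0 ≤ a → a < 1 → (∀ i : Fin n, 0 < (1 - a) / (n + 1)) ∧
      ∑ _i : Fin n, (1 - a) / (n + 1) < 1 - a := by
    intro a h0 h1
    refine ⟨fun i => div_pos (by linarith) (by positivity), ?_⟩
    rw [Finset.sum_const, Finset.card_univ, Fintype.card_fin, nsmul_eq_mul, mul_div_assoc',
      div_lt_iff₀ (by positivity)]
    nlinarith
  refine ⟨⟨fun _ => (1 - 0) / (n + 1), (hmem 0 le_rfl one_pos).1, ?_⟩, ?_, fun i a h0 h1 => ?_⟩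
  · simpa using (hmem 0 le_rfl one_pos).2
  · intro s hs t ht a b ha hb hab
    refine ⟨fun i => ?_, ?_⟩
    · exact (convex_Ioi (0 : ℝ)) (hs.1 i) (ht.1 i) ha hb hab
    · simp only [Pi.add_apply, Pi.smul_apply, Finset.sum_add_distrib, ← Finset.smul_sum]
      exact (convex_Iio (1 : ℝ)) hs.2 ht.2 ha hb hab
  · refine ⟨fun _ => (1 - a) / (n + 1), ⟨(hmem a h0.le h1).1, ?_⟩, fun k => ?_, ?_⟩
    · linarith [(hmem a h0.le h1).2]
    · have := (hmem a h0.le h1).1 k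
      have h2 : (0 : ℝ) ≤ (Pi.single i a : Fin n → ℝ) k := by
        rw [Pi.single_apply]; split_ifs <;> simp [h0.le]
      exact add_pos_of_pos_of_nonneg this h2
    · simp only [Pi.add_apply, Finset.sum_add_distrib, Finset.sum_pi_single', Finset.mem_univ,
        if_true]
      linarith [(hmem a h0.le h1).2]

lemma isRefCorner_cube : IsRefCorner (refCube n) := by
  refine ⟨⟨fun _ => 1 / 2, fun i => by norm_num⟩, fun s hs t ht a b ha hb hab i => ?_,
    fun i a h0 h1 => ⟨fun _ => (1 - a) / 2, fun k => ?_, fun k => ?_⟩⟩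
  · exact (convex_Ioo (0 : ℝ) 1) (hs i) (ht i) ha hb hab
  · constructor <;> linarith
  · rw [Pi.add_apply, Pi.single_apply]
    split_ifs <;> constructor <;> linarith

/-- The geometric properties of simplices and cubes that the approximation relies on. -/
structure IsConvexBody (Q : Set (E n)) : Prop where
  convex : Convex ℝ Q
  isOpen : IsOpen Q
  bounded : Bornology.IsBounded Q
  nonempty : Q.Nonempty

lemma HasCornerCharts.isConvexBody {D : Set (Fin n → ℝ)} {χ : (Fin n → ℝ) → ℝ}
    (hM : IsCornerModel D χ) (hR : IsRefCorner D) {ι : Type*} [Fintype ι] [Nonempty ι]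
    {Q : Set (E n)} (hQ : HasCornerCharts D χ ι Q) : IsConvexBody Q := by
  obtain ⟨L, c, hLc, -⟩ := hQ
  obtain ⟨v⟩ := (inferInstance : Nonempty ι)
  have hD : Bornology.IsBounded D := by
    refine (Metric.isBounded_Icc (0 : Fin n → ℝ) 1).subset fun t ht => ?_
    exact ⟨fun i => (hM.subset t ht i).1.le, fun i => (hM.subset t ht i).2.le⟩
  have himg : Q = (fun t => L v t + c v) '' D := by
    rw [← hLc v, image_preimage_eq]
    exact fun x => ⟨(L v).symm (x - c v), by simp⟩
  have hpre : Q = (fun x => (L v).symm (x - c v)) ⁻¹' D := by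
    rw [← hLc v]
    ext x
    simp
  have himg' : Q = (fun x => x + c v) '' ((L v : (Fin n → ℝ) →ₗ[ℝ] E n) '' D) := by
    rw [himg, image_image]
    rfl
  refine ⟨?_, ?_, ?_, ?_⟩
  · rw [himg']
    have := (hR.convex.linear_image (L v : (Fin n → ℝ) →ₗ[ℝ] E n)).translate (c v)
    simpa only [add_comm] using this
  · rw [hpre]
    exact hM.isOpen.preimage (by fun_prop)
  · refine (hD.isCompact_closure.image
      (by fun_prop : Continuous fun t => L v t + c v)).isBounded.subset ?_
    rw [himg]
    exact image_mono subset_closure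
  · rw [himg]
    exact hR.nonempty.image _

/-- Chart norms: the charts are bounded by the diameter, and their inverses by the inverse of the
inradius, since a ball in `Q` is mapped into the unit cube. -/
lemma chart_norm_le (hn : 0 < n) {D : Set (Fin n → ℝ)} {χ : (Fin n → ℝ) → ℝ}
    (hM : IsCornerModel D χ) (hR : IsRefCorner D) {Q : Set (E n)} (hQ : IsConvexBody Q)
    (L : (Fin n → ℝ) ≃L[ℝ] E n) (c : E n) (hLc : (fun t => L t + c) ⁻¹' Q = D) :
    ‖(L : (Fin n → ℝ) →L[ℝ] E n)‖ ≤ n * Metric.diam Q ∧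
      ‖(L.symm : E n →L[ℝ] (Fin n → ℝ))‖ * inradius Q ≤ 1 := by
  have hmem : ∀ t ∈ D, L t + c ∈ Q := fun t ht => by
    rw [← hLc] at ht
    exact ht
  constructor
  · have h1 : ∀ i, ‖L (Pi.single i 1)‖ ≤ Metric.diam Q := by
      intro i
      refine le_of_forall_lt_imp_le_of_dense fun b hb => ?_
      rcases le_or_gt b 0 with h0 | h0
      · exact h0.trans Metric.diam_nonneg
      have hpos : 0 < ‖L (Pi.single i 1)‖ := h0.trans hb
      obtain ⟨t, ht, ht'⟩ := hR.exists_add_single i (b / ‖L (Pi.single i 1)‖) (by positivity)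
        ((div_lt_one hpos).2 hb)
      have h2 := Metric.dist_le_diam_of_mem hQ.bounded (hmem _ ht') (hmem _ ht)
      have h3 : (Pi.single i (b / ‖L (Pi.single i 1)‖) : Fin n → ℝ) =
          (b / ‖L (Pi.single i 1)‖) • Pi.single i (1 : ℝ) := by
        ext k
        simp [Pi.single_apply]
      rw [dist_add_right, dist_eq_norm, ← map_sub, add_sub_cancel_left, h3, map_smul, norm_smul,
        Real.norm_of_nonneg (by positivity), div_mul_cancel₀ _ hpos.ne'] at h2
      exact h2
    refine ContinuousLinearMap.opNorm_le_bound _ (by positivity) fun t => ?_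
    have h2 : t = ∑ i, t i • (Pi.single i (1 : ℝ) : Fin n → ℝ) := by
      ext k
      simp [Pi.single_apply]
    calc ‖L t‖ = ‖∑ i, t i • L (Pi.single i 1)‖ := by
          conv_lhs => rw [h2]
          rw [map_sum]
          simp only [map_smul]
      _ ≤ ∑ _i : Fin n, ‖t‖ * Metric.diam Q := by
          refine (norm_sum_le _ _).trans (Finset.sum_le_sum fun i _ => ?_)
          rw [norm_smul]
          gcongr
          · exact norm_le_pi_norm t i
          · exact h1 i
      _ = _ := by simp; ring
  · have h1 : ∀ r x, 0 ≤ r → Metric.ball x r ⊆ Q →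
        r * ‖(L.symm : E n →L[ℝ] (Fin n → ℝ))‖ ≤ 1 := by
      intro r x hr hx
      rcases hr.eq_or_lt with rfl | hr
      · simp
      rw [mul_comm, ← le_div_iff₀ hr]
      have hc : ∀ y ∈ Q, L.symm (y - c) ∈ D := fun y hy => by
        rw [← hLc]
        simpa using hy
      refine ContinuousLinearMap.opNorm_le_of_unit_norm (by positivity) fun z hz => ?_
      rw [le_div_iff₀ hr]
      refine le_of_forall_lt_imp_le_of_dense fun b hb => ?_
      by_cases hb0 : b ≤ 0
      · linarith
      push Not at hb0
      -- Shrink `r` slightly to stay inside the open ball.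
      have hz0 : 0 < ‖L.symm z‖ := by
        by_contra h
        have : ‖L.symm z‖ = 0 := le_antisymm (not_lt.1 h) (norm_nonneg _)
        rw [ContinuousLinearEquiv.coe_coe, this, zero_mul] at hb
        linarith
      set a := b / ‖L.symm z‖ with ha
      have ha0 : 0 < a := by positivity
      have har : a < r := by
        rw [ha, div_lt_iff₀ hz0, mul_comm]
        exact hb
      have h3 := hc _ (hx (Metric.mem_ball_self hr))
      have h4 := hc (x + a • z) (hx (by
        rw [Metric.mem_ball, dist_eq_norm, add_sub_cancel_left, norm_smul, hz, mul_one,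
          Real.norm_of_nonneg ha0.le]
        exact har))
      have h5 : ‖L.symm (a • z)‖ ≤ 1 := by
        have h6 : L.symm (a • z) = L.symm (x + a • z - c) - L.symm (x - c) := by
          rw [← map_sub]
          congr 1
          abel
        rw [h6, pi_norm_le_iff_of_nonneg zero_le_one]
        intro i
        have h7 := hM.subset _ h3 i
        have h8 := hM.subset _ h4 i
        rw [Pi.sub_apply, Real.norm_eq_abs, abs_le]
        constructor <;> linarith
      rw [map_smul, norm_smul, Real.norm_of_nonneg ha0.le, ha, div_mul_cancel₀ _ hz0.ne'] at h5
      exact h5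
    rcases (norm_nonneg (L.symm : E n →L[ℝ] (Fin n → ℝ))).eq_or_lt with h0 | h0
    · rw [← h0, zero_mul]
      exact zero_le_one
    · rw [mul_comm, ← le_div_iff₀ h0]
      refine csSup_le ⟨0, le_rfl, 0, by simp⟩ ?_
      rintro r ⟨hr, x, hx⟩
      rw [le_div_iff₀ h0]
      exact h1 r x hr hx

/-- The weight `h^{t - j} / (p + 1)^{m - j}`, `t = min(m, p + 1)`, of the derivatives of order `j`
in the error estimate. -/
noncomputable def approxWeight (h : ℝ) (p m j : ℕ) : ℝ :=
  h ^ ((min m (p + 1) : ℕ) - (j : ℤ)) / ((p : ℝ) + 1) ^ (m - j)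

lemma approxWeight_pos {h : ℝ} (hh : 0 < h) (p m j : ℕ) : 0 < approxWeight h p m j := by
  unfold approxWeight
  positivity

/-- The estimate for large polynomial degrees, by means of the charts. -/
lemma HasCornerCharts.exists_poly (hn : 0 < n) {D : Set (Fin n → ℝ)} {χ : (Fin n → ℝ) → ℝ}
    (hM : IsCornerModel D χ) (hR : IsRefCorner D) (ι : Type*) [Fintype ι] [Nonempty ι] (m : ℕ) :
    ∃ B : ℝ, 0 < B ∧ ∀ Q : Set (E n), HasCornerCharts D χ ι Q → ∀ p : ℕ, m ≤ p + 1 →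
      ∀ U : E n → 𝕜, ContDiff ℝ ∞ U → ∃ P ∈ PolySpace 𝕜 n p, ∀ j ≤ m,
      derivSq j (U - polyFun P) Q ≤ ENNReal.ofReal (B * max 1 (shapeReg Q) ^ m *
        approxWeight (Metric.diam Q) p m j) ^ 2 * derivSq m U Q := by
  obtain ⟨C, hC, h⟩ := hM.exists_poly_derivSq_le (𝕜 := 𝕜) hn ι m
  refine ⟨1 + C.toReal, by positivity, fun Q hQ p hp U hU => ?_⟩
  have hbody := hQ.isConvexBody hM hR
  obtain ⟨L, c, hLc, hsum⟩ := hQ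
  have hd := diam_pos hn hbody.bounded hbody.isOpen hbody.nonempty
  have hin := inradius_pos hn hbody.bounded hbody.isOpen hbody.nonempty
  obtain ⟨P, hP, hPd⟩ := h Q hbody.convex hbody.isOpen hbody.bounded hbody.nonempty L c hLc hsum
    (fun v => by
      rw [← ofReal_norm, ← ENNReal.ofReal_natCast, ← ENNReal.ofReal_mul (by positivity)]
      exact ENNReal.ofReal_le_ofReal (chart_norm_le hn hM hR hbody (L v) (c v) (hLc v)).1)
    (ENNReal.ofReal (max 1 (shapeReg Q))) (by
      rw [ENNReal.one_le_ofReal]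
      exact le_max_left _ _)
    (fun v => by
      rw [← ofReal_norm, ← ENNReal.ofReal_mul (norm_nonneg _)]
      refine ENNReal.ofReal_le_ofReal (le_max_of_le_right ?_)
      rw [shapeReg, le_div_iff₀ hin]
      have := (chart_norm_le hn hM hR hbody (L v) (c v) (hLc v)).2
      nlinarith) p hp U hU
  refine ⟨P, hP, fun j hj => (hPd j hj).trans ?_⟩
  have hw : ENNReal.ofReal (approxWeight (Metric.diam Q) p m j) =
      (ENNReal.ofReal (Metric.diam Q) * ((p : ℝ≥0∞) + 1)⁻¹) ^ (m - j) := by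
    have h1 : ((min m (p + 1) : ℕ) : ℤ) - (j : ℤ) = ((m - j : ℕ) : ℤ) := by omega
    rw [approxWeight, h1, zpow_natCast, ← div_pow, ENNReal.ofReal_pow (by positivity),
      ENNReal.ofReal_div_of_pos (by positivity), div_eq_mul_inv]
    congr 3
    rw [ENNReal.ofReal_add (by positivity) zero_le_one]
    simp
  have hCB : C ≤ ENNReal.ofReal (1 + C.toReal) ^ 2 := by
    rw [← ENNReal.ofReal_pow (by positivity)]
    conv_lhs => rw [← ENNReal.ofReal_toReal hC]
    refine ENNReal.ofReal_le_ofReal ?_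
    nlinarith [ENNReal.toReal_nonneg (a := C)]
  rw [ENNReal.ofReal_mul (by positivity), ENNReal.ofReal_mul (by positivity), hw,
    ENNReal.ofReal_pow (by positivity)]
  generalize ENNReal.ofReal (max 1 (shapeReg Q)) = M
  generalize ENNReal.ofReal (Metric.diam Q) * ((p : ℝ≥0∞) + 1)⁻¹ = A
  calc C * M ^ (2 * m) * A ^ (2 * (m - j)) * derivSq m U Q
      ≤ ENNReal.ofReal (1 + C.toReal) ^ 2 * M ^ (2 * m) * A ^ (2 * (m - j)) * derivSq m U Q := by
        gcongr
    _ = _ := by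
        rw [mul_pow, mul_pow, ← pow_mul, ← pow_mul, mul_comm m 2, mul_comm (m - j) 2]

lemma shape_isConvexBody {Q : Set (E n)} (hQ : IsOpenSimplex Q ∨ IsOpenCube Q) :
    IsConvexBody Q := by
  rcases hQ with hQ | hQ
  · exact hQ.hasCornerCharts.isConvexBody isCornerModel_simplex isRefCorner_simplex
  · exact hQ.hasCornerCharts.isConvexBody isCornerModel_cube isRefCorner_cube

/-- The approximation estimate for smooth functions. For `p + 1 < m` the polynomial of degree `p`
that matches the mean values of the derivatives is good enough, since the powers of `p + 1 < m` are
constants; it does not affect the derivatives of order `j > p + 1`, where the exponent of `h` is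
negative and `h ≤ h₀` is used. -/
lemma exists_poly_smooth (hn : 0 < n) (h₀ : ℝ) (m : ℕ) :
    ∃ B : ℝ, 0 < B ∧ ∀ Q : Set (E n), IsOpenSimplex Q ∨ IsOpenCube Q → Metric.diam Q ≤ h₀ →
      ∀ (p : ℕ) (U : E n → 𝕜), ContDiff ℝ ∞ U → ∃ P ∈ PolySpace 𝕜 n p, ∀ j ≤ m,
      derivSq j (U - polyFun P) Q ≤ ENNReal.ofReal (B * max 1 (shapeReg Q) ^ m *
        approxWeight (Metric.diam Q) p m j) ^ 2 *
          ∑ r ∈ Finset.Icc (min m (p + 1)) m, derivSq r U Q := by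
  obtain ⟨B₁, hB₁, h₁⟩ := HasCornerCharts.exists_poly (𝕜 := 𝕜) hn
    (isCornerModel_simplex (n := n)) isRefCorner_simplex (Fin (n + 1)) m
  obtain ⟨B₂, hB₂, h₂⟩ := HasCornerCharts.exists_poly (𝕜 := 𝕜) hn
    (isCornerModel_cube (n := n)) isRefCorner_cube (Fin n → Bool) m
  set B₃ : ℝ := (2 : ℝ) ^ (n * m) * (m : ℝ) ^ m * max 1 h₀ ^ m with hB₃
  have hB₃0 : 0 ≤ B₃ := by positivity
  refine ⟨B₁ + B₂ + B₃, by positivity, fun Q hQ hQh p U hU => ?_⟩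
  have hbody := shape_isConvexBody hQ
  have hd := diam_pos hn hbody.bounded hbody.isOpen hbody.nonempty
  have hmono : ∀ b, b ≤ B₁ + B₂ + B₃ → ∀ j, ENNReal.ofReal (b * max 1 (shapeReg Q) ^ m *
      approxWeight (Metric.diam Q) p m j) ≤ ENNReal.ofReal ((B₁ + B₂ + B₃) *
        max 1 (shapeReg Q) ^ m * approxWeight (Metric.diam Q) p m j) := by
    intro b hb j
    have := approxWeight_pos hd p m j
    refine ENNReal.ofReal_le_ofReal ?_
    gcongr
  rcases le_or_gt m (p + 1) with hp | hp
  · have hsum : ∑ r ∈ Finset.Icc (min m (p + 1)) m, derivSq r U Q = derivSq m U Q := by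
      rw [min_eq_left hp, Finset.Icc_self, Finset.sum_singleton]
    rw [hsum]
    rcases hQ with hQ | hQ
    · obtain ⟨P, hP, hPd⟩ := h₁ Q hQ.hasCornerCharts p hp U hU
      refine ⟨P, hP, fun j hj => (hPd j hj).trans ?_⟩
      have hB : B₁ ≤ B₁ + B₂ + B₃ := by linarith
      exact mul_le_mul' (pow_le_pow_left₀ zero_le (hmono B₁ hB j) 2) le_rfl
    · obtain ⟨P, hP, hPd⟩ := h₂ Q hQ.hasCornerCharts p hp U hU
      refine ⟨P, hP, fun j hj => (hPd j hj).trans ?_⟩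
      have hB : B₂ ≤ B₁ + B₂ + B₃ := by linarith
      exact mul_le_mul' (pow_le_pow_left₀ zero_le (hmono B₂ hB j) 2) le_rfl
  · rw [min_eq_right hp.le]
    obtain ⟨P, hP, hPz, hPd⟩ := CoverApprox.exists_poly_derivSq_le hbody.convex
      hbody.isOpen.measurableSet hbody.bounded
      (hbody.isOpen.measure_pos volume hbody.nonempty).ne' (p + 1) hU
    refine ⟨P, hP, fun j hj => ?_⟩
    have hm1 : (1 : ℝ) ≤ m := by exact_mod_cast (by omega : 1 ≤ m)
    have hpm : ((p : ℝ) + 1) ^ (m - j) ≤ (m : ℝ) ^ m := by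
      have : (p : ℝ) + 1 ≤ m := by exact_mod_cast hp.le
      exact (pow_le_pow_left₀ (by positivity) this _).trans (pow_le_pow_right₀ hm1 (by omega))
    have hmax : (1 : ℝ) ≤ max 1 h₀ ^ m := one_le_pow₀ (le_max_left _ _)
    have hσ : (1 : ℝ) ≤ max 1 (shapeReg Q) ^ m := one_le_pow₀ (le_max_left _ _)
    have h2 : (1 : ℝ) ≤ 2 ^ (n * m) := one_le_pow₀ one_le_two
    set h := Metric.diam Q with hh
    have hw : approxWeight h p m j = h ^ (((p + 1 : ℕ) : ℤ) - j) / ((p : ℝ) + 1) ^ (m - j) := by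
      rw [approxWeight, min_eq_right hp.le]
    rcases le_or_gt j (p + 1) with hjp | hjp
    · have h3 : derivSq (p + 1) U Q ≤ ∑ r ∈ Finset.Icc (p + 1) m, derivSq r U Q :=
        Finset.single_le_sum (f := fun r => derivSq r U Q) (fun _ _ => zero_le)
          (Finset.mem_Icc.2 ⟨le_rfl, hp.le⟩)
      refine (hPd j hjp).trans (mul_le_mul' ?_ h3)
      have h4 : h ^ (p + 1 - j) ≤ (m : ℝ) ^ m * approxWeight h p m j := by
        have : ((p + 1 : ℕ) : ℤ) - j = ((p + 1 - j : ℕ) : ℤ) := by omega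
        rw [hw, this, zpow_natCast, mul_div_assoc', le_div_iff₀ (by positivity), mul_comm]
        gcongr
      have h5 : (2 : ℝ) ^ (n * m) * h ^ (p + 1 - j) ≤ (B₁ + B₂ + B₃) *
          max 1 (shapeReg Q) ^ m * approxWeight h p m j := by
        have hw0 := approxWeight_pos hd p m j
        calc (2 : ℝ) ^ (n * m) * h ^ (p + 1 - j)
            ≤ 2 ^ (n * m) * ((m : ℝ) ^ m * approxWeight h p m j) := by gcongr
          _ = (2 ^ (n * m) * (m : ℝ) ^ m * 1) * 1 * approxWeight h p m j := by ring
          _ ≤ _ := by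
            gcongr
            calc 2 ^ (n * m) * (m : ℝ) ^ m * 1 ≤ B₃ := by
                  rw [hB₃]
                  gcongr
              _ ≤ _ := by linarith
      calc (2 ^ n * ENNReal.ofReal h ^ 2) ^ (p + 1 - j)
          = (2 : ℝ≥0∞) ^ (n * (p + 1 - j)) * (ENNReal.ofReal (h ^ (p + 1 - j))) ^ 2 := by
            rw [mul_pow, ← pow_mul, ← pow_mul, ENNReal.ofReal_pow hd.le, ← pow_mul]
            congr 2
            ring
        _ ≤ ((2 : ℝ≥0∞) ^ (n * m)) ^ 2 * (ENNReal.ofReal (h ^ (p + 1 - j))) ^ 2 := by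
            refine mul_le_mul_left ?_ _
            rw [← pow_mul]
            refine pow_le_pow_right₀ one_le_two ?_
            calc n * (p + 1 - j) ≤ n * m := Nat.mul_le_mul_left _ (by omega)
              _ ≤ n * m * 2 := by omega
        _ = ENNReal.ofReal (2 ^ (n * m) * h ^ (p + 1 - j)) ^ 2 := by
            rw [ENNReal.ofReal_mul (by positivity), mul_pow, ENNReal.ofReal_pow zero_le_two]
            simp
        _ ≤ _ := by gcongr
    · have h3 : derivSq j U Q ≤ ∑ r ∈ Finset.Icc (p + 1) m, derivSq r U Q :=
        Finset.single_le_sum (f := fun r => derivSq r U Q) (fun _ _ => zero_le)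
          (Finset.mem_Icc.2 ⟨hjp.le, hj⟩)
      have h4 : derivSq j (U - polyFun P) Q = derivSq j U Q := by
        unfold derivSq
        congr 1
        funext x
        rw [iteratedFDeriv_sub (hU.of_le (coe_le_infty j))
          ((contDiff_polyFun P).of_le (coe_le_infty j)), hPz j hjp.le, sub_zero]
      rw [h4]
      refine h3.trans (le_mul_of_one_le_left zero_le ?_)
      refine one_le_pow_of_one_le' ?_ 2
      rw [ENNReal.one_le_ofReal]
      have hw0 := approxWeight_pos hd p m j
      have h5 : 1 ≤ (m : ℝ) ^ m * max 1 h₀ ^ m * approxWeight h p m j := by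
        have h6 : ((p + 1 : ℕ) : ℤ) - j = -((j - (p + 1) : ℕ) : ℤ) := by omega
        rw [hw, h6, zpow_neg, zpow_natCast, mul_div_assoc', le_div_iff₀ (by positivity), one_mul,
          mul_assoc, ← div_eq_mul_inv, ← mul_one (((p : ℝ) + 1) ^ (m - j))]
        gcongr
        rw [one_le_div (by positivity)]
        calc h ^ (j - (p + 1)) ≤ max 1 h₀ ^ (j - (p + 1)) := by
              gcongr
              exact hQh.trans (le_max_right _ _)
          _ ≤ _ := pow_le_pow_right₀ (le_max_left _ _) (by omega)
      calc (1 : ℝ) ≤ 1 * ((m : ℝ) ^ m * max 1 h₀ ^ m) * 1 * approxWeight h p m j := by linarith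
        _ ≤ 2 ^ (n * m) * ((m : ℝ) ^ m * max 1 h₀ ^ m) * max 1 (shapeReg Q) ^ m *
            approxWeight h p m j := by gcongr
        _ ≤ _ := by
          rw [← mul_assoc, ← hB₃]
          gcongr
          linarith

end smooth

/-! ### Weak derivatives -/

section weak

variable {n : ℕ} {𝕜 : Type*} [RCLike 𝕜]

lemma eLpNorm_two_sq {α G : Type*} [MeasurableSpace α] {μ : Measure α} [NormedAddCommGroup G]
    (f : α → G) : eLpNorm f 2 μ ^ 2 = ∫⁻ x, ‖f x‖ₑ ^ 2 ∂μ := by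
  rw [eLpNorm_eq_lintegral_rpow_enorm_toReal (by norm_num) (by norm_num), ← ENNReal.rpow_natCast,
    ← ENNReal.rpow_mul]
  simp

lemma isTestFunction_listDeriv {S : Set (E n)} (l : List (Fin n)) {φ : E n → ℝ}
    (h : IsTestFunction S φ) : IsTestFunction S (listDeriv l φ) := by
  induction l with
  | nil => exact h
  | cons i l ih => exact isTestFunction_partialDeriv i ih

lemma setIntegral_test_smul {S : Set (E n)} {φ : E n → ℝ} (h : IsTestFunction S φ) (f : E n → 𝕜) :
    ∫ x in S, φ x • f x = ∫ x, φ x • f x := by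
  refine setIntegral_eq_integral_of_forall_compl_eq_zero fun x hx => ?_
  rw [image_eq_zero_of_notMem_tsupport fun hx' => hx (h.support hx'), zero_smul]

lemma integral_listDeriv_smul {S : Set (E n)} (l : List (Fin n)) {φ : E n → ℝ}
    (hφ : IsTestFunction S φ) {f : E n → 𝕜} (hf : ContDiff ℝ ∞ f) :
    ∫ x, listDeriv l φ x • f x = (-1 : ℝ) ^ l.length • ∫ x, φ x • listDeriv l.reverse f x := by
  induction l generalizing f with
  | nil => simp
  | cons i l ih =>
    have hψ := isTestFunction_listDeriv l hφ
    have hψ' := isTestFunction_listDeriv (i :: l) hφ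
    have hint : ∀ (ψ : E n → ℝ) (k : E n → 𝕜), IsTestFunction S ψ → ContDiff ℝ ∞ k →
        Integrable fun x => ψ x • k x := fun ψ k hψ hk =>
      (hψ.smooth.continuous.smul hk.continuous).integrable_of_hasCompactSupport
        hψ.compact.smul_right
    have hf' : ContDiff ℝ ∞ (listDeriv [i] f) := contDiff_listDeriv [i] hf
    have h1 := integral_smul_fderiv_eq_neg_fderiv_smul_of_integrable (μ := volume)
      (f := listDeriv l φ) (g := f) (v := EuclideanSpace.single i (1 : ℝ))
      (hint _ _ hψ' hf) (hint _ _ hψ hf') (hint _ _ hψ hf)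
      (fun x _ => (hψ.smooth.differentiable (by simp)) x)
      (fun x _ => (hf.differentiable (by simp)) x)
    have h2 := ih hf'
    rw [← listDeriv_append, ← List.reverse_cons] at h2
    rw [List.length_cons, pow_succ, mul_smul, smul_comm, ← h2, neg_one_smul]
    rw [eq_neg_iff_add_eq_zero, add_comm, ← eq_neg_iff_add_eq_zero]
    exact h1

/-- Classical derivatives are weak derivatives. -/
lemma hasWeakDeriv_of_contDiff (S : Set (E n)) (α : Fin n → ℕ) {f : E n → 𝕜}
    (hf : ContDiff ℝ ∞ f) : HasWeakDeriv α S f (listDeriv (dirList α) f) := by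
  have hf' := contDiff_listDeriv (dirList α) hf
  refine ⟨hf.continuous.locallyIntegrable.locallyIntegrableOn S,
    hf'.continuous.locallyIntegrable.locallyIntegrableOn S, fun φ hφ => ?_⟩
  rw [setIntegral_test_smul hφ, setIntegral_test_smul (isTestFunction_multiDeriv α hφ),
    multiDeriv_eq_listDeriv, integral_listDeriv_smul _ hφ hf, length_dirList,
    listDeriv_perm (List.reverse_perm _) hf]

/-- Weak derivatives are unique. -/
lemma HasWeakDeriv.ae_eq {S : Set (E n)} (hS : IsOpen S) {α : Fin n → ℕ} {f g g' : E n → 𝕜}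
    (h : HasWeakDeriv α S f g) (h' : HasWeakDeriv α S f g') : g =ᵐ[volume.restrict S] g' := by
  have h1 := hS.ae_eq_zero_of_integral_contDiff_smul_eq_zero (μ := volume)
    (h.locInt_deriv.sub h'.locInt_deriv) fun φ hφ hc hs => by
      have ht : IsTestFunction S φ := ⟨hφ, hc, hs⟩
      have h2 := (h.integral_eq φ ht).symm.trans (h'.integral_eq φ ht)
      have h3 : ∫ x in S, φ x • g x = ∫ x in S, φ x • g' x :=
        smul_right_injective 𝕜 (r := (-1 : ℝ) ^ (∑ i, α i)) (by simp) h2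
      rw [← setIntegral_test_smul ht]
      simp only [Pi.sub_apply, smul_sub]
      rw [integral_sub (integrableOn_test_smul ht h.locInt_deriv)
        (integrableOn_test_smul ht h'.locInt_deriv), h3, sub_self]
  rw [Filter.EventuallyEq, ae_restrict_iff' hS.measurableSet]
  filter_upwards [h1] with x hx hxS
  exact sub_eq_zero.1 (hx hxS)

lemma HasWeakDeriv.mono {S K : Set (E n)} (hKS : K ⊆ S) {α : Fin n → ℕ} {f g : E n → 𝕜}
    (h : HasWeakDeriv α S f g) : HasWeakDeriv α K f g := by
  refine ⟨h.locInt.mono_set hKS, h.locInt_deriv.mono_set hKS, fun φ hφ => ?_⟩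
  have hφS : IsTestFunction S φ := ⟨hφ.smooth, hφ.compact, hφ.support.trans hKS⟩
  rw [setIntegral_test_smul hφ, setIntegral_test_smul (isTestFunction_multiDeriv α hφ),
    ← setIntegral_test_smul hφS, ← setIntegral_test_smul (isTestFunction_multiDeriv α hφS)]
  exact h.integral_eq φ hφS

lemma sobolevSeminorm_sq (j : ℕ) (S : Set (E n)) (f : E n → 𝕜) :
    sobolevSeminorm j S f ^ 2 = ∑ α ∈ Finset.piAntidiag (Finset.univ : Finset (Fin n)) j,
      (⨅ (g : E n → 𝕜) (_ : HasWeakDeriv α S f g), eLpNorm g 2 (volume.restrict S)) ^ 2 := by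
  rw [sobolevSeminorm, ← ENNReal.rpow_natCast, ← ENNReal.rpow_mul]
  simp

lemma sobolevNorm_sq (m : ℕ) (S : Set (E n)) (f : E n → 𝕜) :
    sobolevNorm m S f ^ 2 = ∑ j ∈ Finset.range (m + 1), sobolevSeminorm j S f ^ 2 := by
  rw [sobolevNorm, ← ENNReal.rpow_natCast, ← ENNReal.rpow_mul]
  simp

/-- The infimum in the definition of the seminorm is attained by every weak derivative. -/
lemma eLpNorm_le_sobolevSeminorm {S : Set (E n)} (hS : IsOpen S) {α : Fin n → ℕ}
    {f g : E n → 𝕜} (h : HasWeakDeriv α S f g) :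
    eLpNorm g 2 (volume.restrict S) ≤ sobolevSeminorm (∑ i, α i) S f := by
  refine (ENNReal.pow_le_pow_left_iff two_ne_zero).1 ?_
  rw [sobolevSeminorm_sq]
  have h1 : (⨅ (g : E n → 𝕜) (_ : HasWeakDeriv α S f g), eLpNorm g 2 (volume.restrict S)) =
      eLpNorm g 2 (volume.restrict S) :=
    le_antisymm (iInf₂_le g h) (le_iInf₂ fun g' h' => (eLpNorm_congr_ae (h.ae_eq hS h')).le)
  rw [← h1]
  exact Finset.single_le_sum (f := fun α => (⨅ (g : E n → 𝕜) (_ : HasWeakDeriv α S f g),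
    eLpNorm g 2 (volume.restrict S)) ^ 2) (fun _ _ => zero_le) (by simp)

end weak

/-! ### Mollification -/

section mollify

variable {n : ℕ} {𝕜 : Type*} [RCLike 𝕜] {F : Type*} [NormedAddCommGroup F] [NormedSpace ℝ F]

lemma listDeriv_comp_affine (l : List (Fin n)) {f : E n → F} (hf : ContDiff ℝ ∞ f) (a : ℝ)
    (b : E n) : listDeriv l (fun x => f (a • x + b)) =
      fun x => a ^ l.length • listDeriv l f (a • x + b) := by
  induction l with
  | nil => simp
  | cons i l ih =>
    ext x
    rw [listDeriv_cons, ih]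
    have h1 : HasFDerivAt (fun x : E n => a • x + b) (a • ContinuousLinearMap.id ℝ (E n)) x :=
      ((hasFDerivAt_id x).const_smul a).add_const b
    have h2 := (((contDiff_listDeriv l hf).differentiable (by simp)
      (a • x + b)).hasFDerivAt.comp x h1).const_smul (a ^ l.length)
    have h3 : fderiv ℝ (fun x => a ^ l.length • listDeriv l f (a • x + b)) x = _ := h2.fderiv
    simp only [h3, listDeriv_cons]
    simp [pow_succ, mul_smul]

/-- The convolution of a function with a real kernel. -/
noncomputable def mollify (ρ : E n → ℝ) (g : E n → 𝕜) : E n → 𝕜 :=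
  convolution ρ g (ContinuousLinearMap.lsmul ℝ ℝ) volume

lemma mollify_eq_integral (ρ : E n → ℝ) (g : E n → 𝕜) (w : E n) :
    mollify ρ g w = ∫ y, ρ (w - y) • g y := by
  rw [mollify, convolution_eq_swap]
  rfl

lemma contDiff_mollify {ρ : E n → ℝ} (hc : HasCompactSupport ρ) (hρ : ContDiff ℝ ∞ ρ)
    {g : E n → 𝕜} (hg : LocallyIntegrable g) : ContDiff ℝ ∞ (mollify ρ g) :=
  hc.contDiff_convolution_left _ hρ hg

lemma listDeriv_mollify (l : List (Fin n)) {ρ : E n → ℝ} (hc : HasCompactSupport ρ)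
    (hρ : ContDiff ℝ ∞ ρ) {g : E n → 𝕜} (hg : LocallyIntegrable g) :
    listDeriv l (mollify ρ g) = mollify (listDeriv l ρ) g := by
  have ht : ∀ l, IsTestFunction univ (listDeriv l ρ) := fun l =>
    isTestFunction_listDeriv l ⟨hρ, hc, subset_univ _⟩
  induction l with
  | nil => rfl
  | cons i l ih =>
    ext x
    rw [listDeriv_cons, ih]
    have h1 := (ht l).compact.hasFDerivAt_convolution_left
      (ContinuousLinearMap.lsmul ℝ ℝ : ℝ →L[ℝ] 𝕜 →L[ℝ] 𝕜) ((ht l).smooth.of_le (by simp)) hg x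
    have h2 : fderiv ℝ (mollify (listDeriv l ρ) g) x = _ := h1.fderiv
    have hex := ((ht l).compact.fderiv ℝ).convolutionExists_left
      ((ContinuousLinearMap.lsmul ℝ ℝ : ℝ →L[ℝ] 𝕜 →L[ℝ] 𝕜).precompL (E n))
      (((ht l).smooth.continuous_fderiv (by simp))) hg x
    simp only [h2]
    rw [convolution, ContinuousLinearMap.integral_apply hex]
    rfl

/-- Differentiation commutes with mollification, as long as the kernel sees only points of `S`. -/
lemma listDeriv_mollify_of_hasWeakDeriv {S : Set (E n)} (hS : IsOpen S) {α : Fin n → ℕ}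
    {f g : E n → 𝕜} (h : HasWeakDeriv α S f g) (hf : LocallyIntegrable (S.indicator f))
    {ρ : E n → ℝ} (hc : HasCompactSupport ρ) (hρ : ContDiff ℝ ∞ ρ) {w : E n}
    (hw : ∀ y, w - y ∈ tsupport ρ → y ∈ S) :
    listDeriv (dirList α) (mollify ρ (S.indicator f)) w = mollify ρ (S.indicator g) w := by
  have hrw : ∀ (σ : E n → ℝ) (k : E n → 𝕜),
      ∫ y, σ (w - y) • S.indicator k y = ∫ y in S, σ (w - y) • k y := by
    intro σ k
    rw [← integral_indicator hS.measurableSet]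
    congr 1
    ext y
    by_cases hy : y ∈ S <;> simp [hy]
  rw [listDeriv_mollify _ hc hρ hf, mollify_eq_integral, mollify_eq_integral, hrw, hrw]
  have htest : IsTestFunction S fun y => ρ (w - y) := by
    refine ⟨hρ.comp (contDiff_const.sub contDiff_id), ?_, ?_⟩
    · exact hc.comp_homeomorph (Homeomorph.subLeft w)
    · have hcl : IsClosed {y | w - y ∈ tsupport ρ} :=
        (isClosed_tsupport ρ).preimage (by fun_prop)
      have hsub : tsupport (fun y => ρ (w - y)) ⊆ {y | w - y ∈ tsupport ρ} :=
        closure_minimal (fun y hy => subset_tsupport ρ hy) hcl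
      exact hsub.trans hw
  have h1 := h.integral_eq _ htest
  rw [multiDeriv_eq_listDeriv] at h1
  have h2 : (fun y => ρ (w - y)) = fun y => ρ ((-1 : ℝ) • y + w) := by
    ext y
    congr 1
    module
  have h3 : listDeriv (dirList α) (fun y => ρ (w - y)) =
      fun y => (-1 : ℝ) ^ (∑ i, α i) * listDeriv (dirList α) ρ (w - y) := by
    rw [h2, listDeriv_comp_affine _ hρ, length_dirList]
    ext y
    rw [smul_eq_mul]
    congr 2
    module
  rw [h3] at h1
  simp only [mul_smul] at h1
  rw [integral_smul] at h1
  exact smul_right_injective 𝕜 (r := (-1 : ℝ) ^ (∑ i, α i)) (by simp) h1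

lemma enorm_mollify_sq_le {ρ : E n → ℝ} (hc : HasCompactSupport ρ) (hρ : Continuous ρ)
    (h0 : ∀ x, 0 ≤ ρ x) (h1 : ∫ x, ρ x = 1) {g : E n → 𝕜} (hg : StronglyMeasurable g) (w : E n) :
    ‖mollify ρ g w‖ₑ ^ 2 ≤ ∫⁻ z, ENNReal.ofReal (ρ z) * ‖g (w - z)‖ₑ ^ 2 := by
  set μ : Measure (E n) := volume.withDensity fun z => ENNReal.ofReal (ρ z) with hμ
  have hm : Measurable fun z => ENNReal.ofReal (ρ z) := hρ.measurable.ennreal_ofReal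
  have hp : IsProbabilityMeasure μ := by
    constructor
    rw [hμ, withDensity_apply _ MeasurableSet.univ, setLIntegral_univ,
      ← ofReal_integral_eq_lintegral_ofReal (hρ.integrable_of_hasCompactSupport hc)
        (Filter.Eventually.of_forall h0), h1, ENNReal.ofReal_one]
  have hgm : StronglyMeasurable fun z => g (w - z) :=
    hg.comp_measurable (measurable_const.sub measurable_id)
  have h2 : mollify ρ g w = ∫ z, g (w - z) ∂μ := by
    rw [hμ, integral_withDensity_eq_integral_toReal_smul hm (by simp)]
    rw [mollify, convolution]
    congr 1
    ext z
    simp [ENNReal.toReal_ofReal (h0 z)]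
  rw [h2]
  refine (enorm_integral_sq_le μ hgm.aestronglyMeasurable).trans_eq ?_
  rw [hμ, lintegral_withDensity_eq_lintegral_mul _ hm (hgm.measurable.enorm.pow_const 2)]
  rfl

/-- Mollification combined with a contraction is bounded in `L²`. -/
lemma lintegral_mollify_sq_le {ρ : E n → ℝ} (hc : HasCompactSupport ρ) (hρ : Continuous ρ)
    (h0 : ∀ x, 0 ≤ ρ x) (h1 : ∫ x, ρ x = 1) {g : E n → 𝕜} (hg : StronglyMeasurable g)
    {τ : ℝ} (hτ : 1 / 2 ≤ τ) (hτ1 : τ < 1) (b : E n) :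
    ∫⁻ x, ‖mollify ρ g (τ • x + b)‖ₑ ^ 2 ≤ 2 ^ n * ∫⁻ x, ‖g x‖ₑ ^ 2 := by
  have hm : Measurable fun z => ENNReal.ofReal (ρ z) := hρ.measurable.ennreal_ofReal
  have hgm : Measurable fun x => ‖g x‖ₑ ^ 2 := hg.measurable.enorm.pow_const 2
  calc ∫⁻ x, ‖mollify ρ g (τ • x + b)‖ₑ ^ 2
      ≤ ∫⁻ x, (∫⁻ z, ENNReal.ofReal (ρ z) * ‖g (τ • x + b - z)‖ₑ ^ 2) :=
        lintegral_mono fun x => enorm_mollify_sq_le hc hρ h0 h1 hg _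
    _ = ∫⁻ z, (∫⁻ x, ENNReal.ofReal (ρ z) * ‖g (τ • x + b - z)‖ₑ ^ 2) := by
        refine lintegral_lintegral_swap (Measurable.aemeasurable ?_)
        exact (hm.comp measurable_snd).mul (hgm.comp (by fun_prop))
    _ ≤ ∫⁻ z, ENNReal.ofReal (ρ z) * (2 ^ n * ∫⁻ x, ‖g x‖ₑ ^ 2) := by
        refine lintegral_mono fun z => ?_
        rw [lintegral_const_mul' _ _ ENNReal.ofReal_ne_top]
        gcongr
        have := lintegral_contract_le (volume : Measure (E n)) convex_univ MeasurableSet.univ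
          (fun x => ‖g x‖ₑ ^ 2) hgm (y := (1 - τ)⁻¹ • (b - z)) (mem_univ _) hτ hτ1.le
        have hne : 1 - τ ≠ 0 := by linarith
        simpa only [setLIntegral_univ, smul_smul, mul_inv_cancel₀ hne, one_smul, ← add_sub_assoc,
          finrank_euclideanSpace, Fintype.card_fin] using this
    _ = 2 ^ n * ∫⁻ x, ‖g x‖ₑ ^ 2 := by
        rw [lintegral_mul_const _ hm, ← ofReal_integral_eq_lintegral_ofReal
          (hρ.integrable_of_hasCompactSupport hc) (Filter.Eventually.of_forall h0), h1,
          ENNReal.ofReal_one, one_mul]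

end mollify

/-! ### Density of smooth functions -/

section density

open Filter Topology

variable {n : ℕ} {𝕜 : Type*} [RCLike 𝕜]

/-- Mollification combined with a contraction towards a point converges to the identity in `L²`,
as it is bounded, and converges for continuous functions with compact support. -/
lemma eventually_lintegral_mollify_sub_sq_le {Q : Set (E n)} (hb : Bornology.IsBounded Q)
    (hm : MeasurableSet Q) (x₀ : E n) {r : ℝ} {g : E n → 𝕜}
    (hg : StronglyMeasurable g) (hg2 : MemLp g 2) {δ : ℝ≥0∞} (hδ : δ ≠ 0) :
    ∀ᶠ s in 𝓝[>] (0 : ℝ), ∀ φ : ContDiffBump (0 : E n), φ.rOut ≤ s * r →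
      ∫⁻ x in Q, ‖mollify (φ.normed volume) g ((1 - s) • x + s • x₀) - g x‖ₑ ^ 2 ≤ δ := by
  set K : ℝ≥0∞ := 4 * 2 ^ n + 16 * 1 + 16 * 1 with hK
  have hKt : K ≠ ⊤ := by finiteness
  have hK0 : K ≠ 0 := by simp [hK]
  set δ₁ := δ / K with hδ₁
  have hδ₁0 : δ₁ ≠ 0 := (ENNReal.div_pos hδ hKt).ne'
  -- Squares of small numbers are smaller.
  have hsq : ∀ a : ℝ≥0∞, a ≤ min 1 δ₁ → a ^ 2 ≤ δ₁ := fun a ha => by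
    calc a ^ 2 = a * a := sq a
      _ ≤ 1 * δ₁ := mul_le_mul' (ha.trans (min_le_left _ _)) (ha.trans (min_le_right _ _))
      _ = δ₁ := one_mul _
  obtain ⟨h, hhc, hgh, hcont, hh2⟩ := hg2.exists_hasCompactSupport_eLpNorm_sub_le (by norm_num)
    (ε := min 1 δ₁) (by simp [hδ₁0])
  have hQt : volume Q ≠ ⊤ := hb.measure_lt_top.ne
  obtain ⟨η, hη, hηQ⟩ := ENNReal.exists_nnreal_pos_mul_lt hQt hδ₁0
  set ε : ℝ := min 1 η with hε
  have hε0 : 0 < ε := lt_min one_pos (by exact_mod_cast hη)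
  obtain ⟨d, hd, hdh⟩ := Metric.uniformContinuous_iff.1
    (hhc.uniformContinuous_of_continuous hcont) ε hε0
  obtain ⟨R, hR⟩ := hb.exists_norm_le
  have hlim : ∀ᶠ s in 𝓝[>] (0 : ℝ), s * (r + (R + ‖x₀‖)) < d := by
    have : Tendsto (fun s : ℝ => s * (r + (R + ‖x₀‖))) (𝓝[>] 0) (𝓝 (0 * (r + (R + ‖x₀‖)))) :=
      (continuous_id.mul continuous_const).continuousAt.tendsto.mono_left nhdsWithin_le_nhds
    rw [zero_mul] at this
    exact this.eventually (gt_mem_nhds hd)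
  have hhalf : ∀ᶠ s in 𝓝[>] (0 : ℝ), s < 1 / 2 :=
    (gt_mem_nhds (by norm_num : (0 : ℝ) < 1 / 2)).filter_mono nhdsWithin_le_nhds
  filter_upwards [hlim, hhalf, self_mem_nhdsWithin] with s hs hs2 hs0 φ hφ
  have hs0' : (0 : ℝ) < s := hs0
  set ρ := φ.normed volume with hρ
  have hρc : HasCompactSupport ρ := φ.hasCompactSupport_normed
  have hρs : ContDiff ℝ ∞ ρ := φ.contDiff_normed
  set D : E n → 𝕜 := g - h with hD
  have hhm : StronglyMeasurable h := hcont.stronglyMeasurable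
  have hDm : StronglyMeasurable D := hg.sub hhm
  have hDl : LocallyIntegrable D := (hg2.sub hh2).locallyIntegrable (by norm_num)
  have hhl : LocallyIntegrable h := hcont.locallyIntegrable
  have hD2 : ∫⁻ x, ‖D x‖ₑ ^ 2 ≤ δ₁ := by
    rw [← eLpNorm_two_sq]
    exact hsq _ hgh
  have hadd : ∀ w, mollify ρ g w = mollify ρ D w + mollify ρ h w := by
    intro w
    have h1 : g = D + h := by simp [hD]
    have h2 := ((hρc.convolutionExists_left (ContinuousLinearMap.lsmul ℝ ℝ : ℝ →L[ℝ] 𝕜 →L[ℝ] 𝕜)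
      hρs.continuous hDl).distrib_add (hρc.convolutionExists_left
      (ContinuousLinearMap.lsmul ℝ ℝ : ℝ →L[ℝ] 𝕜 →L[ℝ] 𝕜) hρs.continuous hhl))
    conv_lhs => rw [h1]
    exact congrFun h2 w
  have hcl : ∀ x ∈ Q, ‖mollify ρ h ((1 - s) • x + s • x₀) - h x‖ₑ ≤ ENNReal.ofReal ε := by
    intro x hx
    rw [← ofReal_norm]
    refine ENNReal.ofReal_le_ofReal ?_
    rw [← dist_eq_norm]
    have h1 : ∀ y, dist y ((1 - s) • x + s • x₀) < φ.rOut → dist (h y) (h x) ≤ ε := by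
      intro y hy
      refine (hdh ?_).le
      have h2 : dist ((1 - s) • x + s • x₀) x ≤ s * (R + ‖x₀‖) := by
        have h3 : (1 - s) • x + s • x₀ - x = s • (x₀ - x) := by module
        rw [dist_eq_norm, h3, norm_smul, Real.norm_of_nonneg hs0'.le]
        gcongr
        calc ‖x₀ - x‖ ≤ ‖x₀‖ + ‖x‖ := norm_sub_le _ _
          _ ≤ _ := by linarith [hR x hx]
      calc dist y x ≤ dist y ((1 - s) • x + s • x₀) + dist ((1 - s) • x + s • x₀) x :=
            dist_triangle _ _ _
        _ < d := by nlinarith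
    exact dist_convolution_le hε0.le φ.support_normed_eq.subset φ.nonneg_normed φ.integral_normed
      hhm.aestronglyMeasurable h1
  have hptw : ∀ x ∈ Q, ‖mollify ρ g ((1 - s) • x + s • x₀) - g x‖ₑ ^ 2 ≤
      4 * ‖mollify ρ D ((1 - s) • x + s • x₀)‖ₑ ^ 2 +
        (16 * ENNReal.ofReal ε ^ 2 + 16 * ‖D x‖ₑ ^ 2) := by
    intro x hx
    have h1 : mollify ρ g ((1 - s) • x + s • x₀) - g x = mollify ρ D ((1 - s) • x + s • x₀) +
        ((mollify ρ h ((1 - s) • x + s • x₀) - h x) + -D x) := by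
      rw [hadd]
      simp only [hD, Pi.sub_apply]
      ring
    rw [h1]
    calc _ ≤ 4 * (‖mollify ρ D ((1 - s) • x + s • x₀)‖ₑ ^ 2 +
          ‖(mollify ρ h ((1 - s) • x + s • x₀) - h x) + -D x‖ₑ ^ 2) := enorm_add_sq_le _ _
      _ ≤ 4 * (‖mollify ρ D ((1 - s) • x + s • x₀)‖ₑ ^ 2 +
          4 * (ENNReal.ofReal ε ^ 2 + ‖D x‖ₑ ^ 2)) := by
          gcongr
          refine (enorm_add_sq_le _ _).trans ?_
          rw [enorm_neg]
          gcongr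
          exact hcl x hx
      _ = _ := by ring
  have hMm : Measurable fun x => ‖mollify ρ D ((1 - s) • x + s • x₀)‖ₑ ^ 2 := by
    have : Continuous fun x => mollify ρ D ((1 - s) • x + s • x₀) :=
      (contDiff_mollify hρc hρs hDl).continuous.comp (by fun_prop)
    exact this.measurable.enorm.pow_const 2
  have hDm2 : Measurable fun x => ‖D x‖ₑ ^ 2 := hDm.measurable.enorm.pow_const 2
  calc _ ≤ ∫⁻ x in Q, (4 * ‖mollify ρ D ((1 - s) • x + s • x₀)‖ₑ ^ 2 +
        (16 * ENNReal.ofReal ε ^ 2 + 16 * ‖D x‖ₑ ^ 2)) := setLIntegral_mono' hm hptw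
    _ = 4 * (∫⁻ x in Q, ‖mollify ρ D ((1 - s) • x + s • x₀)‖ₑ ^ 2) +
        (16 * (ENNReal.ofReal ε ^ 2 * volume Q) + 16 * ∫⁻ x in Q, ‖D x‖ₑ ^ 2) := by
        rw [lintegral_add_left (hMm.const_mul 4), lintegral_add_left measurable_const,
          lintegral_const_mul _ hMm, lintegral_const_mul _ hDm2, setLIntegral_const, mul_assoc]
    _ ≤ 4 * (2 ^ n * δ₁) + (16 * δ₁ + 16 * δ₁) := by
        gcongr
        · refine (setLIntegral_le_lintegral _ _).trans ?_
          refine (lintegral_mollify_sq_le hρc hρs.continuous φ.nonneg_normed φ.integral_normed hDm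
            (by linarith) (by linarith) _).trans ?_
          gcongr
        · refine le_trans ?_ hηQ.le
          gcongr
          have h1 : ENNReal.ofReal ε ≤ 1 := by
            rw [ENNReal.ofReal_le_one]
            exact min_le_left _ _
          have h2 : ENNReal.ofReal ε ≤ η := by
            rw [← ENNReal.ofReal_coe_nnreal]
            exact ENNReal.ofReal_le_ofReal (min_le_right _ _)
          calc ENNReal.ofReal ε ^ 2 = ENNReal.ofReal ε * ENNReal.ofReal ε := sq _
            _ ≤ 1 * η := mul_le_mul' h1 h2
            _ = η := one_mul _
        · exact (setLIntegral_le_lintegral _ _).trans hD2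
    _ = δ₁ * K := by rw [hK]; ring
    _ = δ := ENNReal.div_mul_cancel hK0 hKt

/-- Functions with weak derivatives in `L²(Q)`, `Q` convex and bounded, are approximated together
with these derivatives by functions which are smooth on the whole space: contract towards an
interior point and mollify. -/
lemma exists_smooth_approx {Q : Set (E n)} (hQ : IsConvexBody Q) (A : Finset (Fin n → ℕ))
    {U : E n → 𝕜} (hU : MemLp U 2 (volume.restrict Q)) {g : (Fin n → ℕ) → E n → 𝕜}
    (hgm : ∀ α ∈ A, StronglyMeasurable (g α)) (hg2 : ∀ α ∈ A, MemLp (g α) 2 (volume.restrict Q))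
    (hg : ∀ α ∈ A, HasWeakDeriv α Q U (g α)) {δ : ℝ≥0∞} (hδ : δ ≠ 0) :
    ∃ V : E n → 𝕜, ContDiff ℝ ∞ V ∧ ∀ α ∈ A,
      eLpNorm (g α - listDeriv (dirList α) V) 2 (volume.restrict Q) ≤ δ := by
  have hm := hQ.isOpen.measurableSet
  obtain ⟨x₀, hx₀⟩ := hQ.nonempty
  obtain ⟨r, hr, hball⟩ := Metric.isOpen_iff.1 hQ.isOpen x₀ hx₀
  have hind : ∀ f : E n → 𝕜, MemLp f 2 (volume.restrict Q) → MemLp (Q.indicator f) 2 :=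
    fun f hf => (memLp_indicator_iff_restrict hm).2 hf
  have hUl : LocallyIntegrable (Q.indicator U) := (hind U hU).locallyIntegrable (by norm_num)
  have hδ2 : (δ / 2) ^ 2 ≠ 0 := pow_ne_zero _ (ENNReal.half_pos hδ).ne'
  have hev1 : ∀ᶠ s in 𝓝[>] (0 : ℝ), ∀ α ∈ A, ∀ φ : ContDiffBump (0 : E n), φ.rOut ≤ s * (r / 2) →
      ∫⁻ x in Q, ‖mollify (φ.normed volume) (Q.indicator (g α)) ((1 - s) • x + s • x₀) -
        Q.indicator (g α) x‖ₑ ^ 2 ≤ (δ / 2) ^ 2 := by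
    rw [Filter.eventually_all_finset]
    intro α hα
    exact eventually_lintegral_mollify_sub_sq_le hQ.bounded hm x₀
      ((hgm α hα).indicator hm) (hind _ (hg2 α hα)) hδ2
  have hev2 : ∀ᶠ s in 𝓝[>] (0 : ℝ), ∀ α ∈ A, ENNReal.ofReal (1 - (1 - s) ^ (∑ i, α i)) *
      eLpNorm (g α) 2 (volume.restrict Q) ≤ δ / 2 := by
    rw [Filter.eventually_all_finset]
    intro α hα
    have h1 : Tendsto (fun s : ℝ => ENNReal.ofReal (1 - (1 - s) ^ (∑ i, α i)) *
        eLpNorm (g α) 2 (volume.restrict Q)) (𝓝[>] 0)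
        (𝓝 (ENNReal.ofReal (1 - (1 - 0) ^ (∑ i, α i)) * eLpNorm (g α) 2 (volume.restrict Q))) := by
      refine ENNReal.Tendsto.mul_const ?_ (Or.inr (hg2 α hα).2.ne)
      have hc : Continuous fun s : ℝ => ENNReal.ofReal (1 - (1 - s) ^ (∑ i, α i)) :=
        ENNReal.continuous_ofReal.comp (by fun_prop)
      exact hc.continuousAt.tendsto.mono_left nhdsWithin_le_nhds
    simp only [sub_zero, one_pow, sub_self, ENNReal.ofReal_zero, zero_mul] at h1
    exact h1.eventually (ge_mem_nhds (ENNReal.half_pos hδ))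
  have hhalf : ∀ᶠ s in 𝓝[>] (0 : ℝ), s < 1 :=
    (gt_mem_nhds one_pos).filter_mono nhdsWithin_le_nhds
  obtain ⟨s, hs1, hs2, hs3, hs0⟩ := (hev1.and (hev2.and (hhalf.and self_mem_nhdsWithin))).exists
  have hs0' : (0 : ℝ) < s := hs0
  have hout : 0 < s * (r / 2) := by positivity
  set φ : ContDiffBump (0 : E n) := ⟨s * (r / 2) / 2, s * (r / 2), by positivity, by linarith⟩
    with hφ
  set ρ := φ.normed volume with hρ
  have hρc : HasCompactSupport ρ := φ.hasCompactSupport_normed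
  have hρs : ContDiff ℝ ∞ ρ := φ.contDiff_normed
  have hM := contDiff_mollify hρc hρs hUl
  refine ⟨fun x => mollify ρ (Q.indicator U) ((1 - s) • x + s • x₀),
    hM.comp ((contDiff_const_smul (1 - s)).add contDiff_const), fun α hα => ?_⟩
  set k : ℕ := ∑ i, α i with hk
  set M : E n → 𝕜 := fun x => mollify ρ (Q.indicator (g α)) ((1 - s) • x + s • x₀) with hMdef
  have hderiv : ∀ x ∈ Q, listDeriv (dirList α)
      (fun x => mollify ρ (Q.indicator U) ((1 - s) • x + s • x₀)) x = (1 - s) ^ k • M x := by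
    intro x hx
    rw [listDeriv_comp_affine _ hM, length_dirList]
    simp only
    rw [listDeriv_mollify_of_hasWeakDeriv hQ.isOpen (hg α hα) hUl hρc hρs]
    intro y hy
    rw [φ.tsupport_normed_eq, mem_closedBall_zero_iff] at hy
    have hy' : ‖(1 - s) • x + s • x₀ - y‖ ≤ s * (r / 2) := hy
    -- The point is a convex combination of `x` and of a point near `x₀`.
    have h1 : y = (1 - s) • x + s • (x₀ + s⁻¹ • (y - ((1 - s) • x + s • x₀))) := by
      rw [smul_add, smul_smul, mul_inv_cancel₀ hs0'.ne', one_smul]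
      module
    rw [h1]
    refine hQ.convex hx (hball ?_) (by linarith) hs0'.le (by ring)
    rw [Metric.mem_ball, dist_eq_norm, add_sub_cancel_left, norm_smul, norm_inv,
      Real.norm_of_nonneg hs0'.le, norm_sub_rev, inv_mul_lt_iff₀ hs0']
    nlinarith
  have hMc : Continuous M :=
    (contDiff_mollify hρc hρs ((hind _ (hg2 α hα)).locallyIntegrable (by norm_num))).continuous.comp
      (by fun_prop)
  have hpow : (0 : ℝ) ≤ (1 - s) ^ k ∧ (1 - s) ^ k ≤ 1 :=
    ⟨pow_nonneg (by linarith) _, pow_le_one₀ (by linarith) (by linarith)⟩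
  have hsplit : g α - listDeriv (dirList α)
      (fun x => mollify ρ (Q.indicator U) ((1 - s) • x + s • x₀)) =ᵐ[volume.restrict Q]
      (1 - s) ^ k • (g α - M) + (1 - (1 - s) ^ k) • g α := by
    filter_upwards [ae_restrict_mem hm] with x hx
    simp only [Pi.sub_apply, Pi.add_apply, Pi.smul_apply, hderiv x hx]
    module
  have hgMm : AEStronglyMeasurable (g α - M) (volume.restrict Q) :=
    (hgm α hα).aestronglyMeasurable.sub hMc.aestronglyMeasurable
  have hgM : eLpNorm (g α - M) 2 (volume.restrict Q) ≤ δ / 2 := by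
    refine (ENNReal.pow_le_pow_left_iff two_ne_zero).1 ?_
    rw [eLpNorm_two_sq]
    refine le_trans (le_of_eq ?_) (hs1 α hα φ le_rfl)
    refine setLIntegral_congr_fun hm fun x hx => ?_
    simp only [Pi.sub_apply, hMdef, indicator_of_mem hx]
    rw [← enorm_neg, neg_sub]
  rw [eLpNorm_congr_ae hsplit]
  calc _ ≤ eLpNorm ((1 - s) ^ k • (g α - M)) 2 (volume.restrict Q) +
        eLpNorm ((1 - (1 - s) ^ k) • g α) 2 (volume.restrict Q) :=
        eLpNorm_add_le (hgMm.const_smul _) ((hgm α hα).aestronglyMeasurable.const_smul _)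
          (by norm_num)
    _ ≤ 1 * (δ / 2) + δ / 2 := by
        rw [eLpNorm_const_smul, eLpNorm_const_smul]
        refine add_le_add (mul_le_mul' ?_ hgM) ?_
        · rw [Real.enorm_of_nonneg hpow.1, ENNReal.ofReal_le_one]
          exact hpow.2
        · rw [Real.enorm_of_nonneg (by linarith [hpow.2])]
          exact hs2 α hα
    _ = δ := by rw [one_mul, ENNReal.add_halves]

end density

/-! ### Best approximation in the Sobolev space -/

section projection

variable {n : ℕ} {𝕜 : Type*} [RCLike 𝕜]

/-- Linear best approximation from a finite-dimensional space, measured through a linear map into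
an inner product space: the orthogonal projection to the range, followed by a linear section. -/
lemma exists_linear_best_approx {X Y H : Type*} [AddCommGroup X] [Module 𝕜 X] [AddCommGroup Y]
    [Module 𝕜 Y] [Module.Finite 𝕜 Y] [NormedAddCommGroup H] [InnerProductSpace 𝕜 H]
    (J : X →ₗ[𝕜] H) (ι : Y →ₗ[𝕜] X) :
    ∃ π : X →ₗ[𝕜] Y, ∀ x y, ‖J (x - ι (π x))‖ ≤ ‖J (x - ι y)‖ := by
  set T : Y →ₗ[𝕜] H := J ∘ₗ ι with hT
  obtain ⟨s, hs⟩ := T.rangeRestrict.exists_rightInverse_of_surjective T.range_rangeRestrict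
  refine ⟨s ∘ₗ (LinearMap.range T).orthogonalProjectionOnto.toLinearMap ∘ₗ J, fun x y => ?_⟩
  have h1 : J (ι (s ((LinearMap.range T).orthogonalProjectionOnto (J x)))) =
      (LinearMap.range T).starProjection (J x) := by
    have := LinearMap.congr_fun hs ((LinearMap.range T).orthogonalProjectionOnto (J x))
    exact congrArg Subtype.val this
  have h2 : ‖J x - (LinearMap.range T).starProjection (J x)‖ ≤ ‖J x - T y‖ := by
    rw [Submodule.starProjection_minimal]
    exact ciInf_le ⟨0, by rintro _ ⟨z, rfl⟩; exact norm_nonneg _⟩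
      (⟨T y, LinearMap.mem_range_self T y⟩ : LinearMap.range T)
  simp only [map_sub, LinearMap.comp_apply, ContinuousLinearMap.coe_coe]
  rw [h1]
  exact h2

/-- The multi-indices of order at most `m`. -/
def multiIdx (n m : ℕ) : Finset (Fin n → ℕ) :=
  (Finset.range (m + 1)).biUnion fun j => Finset.piAntidiag Finset.univ j

lemma mem_multiIdx {m : ℕ} {α : Fin n → ℕ} : α ∈ multiIdx n m ↔ ∑ i, α i ≤ m := by
  simp [multiIdx]

lemma piAntidiag_subset_multiIdx {j m : ℕ} (hj : j ≤ m) :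
    Finset.piAntidiag Finset.univ j ⊆ multiIdx n m := fun α hα => by
  rw [mem_multiIdx]
  exact (Finset.mem_piAntidiag.1 hα).1.trans_le hj

lemma card_multiIdx_pos (n m : ℕ) : 0 < (multiIdx n m).card :=
  Finset.card_pos.2 ⟨0, by simp [mem_multiIdx]⟩

lemma HasWeakDeriv.congr_deriv {α : Fin n → ℕ} {S : Set (E n)} {f g g' : E n → 𝕜}
    (h : HasWeakDeriv α S f g) (hg : MemLp g' 2 (volume.restrict S))
    (hgg : g =ᵐ[volume.restrict S] g') : HasWeakDeriv α S f g' := by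
  refine ⟨h.locInt, ?_, fun φ hφ => ?_⟩
  · exact locallyIntegrableOn_of_locallyIntegrable_restrict (hg.locallyIntegrable (by norm_num))
  · rw [h.integral_eq φ hφ]
    congr 1
    refine integral_congr_ae ?_
    filter_upwards [hgg] with x hx
    rw [hx]

lemma exists_weakDeriv_Lp {m : ℕ} {S : Set (E n)} (U : SobolevSpace 𝕜 m S) {α : Fin n → ℕ}
    (hα : ∑ i, α i ≤ m) : ∃ G : Lp 𝕜 2 (volume.restrict S),
      HasWeakDeriv α S (U : Lp 𝕜 2 (volume.restrict S)) G := by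
  obtain ⟨g, hg, hg2⟩ := U.2 α hα
  exact ⟨hg2.toLp g, hg.congr_deriv (Lp.memLp _) hg2.coeFn_toLp.symm⟩

lemma HasWeakDeriv.Lp_ext {S : Set (E n)} (hS : IsOpen S) {α : Fin n → ℕ} {f : E n → 𝕜}
    {G G' : Lp 𝕜 2 (volume.restrict S)} (h : HasWeakDeriv α S f G) (h' : HasWeakDeriv α S f G') :
    G = G' := Lp.ext (h.ae_eq hS h')

lemma HasWeakDeriv.Lp_add {S : Set (E n)} {α : Fin n → ℕ} {f f' G G' : Lp 𝕜 2 (volume.restrict S)}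
    (h : HasWeakDeriv α S f G) (h' : HasWeakDeriv α S f' G') :
    HasWeakDeriv α S (f + f' : Lp 𝕜 2 (volume.restrict S)) (G + G' : Lp 𝕜 2 (volume.restrict S)) :=
  (hasWeakDeriv_congr (Lp.coeFn_add f f').symm (h.add h')).congr_deriv (Lp.memLp _)
    (Lp.coeFn_add G G').symm

lemma HasWeakDeriv.Lp_smul {S : Set (E n)} {α : Fin n → ℕ} {f G : Lp 𝕜 2 (volume.restrict S)}
    (c : 𝕜) (h : HasWeakDeriv α S f G) :
    HasWeakDeriv α S (c • f : Lp 𝕜 2 (volume.restrict S)) (c • G : Lp 𝕜 2 (volume.restrict S)) :=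
  (hasWeakDeriv_congr (Lp.coeFn_smul c f).symm (h.smul c)).congr_deriv (Lp.memLp _)
    (Lp.coeFn_smul c G).symm

/-- The weak derivative `D^α` as a linear map on `W^m(S)`. -/
noncomputable def weakDerivLp {S : Set (E n)} (hS : IsOpen S) (m : ℕ) (α : Fin n → ℕ)
    (hα : ∑ i, α i ≤ m) : SobolevSpace 𝕜 m S →ₗ[𝕜] Lp 𝕜 2 (volume.restrict S) where
  toFun U := (exists_weakDeriv_Lp U hα).choose
  map_add' U V := ((exists_weakDeriv_Lp (U + V) hα).choose_spec).Lp_ext hS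
    ((exists_weakDeriv_Lp U hα).choose_spec.Lp_add (exists_weakDeriv_Lp V hα).choose_spec)
  map_smul' c U := ((exists_weakDeriv_Lp (c • U) hα).choose_spec).Lp_ext hS
    ((exists_weakDeriv_Lp U hα).choose_spec.Lp_smul c)

lemma hasWeakDeriv_weakDerivLp {S : Set (E n)} (hS : IsOpen S) {m : ℕ} {α : Fin n → ℕ}
    (hα : ∑ i, α i ≤ m) (U : SobolevSpace 𝕜 m S) :
    HasWeakDeriv α S (U : Lp 𝕜 2 (volume.restrict S)) (weakDerivLp hS m α hα U) :=
  (exists_weakDeriv_Lp U hα).choose_spec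

lemma memLp_of_continuous {Q : Set (E n)} (hb : Bornology.IsBounded Q) {f : E n → 𝕜}
    (hf : Continuous f) : MemLp f 2 (volume.restrict Q) := by
  obtain ⟨C, hC⟩ := hb.isCompact_closure.exists_bound_of_continuousOn hf.continuousOn
  have h1 : MemLp f 2 (volume.restrict (closure Q)) := by
    have hfin' : IsFiniteMeasure (volume.restrict (closure Q)) := ⟨by
      rw [Measure.restrict_apply_univ]
      exact hb.isCompact_closure.measure_lt_top⟩
    refine MemLp.of_bound hf.aestronglyMeasurable C ?_
    filter_upwards [ae_restrict_mem isClosed_closure.measurableSet] with x hx using hC x hx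
  exact h1.mono_measure (Measure.restrict_mono subset_closure le_rfl)

/-- The inclusion of the polynomials in the Sobolev space of a bounded set. -/
noncomputable def polySobolev (𝕜 : Type*) [RCLike 𝕜] {Q : Set (E n)} (hb : Bornology.IsBounded Q)
    (m p : ℕ) : PolySpace 𝕜 n p →ₗ[𝕜] SobolevSpace 𝕜 m Q where
  toFun P := ⟨(memLp_of_continuous hb (contDiff_polyFun P.1).continuous).toLp (polyFun P.1),
    fun α _ => ⟨listDeriv (dirList α) (polyFun P.1),
      hasWeakDeriv_congr (MemLp.coeFn_toLp _).symm
        (hasWeakDeriv_of_contDiff Q α (contDiff_polyFun P.1)),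
      memLp_of_continuous hb (contDiff_listDeriv _ (contDiff_polyFun P.1)).continuous⟩⟩
  map_add' P P' := by
    ext1
    have h : polyFun (P + P').1 = polyFun P.1 + polyFun P'.1 := by
      ext x
      simp [polyFun]
    simp only [h]
    exact MemLp.toLp_add (memLp_of_continuous hb (contDiff_polyFun P.1).continuous)
      (memLp_of_continuous hb (contDiff_polyFun P'.1).continuous)
  map_smul' c P := by
    ext1
    have h : polyFun (c • P).1 = c • polyFun P.1 := by
      ext x
      simp [polyFun, MvPolynomial.smul_eval]
    simp only [h]
    exact MemLp.toLp_const_smul c (memLp_of_continuous hb (contDiff_polyFun P.1).continuous)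

lemma coeFn_polySobolev {Q : Set (E n)} (hb : Bornology.IsBounded Q) (m p : ℕ)
    (P : PolySpace 𝕜 n p) :
    ((polySobolev 𝕜 hb m p P : SobolevSpace 𝕜 m Q) : Lp 𝕜 2 (volume.restrict Q))
      =ᵐ[volume.restrict Q] polyFun P.1 :=
  MemLp.coeFn_toLp (memLp_of_continuous hb (contDiff_polyFun P.1).continuous)

/-- The vector of all weak derivatives of order at most `m`, those of order `j` scaled by
`1 / w j`. -/
noncomputable def derivVec {Q : Set (E n)} (hQ : IsOpen Q) (m : ℕ) (w : ℕ → ℝ) :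
    SobolevSpace 𝕜 m Q →ₗ[𝕜] PiLp 2 fun _ : multiIdx n m => Lp 𝕜 2 (volume.restrict Q) :=
  (WithLp.linearEquiv 2 𝕜 (multiIdx n m → Lp 𝕜 2 (volume.restrict Q))).symm.toLinearMap ∘ₗ
    LinearMap.pi fun α => (((w (∑ i, α.1 i))⁻¹ : ℝ) : 𝕜) •
      weakDerivLp hQ m α.1 (mem_multiIdx.1 α.2)

lemma derivVec_apply {Q : Set (E n)} (hQ : IsOpen Q) (m : ℕ) (w : ℕ → ℝ) (U : SobolevSpace 𝕜 m Q)
    (α : multiIdx n m) : derivVec hQ m w U α = (((w (∑ i, α.1 i))⁻¹ : ℝ) : 𝕜) •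
      weakDerivLp hQ m α.1 (mem_multiIdx.1 α.2) U := rfl

lemma norm_piLp_le_sum {ι : Type*} [Fintype ι] {G : Type*} [NormedAddCommGroup G]
    (x : PiLp 2 fun _ : ι => G) : ‖x‖ ≤ ∑ i, ‖x i‖ := by
  refine abs_le_of_sq_le_sq' ?_ (Finset.sum_nonneg fun i _ => norm_nonneg _) |>.2
  rw [PiLp.norm_sq_eq_of_L2]
  exact Finset.sum_sq_le_sq_sum_of_nonneg fun i _ => norm_nonneg _

end projection

/-! ### The error of the best approximation -/

section estimate

variable {n : ℕ} {𝕜 : Type*} [RCLike 𝕜]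

/-- The `L²(Q)` norms of classical derivatives of smooth functions and the seminorms `derivSq`. -/
lemma eLpNorm_listDeriv_sq_le (Q : Set (E n)) {α : Fin n → ℕ} {V : E n → 𝕜}
    (hV : ContDiff ℝ ∞ V) :
    eLpNorm (listDeriv (dirList α) V) 2 (volume.restrict Q) ^ 2 ≤ derivSq (∑ i, α i) V Q := by
  rw [eLpNorm_two_sq]
  refine lintegral_mono fun x => ?_
  have := enorm_listDeriv_le (dirList α) hV x
  rw [length_dirList] at this
  gcongr

lemma derivSq_le_sum_eLpNorm (Q : Set (E n)) (r : ℕ) {V : E n → 𝕜} (hV : ContDiff ℝ ∞ V) :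
    derivSq r V Q ≤ (n : ℝ≥0∞) ^ (3 * r) * ∑ α ∈ Finset.piAntidiag Finset.univ r,
      eLpNorm (listDeriv (dirList α) V) 2 (volume.restrict Q) ^ 2 := by
  have hm : ∀ α : Fin n → ℕ, Measurable fun x => ‖listDeriv (dirList α) V x‖ₑ ^ 2 := fun α =>
    (contDiff_listDeriv _ hV).continuous.measurable.enorm.pow_const 2
  have hnt : (n : ℝ≥0∞) ^ (3 * r) ≠ ⊤ := by finiteness
  simp only [eLpNorm_two_sq]
  rw [← lintegral_finsetSum _ fun α _ => hm α, ← lintegral_const_mul' _ _ hnt]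
  exact lintegral_mono fun x => enorm_iteratedFDeriv_sq_le hV x

/-- Transfer of an approximation estimate from smooth functions to the Sobolev space, up to an
arbitrarily small error. -/
lemma exists_poly_weakDerivLp_le (hn : 0 < n) {m p t : ℕ} {Q : Set (E n)} (hbody : IsConvexBody Q)
    {c : ℕ → ℝ≥0∞} (hsm : ∀ V : E n → 𝕜, ContDiff ℝ ∞ V → ∃ P ∈ PolySpace 𝕜 n p, ∀ j ≤ m,
      derivSq j (V - polyFun P) Q ≤ c j ^ 2 * ∑ r ∈ Finset.Icc t m, derivSq r V Q)
    (U : SobolevSpace 𝕜 m Q) {δ : ℝ≥0∞} (hδ0 : δ ≠ 0) :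
    ∃ P : PolySpace 𝕜 n p, ∀ α (hα : ∑ i, α i ≤ m),
      ‖weakDerivLp hbody.isOpen m α hα (U - polySobolev 𝕜 hbody.bounded m p P)‖ₑ ≤
        δ + c (∑ i, α i) * ((n : ℝ≥0∞) ^ (3 * m) * ((multiIdx n m).card *
          ((∑ r ∈ Finset.Icc t m, sobolevSeminorm r Q (U : Lp 𝕜 2 (volume.restrict Q))) +
            (m + 1 : ℕ) * δ))) := by
  have ho := hbody.isOpen
  have hgex : ∀ α : Fin n → ℕ, ∃ g : Lp 𝕜 2 (volume.restrict Q), ∀ h : ∑ i, α i ≤ m,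
      g = weakDerivLp ho m α h U := fun α => by
    by_cases h : ∑ i, α i ≤ m
    · exact ⟨weakDerivLp ho m α h U, fun _ => rfl⟩
    · exact ⟨0, fun h' => absurd h' h⟩
  choose g hgα using hgex
  have hgW : ∀ α (_ : ∑ i, α i ≤ m), HasWeakDeriv α Q (U : Lp 𝕜 2 (volume.restrict Q)) (g α) :=
    fun α h => by
      rw [hgα α h]
      exact hasWeakDeriv_weakDerivLp ho h U
  obtain ⟨V, hV, hVd⟩ := exists_smooth_approx hbody (multiIdx n m)
    (Lp.memLp (U : Lp 𝕜 2 (volume.restrict Q))) (g := fun α => g α)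
    (fun α _ => Lp.stronglyMeasurable _) (fun α _ => Lp.memLp _)
    (fun α hα => hgW α (mem_multiIdx.1 hα)) hδ0
  obtain ⟨P, hP, hPd⟩ := hsm V hV
  have hn1 : (1 : ℝ≥0∞) ≤ n := by exact_mod_cast hn
  have hgm : ∀ α, AEStronglyMeasurable (g α) (volume.restrict Q) := fun α =>
    Lp.aestronglyMeasurable _
  have hcm : ∀ (α : Fin n → ℕ) (W : E n → 𝕜), ContDiff ℝ ∞ W →
      AEStronglyMeasurable (listDeriv (dirList α) W) (volume.restrict Q) := fun α W hW =>
    (contDiff_listDeriv _ hW).continuous.aestronglyMeasurable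
  -- The seminorms of the smooth function are controlled by those of `U`.
  have hVr : ∀ r ∈ Finset.Icc t m, derivSq r V Q ≤ ((n : ℝ≥0∞) ^ (3 * m) * ((multiIdx n m).card *
      (sobolevSeminorm r Q (U : Lp 𝕜 2 (volume.restrict Q)) + δ))) ^ 2 := by
    intro r hr
    have hrm : r ≤ m := (Finset.mem_Icc.1 hr).2
    have h1 : ∀ α ∈ Finset.piAntidiag (Finset.univ : Finset (Fin n)) r,
        eLpNorm (listDeriv (dirList α) V) 2 (volume.restrict Q) ≤
          sobolevSeminorm r Q (U : Lp 𝕜 2 (volume.restrict Q)) + δ := by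
      intro α hα
      have hαr : ∑ i, α i = r := (Finset.mem_piAntidiag.1 hα).1
      have hαm : ∑ i, α i ≤ m := hαr.trans_le hrm
      have h2 : listDeriv (dirList α) V = g α - (g α - listDeriv (dirList α) V) := by
        rw [sub_sub_cancel]
      rw [h2]
      refine (eLpNorm_sub_le (hgm α) ((hgm α).sub (hcm α V hV)) (by norm_num)).trans ?_
      refine add_le_add ?_ (hVd α (mem_multiIdx.2 hαm))
      rw [← hαr]
      exact eLpNorm_le_sobolevSeminorm ho (hgW α hαm)
    calc derivSq r V Q ≤ (n : ℝ≥0∞) ^ (3 * r) * ∑ α ∈ Finset.piAntidiag Finset.univ r,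
          eLpNorm (listDeriv (dirList α) V) 2 (volume.restrict Q) ^ 2 :=
          derivSq_le_sum_eLpNorm Q r hV
      _ ≤ ((n : ℝ≥0∞) ^ (3 * m)) ^ 2 * (∑ α ∈ Finset.piAntidiag Finset.univ r,
          eLpNorm (listDeriv (dirList α) V) 2 (volume.restrict Q)) ^ 2 := by
          refine mul_le_mul' ?_ (Finset.sum_sq_le_sq_sum_of_nonneg fun _ _ => zero_le)
          rw [← pow_mul]
          exact pow_le_pow_right₀ hn1 (by omega)
      _ ≤ _ := by
          rw [← mul_pow]
          gcongr
          refine (Finset.sum_le_card_nsmul _ _ _ h1).trans ?_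
          rw [nsmul_eq_mul]
          gcongr
          exact piAntidiag_subset_multiIdx hrm
  have hVsum : ∑ r ∈ Finset.Icc t m, derivSq r V Q ≤ ((n : ℝ≥0∞) ^ (3 * m) *
      ((multiIdx n m).card * ((∑ r ∈ Finset.Icc t m, sobolevSeminorm r Q
        (U : Lp 𝕜 2 (volume.restrict Q))) + (m + 1 : ℕ) * δ))) ^ 2 := by
    refine (Finset.sum_le_sum hVr).trans ?_
    refine (Finset.sum_sq_le_sq_sum_of_nonneg fun _ _ => zero_le).trans ?_
    rw [← Finset.mul_sum, ← Finset.mul_sum, Finset.sum_add_distrib, Finset.sum_const,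
      nsmul_eq_mul]
    gcongr
    rw [Nat.card_Icc]
    omega
  refine ⟨⟨P, hP⟩, fun α hα => ?_⟩
  have h1 : (weakDerivLp ho m α hα (U - polySobolev 𝕜 hbody.bounded m p ⟨P, hP⟩) : E n → 𝕜)
      =ᵐ[volume.restrict Q]
      (g α - listDeriv (dirList α) V) + listDeriv (dirList α) (V - polyFun P) := by
    have h2 : (weakDerivLp ho m α hα (polySobolev 𝕜 hbody.bounded m p ⟨P, hP⟩) : E n → 𝕜)
        =ᵐ[volume.restrict Q] listDeriv (dirList α) (polyFun P) :=
      (hasWeakDeriv_congr (coeFn_polySobolev hbody.bounded m p ⟨P, hP⟩)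
        (hasWeakDeriv_weakDerivLp ho hα _)).ae_eq ho
          (hasWeakDeriv_of_contDiff Q α (contDiff_polyFun P))
    rw [map_sub, ← hgα α hα]
    filter_upwards [Lp.coeFn_sub (g α) (weakDerivLp ho m α hα
      (polySobolev 𝕜 hbody.bounded m p ⟨P, hP⟩)), h2] with x hx hx2
    rw [hx, listDeriv_sub _ hV (contDiff_polyFun P)]
    simp only [Pi.sub_apply, Pi.add_apply, hx2]
    ring
  rw [Lp.enorm_def, eLpNorm_congr_ae h1]
  refine (eLpNorm_add_le ((hgm α).sub (hcm α V hV))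
    (hcm α _ (hV.sub (contDiff_polyFun P))) (by norm_num)).trans ?_
  refine add_le_add (hVd α (mem_multiIdx.2 hα)) ?_
  refine (ENNReal.pow_le_pow_left_iff two_ne_zero).1 ?_
  refine (eLpNorm_listDeriv_sq_le Q (hV.sub (contDiff_polyFun P))).trans ?_
  refine (hPd _ hα).trans ?_
  rw [mul_pow]
  gcongr

lemma enorm_derivVec_apply {Q : Set (E n)} (hQ : IsOpen Q) {m : ℕ} {w : ℕ → ℝ} (hw : ∀ j, 0 < w j)
    (W : SobolevSpace 𝕜 m Q) (α : multiIdx n m) : ‖derivVec hQ m w W α‖ₑ =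
      ENNReal.ofReal (w (∑ i, α.1 i))⁻¹ * ‖weakDerivLp hQ m α.1 (mem_multiIdx.1 α.2) W‖ₑ := by
  rw [derivVec_apply, enorm_smul]
  congr 1
  rw [← ofReal_norm, RCLike.norm_ofReal, abs_of_pos (inv_pos.2 (hw _))]

lemma enorm_derivVec_le {Q : Set (E n)} (hQ : IsOpen Q) {m : ℕ} {w : ℕ → ℝ} (hw : ∀ j, 0 < w j)
    (W : SobolevSpace 𝕜 m Q) : ‖derivVec hQ m w W‖ₑ ≤ ∑ α : multiIdx n m,
      ENNReal.ofReal (w (∑ i, α.1 i))⁻¹ * ‖weakDerivLp hQ m α.1 (mem_multiIdx.1 α.2) W‖ₑ := by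
  simp only [← enorm_derivVec_apply hQ hw]
  rw [← ofReal_norm]
  refine (ENNReal.ofReal_le_ofReal (norm_piLp_le_sum _)).trans_eq ?_
  rw [ENNReal.ofReal_sum_of_nonneg fun _ _ => norm_nonneg _]
  simp only [ofReal_norm]

/-- The error of the best approximation in the weighted norm. It is at most the error of the
polynomial found for a smooth function close to `U`, and the distance `δ` of that function to `U` is
arbitrary, because the best approximation `P₀` does not depend on it. -/
lemma enorm_derivVec_best_approx_le (hn : 0 < n) {m p t : ℕ} {Q : Set (E n)}
    (hbody : IsConvexBody Q) {w : ℕ → ℝ} (hw : ∀ j, 0 < w j) {c : ℝ≥0∞} (hc : c ≠ ⊤)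
    (hsm : ∀ V : E n → 𝕜, ContDiff ℝ ∞ V → ∃ P ∈ PolySpace 𝕜 n p, ∀ j ≤ m,
      derivSq j (V - polyFun P) Q ≤ (c * ENNReal.ofReal (w j)) ^ 2 *
        ∑ r ∈ Finset.Icc t m, derivSq r V Q)
    (U : SobolevSpace 𝕜 m Q) {P₀ : PolySpace 𝕜 n p}
    (hP₀ : ∀ P, ‖derivVec hbody.isOpen m w (U - polySobolev 𝕜 hbody.bounded m p P₀)‖ ≤
      ‖derivVec hbody.isOpen m w (U - polySobolev 𝕜 hbody.bounded m p P)‖) :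
    ‖derivVec hbody.isOpen m w (U - polySobolev 𝕜 hbody.bounded m p P₀)‖ₑ ≤
      (multiIdx n m).card * (c * ((n : ℝ≥0∞) ^ (3 * m) * ((multiIdx n m).card *
        ∑ r ∈ Finset.Icc t m, sobolevSeminorm r Q (U : Lp 𝕜 2 (volume.restrict Q))))) := by
  generalize hR : ∑ r ∈ Finset.Icc t m, sobolevSeminorm r Q
    (U : Lp 𝕜 2 (volume.restrict Q)) = R
  generalize hN : (multiIdx n m).card = N
  have hδ : ∀ δ : ℝ≥0∞, δ ≠ 0 →
      ‖derivVec hbody.isOpen m w (U - polySobolev 𝕜 hbody.bounded m p P₀)‖ₑ ≤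
      N * (c * ((n : ℝ≥0∞) ^ (3 * m) * (N * R))) +
        (∑ α : multiIdx n m, ENNReal.ofReal (w (∑ i, α.1 i))⁻¹ +
          N * (c * ((n : ℝ≥0∞) ^ (3 * m) * (N * (m + 1 : ℕ))))) * δ := by
    intro δ hδ0
    obtain ⟨P, hP⟩ := exists_poly_weakDerivLp_le hn hbody hsm U hδ0
    rw [hR, hN] at hP
    have hle : ‖derivVec hbody.isOpen m w (U - polySobolev 𝕜 hbody.bounded m p P₀)‖ₑ ≤
        ‖derivVec hbody.isOpen m w (U - polySobolev 𝕜 hbody.bounded m p P)‖ₑ := by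
      rw [enorm_le_iff_norm_le]
      exact hP₀ P
    refine (hle.trans (enorm_derivVec_le hbody.isOpen hw _)).trans ?_
    calc _ ≤ ∑ α : multiIdx n m, (ENNReal.ofReal (w (∑ i, α.1 i))⁻¹ * δ +
          c * ((n : ℝ≥0∞) ^ (3 * m) * (N * (R + (m + 1 : ℕ) * δ)))) := by
          refine Finset.sum_le_sum fun α _ => ?_
          refine (mul_le_mul_right (hP α.1 (mem_multiIdx.1 α.2)) _).trans_eq ?_
          have hcancel :
              ENNReal.ofReal (w (∑ i, α.1 i))⁻¹ * ENNReal.ofReal (w (∑ i, α.1 i)) = 1 := by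
            rw [← ENNReal.ofReal_mul (inv_nonneg.2 (hw _).le), inv_mul_cancel₀ (hw _).ne',
              ENNReal.ofReal_one]
          rw [mul_add, mul_comm c, mul_assoc, ← mul_assoc _ (ENNReal.ofReal (w _)) _, hcancel,
            one_mul]
      _ = _ := by
          rw [Finset.sum_add_distrib, ← Finset.sum_mul, Finset.sum_const, Finset.card_univ,
            Fintype.card_coe, nsmul_eq_mul, hN]
          ring
  refine ENNReal.le_of_forall_pos_le_add fun ε hε _ => ?_
  set K : ℝ≥0∞ := ∑ α : multiIdx n m, ENNReal.ofReal (w (∑ i, α.1 i))⁻¹ +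
    N * (c * ((n : ℝ≥0∞) ^ (3 * m) * (N * (m + 1 : ℕ)))) with hK
  have hKt : K ≠ ⊤ := ENNReal.add_ne_top.2
    ⟨ENNReal.sum_ne_top.2 fun _ _ => ENNReal.ofReal_ne_top, by finiteness⟩
  refine (hδ (ε / K) (ENNReal.div_pos (by exact_mod_cast hε.ne') hKt).ne').trans ?_
  gcongr
  exact ENNReal.mul_div_le

/-- A linear operator from `W^m(Q)` to the polynomials whose error has weak derivatives of the
claimed size. -/
lemma exists_projection (hn : 0 < n) (h₀ : ℝ) (m : ℕ) :
    ∃ B : ℝ, 0 < B ∧ ∀ (p : ℕ) (Q : Set (E n)), IsOpenSimplex Q ∨ IsOpenCube Q →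
      Metric.diam Q ≤ h₀ → ∃ π : SobolevSpace 𝕜 m Q →ₗ[𝕜] PolySpace 𝕜 n p,
      ∀ (U : SobolevSpace 𝕜 m Q) (α : Fin n → ℕ), ∑ i, α i ≤ m → ∃ G : E n → 𝕜,
      HasWeakDeriv α Q (fun x => (U : Lp 𝕜 2 (volume.restrict Q)) x - polyFun (π U).1 x) G ∧
      eLpNorm G 2 (volume.restrict Q) ≤ ENNReal.ofReal (B * max 1 (shapeReg Q) ^ m *
        approxWeight (Metric.diam Q) p m (∑ i, α i)) *
          ∑ r ∈ Finset.Icc (min m (p + 1)) m, sobolevSeminorm r Q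
            (U : Lp 𝕜 2 (volume.restrict Q)) := by
  obtain ⟨B, hB, hsm⟩ := exists_poly_smooth (𝕜 := 𝕜) hn h₀ m
  have hN0 : 0 < (multiIdx n m).card := card_multiIdx_pos n m
  generalize hN : (multiIdx n m).card = N at hN0
  refine ⟨B * (N ^ 2 * n ^ (3 * m)), by positivity, fun p Q hQ hQh => ?_⟩
  have hbody := shape_isConvexBody hQ
  have hd := diam_pos hn hbody.bounded hbody.isOpen hbody.nonempty
  have hw0 : ∀ j, 0 < approxWeight (Metric.diam Q) p m j := approxWeight_pos hd p m
  have hsm' := hsm Q hQ hQh p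
  generalize approxWeight (Metric.diam Q) p m = w at hw0 hsm' ⊢
  have hσ0 : 0 < max 1 (shapeReg Q) ^ m := by positivity
  generalize max 1 (shapeReg Q) ^ m = σ at hσ0 hsm' ⊢
  obtain ⟨π, hπ⟩ := exists_linear_best_approx (derivVec (𝕜 := 𝕜) hbody.isOpen m w)
    (polySobolev 𝕜 hbody.bounded m p)
  refine ⟨π, fun U α hα => ?_⟩
  have hX := enorm_derivVec_best_approx_le (c := ENNReal.ofReal (B * σ)) hn hbody hw0
    ENNReal.ofReal_ne_top (t := min m (p + 1)) (fun V hV => by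
      obtain ⟨P, hP, hPd⟩ := hsm' V hV
      refine ⟨P, hP, fun j hj => ?_⟩
      rw [← ENNReal.ofReal_mul (by positivity)]
      exact hPd j hj) U (hπ U)
  rw [hN] at hX
  generalize hR : ∑ r ∈ Finset.Icc (min m (p + 1)) m, sobolevSeminorm r Q
    (U : Lp 𝕜 2 (volume.restrict Q)) = R at hX ⊢
  refine ⟨weakDerivLp hbody.isOpen m α hα (U - polySobolev 𝕜 hbody.bounded m p (π U)), ?_, ?_⟩
  · refine hasWeakDeriv_congr ?_ (hasWeakDeriv_weakDerivLp hbody.isOpen hα _)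
    filter_upwards [Lp.coeFn_sub (U : Lp 𝕜 2 (volume.restrict Q))
      (polySobolev 𝕜 hbody.bounded m p (π U) : SobolevSpace 𝕜 m Q),
      coeFn_polySobolev hbody.bounded m p (π U)] with x hx hx2
    rw [← hx2]
    exact hx
  · have h1 := enorm_derivVec_apply hbody.isOpen hw0 (U - polySobolev 𝕜 hbody.bounded m p (π U))
      ⟨α, mem_multiIdx.2 hα⟩
    have h2 := (PiLp.enorm_apply_le
      (derivVec hbody.isOpen m w (U - polySobolev 𝕜 hbody.bounded m p (π U)))
      ⟨α, mem_multiIdx.2 hα⟩).trans hX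
    rw [h1] at h2
    simp only at h2
    rw [← Lp.enorm_def]
    generalize ‖weakDerivLp hbody.isOpen m α hα
      (U - polySobolev 𝕜 hbody.bounded m p (π U))‖ₑ = d at h2 ⊢
    have hcancel : ENNReal.ofReal (w (∑ i, α i)) * ENNReal.ofReal (w (∑ i, α i))⁻¹ = 1 := by
      rw [← ENNReal.ofReal_mul (hw0 _).le, mul_inv_cancel₀ (hw0 _).ne', ENNReal.ofReal_one]
    calc d = ENNReal.ofReal (w (∑ i, α i)) * (ENNReal.ofReal (w (∑ i, α i))⁻¹ * d) := by
          rw [← mul_assoc, hcancel, one_mul]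
      _ ≤ _ := mul_le_mul_right h2 _
      _ = _ := by
          have := (hw0 (∑ i, α i)).le
          have e1 : B * ((N : ℝ) ^ 2 * (n : ℝ) ^ (3 * m)) * σ * w (∑ i, α i) =
              (B * σ) * (w (∑ i, α i) * ((N ^ 2 * n ^ (3 * m) : ℕ) : ℝ)) := by
            push_cast
            ring
          rw [e1, ENNReal.ofReal_mul (p := B * σ) (by positivity), ENNReal.ofReal_mul this,
            ENNReal.ofReal_natCast]
          push_cast
          ring

lemma approxWeight_le {h h₀ : ℝ} (hh : 0 < h) (hh₀ : h ≤ h₀) (p : ℕ) {m i j : ℕ} (hij : i ≤ j)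
    (hjm : j ≤ m) : approxWeight h p m i ≤ max 1 h₀ ^ m * approxWeight h p m j := by
  have h1 : h ^ ((min m (p + 1) : ℕ) - (i : ℤ)) =
      h ^ (j - i) * h ^ ((min m (p + 1) : ℕ) - (j : ℤ)) := by
    rw [← zpow_natCast h (j - i), ← zpow_add₀ hh.ne']
    congr 1
    omega
  have h2 : ((p : ℝ) + 1) ^ (m - j) ≤ ((p : ℝ) + 1) ^ (m - i) :=
    pow_le_pow_right₀ (by linarith [(Nat.cast_nonneg p : (0 : ℝ) ≤ p)]) (by omega)
  have h3 : h ^ (j - i) ≤ max 1 h₀ ^ m :=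
    (pow_le_pow_left₀ hh.le (hh₀.trans (le_max_right _ _)) _).trans
      (pow_le_pow_right₀ (le_max_left _ _) (by omega))
  unfold approxWeight
  rw [h1, ← mul_div_assoc]
  gcongr

/-- Summation of Sobolev norms over disjoint subsets: a weak derivative on `Q` restricts to a weak
derivative on each of them. -/
lemma tsum_sobolevNorm_sq_le {Q : Set (E n)} {ι : Type*} [Countable ι]
    (K : ι → Set (E n)) (hKo : ∀ k, IsOpen (K k)) (hKQ : ∀ k, K k ⊆ Q)
    (hKd : Pairwise (Function.onFun Disjoint K)) (j : ℕ) {f : ι → E n → 𝕜} {e : E n → 𝕜}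
    (hf : ∀ k, e =ᵐ[volume.restrict (K k)] f k) {D : (Fin n → ℕ) → E n → 𝕜}
    (hD : ∀ α, ∑ i, α i ≤ j → HasWeakDeriv α Q e (D α)) :
    ∑' k, sobolevNorm j (K k) (f k) ^ 2 ≤ ∑ i ∈ Finset.range (j + 1),
      ∑ α ∈ Finset.piAntidiag Finset.univ i, eLpNorm (D α) 2 (volume.restrict Q) ^ 2 := by
  have h1 : ∀ k, sobolevNorm j (K k) (f k) ^ 2 ≤ ∑ i ∈ Finset.range (j + 1),
      ∑ α ∈ Finset.piAntidiag Finset.univ i, ∫⁻ x in K k, ‖D α x‖ₑ ^ 2 := by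
    intro k
    rw [sobolevNorm_sq]
    refine Finset.sum_le_sum fun i hi => ?_
    rw [sobolevSeminorm_sq]
    refine Finset.sum_le_sum fun α hα => ?_
    rw [← eLpNorm_two_sq]
    gcongr
    refine iInf₂_le (D α) (hasWeakDeriv_congr (hf k) ((hD α ?_).mono (hKQ k)))
    rw [(Finset.mem_piAntidiag.1 hα).1]
    exact Nat.lt_succ_iff.1 (Finset.mem_range.1 hi)
  refine (ENNReal.tsum_le_tsum h1).trans ?_
  rw [Summable.tsum_finsetSum fun _ _ => ENNReal.summable]
  refine Finset.sum_le_sum fun i _ => ?_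
  rw [Summable.tsum_finsetSum fun _ _ => ENNReal.summable]
  refine Finset.sum_le_sum fun α _ => ?_
  rw [← lintegral_iUnion (fun k => (hKo k).measurableSet) hKd, eLpNorm_two_sq]
  exact lintegral_mono_set (iUnion_subset hKQ)

end estimate

end CoverApprox

theorem lemma2p3 {𝕜 : Type*} [RCLike 𝕜] (n : ℕ) (hn : 1 ≤ n) (h₀ : ℝ) (hh₀ : 0 < h₀) :
    ∃ (C : ℕ → ℝ → ℝ)
      (π : ∀ (p m : ℕ) (Q : Set (CoverApprox.E n)),
        CoverApprox.SobolevSpace 𝕜 m Q →ₗ[𝕜] CoverApprox.PolySpace 𝕜 n p),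
      (∀ m σ, 0 < C m σ) ∧ (∀ m, Monotone (C m)) ∧
      ∀ (Ω : Set (CoverApprox.E n)), IsOpen Ω → Ω.Nonempty →
      ∀ (T Tc : Set (Set (CoverApprox.E n))), CoverApprox.IsMesh Ω T → CoverApprox.IsCovering T Tc →
      ∀ κ : T → Tc, (∀ K : T, (K : Set (CoverApprox.E n)) ⊆ κ K) →
      (∀ Q ∈ Tc, Metric.diam Q ≤ h₀) →
      ∀ (u : Lp 𝕜 2 (volume.restrict Ω)) (m : Tc → ℕ)
        (U : ∀ Q : Tc, CoverApprox.SobolevSpace 𝕜 (m Q) (Q : Set (CoverApprox.E n))),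
      (∀ Q : Tc, ∀ K ∈ κ ⁻¹' {Q},
        ((U Q : Lp 𝕜 2 (volume.restrict (Q : Set (CoverApprox.E n)))) : CoverApprox.E n → 𝕜)
          =ᵐ[volume.restrict (K : Set (CoverApprox.E n))] u) →
      ∀ (Q : Tc) (p j : ℕ), j ≤ m Q →
        (∑' K : κ ⁻¹' {Q}, CoverApprox.sobolevNorm j (K : Set (CoverApprox.E n))
            (fun x => u x - CoverApprox.polyFun (π p (m Q) Q (U Q)).1 x) ^ 2) ^ (1 / 2 : ℝ)
          ≤ ENNReal.ofReal (C (m Q) (CoverApprox.shapeReg (Q : Set (CoverApprox.E n))) *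
              (Metric.diam (Q : Set (CoverApprox.E n)) ^ ((min (m Q) (p + 1) : ℕ) - (j : ℤ)) /
                ((p : ℝ) + 1) ^ (m Q - j))) *
            ∑ r ∈ Finset.Icc (min (m Q) (p + 1)) (m Q), CoverApprox.sobolevSeminorm r
              (Q : Set (CoverApprox.E n))
              (U Q : Lp 𝕜 2 (volume.restrict (Q : Set (CoverApprox.E n)))) := by
  classical
  -- Only simplices and cubes of diameter at most `h₀` matter for the operators; on all other sets
  -- they are set to zero. The factor `#multiIdx` accounts for the summation over `|α| ≤ j`.
  choose B hB hproj using fun m => CoverApprox.exists_projection (𝕜 := 𝕜) (n := n) hn h₀ m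
  refine ⟨fun m σ => (CoverApprox.multiIdx n m).card * (max 1 h₀ ^ m * (B m * max 1 σ ^ m)),
    fun p m Q => if h : (CoverApprox.IsOpenSimplex Q ∨ CoverApprox.IsOpenCube Q) ∧
      Metric.diam Q ≤ h₀ then (hproj m p Q h.1 h.2).choose else 0,
    fun m σ => ?_, fun m a b hab => ?_, ?_⟩
  · have h1 : (0 : ℝ) < (CoverApprox.multiIdx n m).card := by
      exact_mod_cast CoverApprox.card_multiIdx_pos n m
    have := hB m
    positivity
  · have := (hB m).le
    simp only
    gcongr
  intro Ω _ _ T Tc hT hTc κ hκ hdiam u m U hU Q p j hj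
  have hQ : (CoverApprox.IsOpenSimplex (Q : Set (CoverApprox.E n)) ∨
      CoverApprox.IsOpenCube (Q : Set (CoverApprox.E n))) ∧
      Metric.diam (Q : Set (CoverApprox.E n)) ≤ h₀ := ⟨hTc.shape Q Q.2, hdiam Q Q.2⟩
  have hbody := CoverApprox.shape_isConvexBody hQ.1
  have hd := CoverApprox.diam_pos hn hbody.bounded hbody.isOpen hbody.nonempty
  simp only [dif_pos hQ]
  have hπ := (hproj (m Q) p Q hQ.1 hQ.2).choose_spec (U Q)
  generalize (hproj (m Q) p Q hQ.1 hQ.2).choose (U Q) = P at hπ ⊢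
  set R := ∑ r ∈ Finset.Icc (min (m Q) (p + 1)) (m Q), CoverApprox.sobolevSeminorm r
    (Q : Set (CoverApprox.E n))
    (U Q : Lp 𝕜 2 (volume.restrict (Q : Set (CoverApprox.E n)))) with hR
  set σ := CoverApprox.shapeReg (Q : Set (CoverApprox.E n)) with hσ
  set h := Metric.diam (Q : Set (CoverApprox.E n)) with hh
  have hw : ∀ i : ℕ, h ^ ((min (m Q) (p + 1) : ℕ) - (i : ℤ)) / ((p : ℝ) + 1) ^ (m Q - i) =
      CoverApprox.approxWeight h p (m Q) i := fun i => rfl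
  rw [hw]
  have hN0 := CoverApprox.card_multiIdx_pos n (m Q)
  generalize hN : (CoverApprox.multiIdx n (m Q)).card = N at hN0 ⊢
  choose! D hD hDn using hπ
  have hcount : Countable (κ ⁻¹' {Q}) := by
    have : Countable T := hT.countable
    infer_instance
  have hsum := CoverApprox.tsum_sobolevNorm_sq_le (Q := (Q : Set (CoverApprox.E n)))
    (fun K : κ ⁻¹' {Q} => ((K : T) : Set (CoverApprox.E n)))
    (fun K => hT.isOpen _ K.1.2)
    (fun K => by
      have h1 := hκ K.1
      have h2 : κ K.1 = Q := K.2
      rwa [h2] at h1)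
    (fun K K' hne => hT.disjoint K.1.2 K'.1.2 fun h => hne (Subtype.ext (Subtype.ext h))) j
    (f := fun _ x => u x - CoverApprox.polyFun P.1 x)
    (e := fun x => (U Q : Lp 𝕜 2 (volume.restrict (Q : Set (CoverApprox.E n)))) x -
      CoverApprox.polyFun P.1 x) (fun K => by
      filter_upwards [hU Q K.1 K.2] with x hx
      rw [hx]) (D := D) (fun α hα => hD α (hα.trans hj))
  set A : ℝ≥0∞ := ENNReal.ofReal (max 1 h₀ ^ m Q * (B (m Q) * max 1 σ ^ m Q) *
    CoverApprox.approxWeight h p (m Q) j) * R with hA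
  have hDA : ∀ i ∈ Finset.range (j + 1), ∀ α ∈ Finset.piAntidiag Finset.univ i,
      eLpNorm (D α) 2 (volume.restrict (Q : Set (CoverApprox.E n))) ≤ A := by
    intro i hi α hα
    have hij : i ≤ j := Nat.lt_succ_iff.1 (Finset.mem_range.1 hi)
    have hαi : ∑ k, α k = i := (Finset.mem_piAntidiag.1 hα).1
    refine (hDn α (by omega)).trans ?_
    rw [hA, hαi]
    refine mul_le_mul_left (ENNReal.ofReal_le_ofReal ?_) _
    have h1 := CoverApprox.approxWeight_le hd hQ.2 p hij hj
    have h2 := (hB (m Q)).le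
    calc _ ≤ B (m Q) * max 1 σ ^ m Q *
          (max 1 h₀ ^ m Q * CoverApprox.approxWeight h p (m Q) j) := by gcongr
      _ = _ := by ring
  rw [one_div, ENNReal.rpow_inv_le_iff (by norm_num)]
  refine hsum.trans ?_
  have hdisj : ∑ i ∈ Finset.range (j + 1), ∑ α ∈ Finset.piAntidiag Finset.univ i,
      eLpNorm (D α) 2 (volume.restrict (Q : Set (CoverApprox.E n))) ^ 2 =
      ∑ α ∈ CoverApprox.multiIdx n j,
        eLpNorm (D α) 2 (volume.restrict (Q : Set (CoverApprox.E n))) ^ 2 := by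
    rw [CoverApprox.multiIdx, Finset.sum_biUnion]
    intro i _ i' _ hne
    refine Finset.disjoint_left.2 fun α hα hα' => hne ?_
    exact (Finset.mem_piAntidiag.1 hα).1.symm.trans (Finset.mem_piAntidiag.1 hα').1
  rw [hdisj]
  have hsub : CoverApprox.multiIdx n j ⊆ CoverApprox.multiIdx n (m Q) := fun α hα =>
    CoverApprox.mem_multiIdx.2 ((CoverApprox.mem_multiIdx.1 hα).trans hj)
  have hDA' : ∀ α ∈ CoverApprox.multiIdx n j,
      eLpNorm (D α) 2 (volume.restrict (Q : Set (CoverApprox.E n))) ^ 2 ≤ A ^ 2 := by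
    intro α hα
    have := hDA (∑ i, α i) (Finset.mem_range.2 (Nat.lt_succ_of_le (CoverApprox.mem_multiIdx.1 hα)))
      α (by simp)
    gcongr
  refine (Finset.sum_le_card_nsmul _ _ _ hDA').trans ?_
  rw [nsmul_eq_mul]
  have hN1 : (1 : ℝ≥0∞) ≤ N := by exact_mod_cast hN0
  have hle : (CoverApprox.multiIdx n j).card ≤ N := hN ▸ Finset.card_le_card hsub
  calc ((CoverApprox.multiIdx n j).card : ℝ≥0∞) * A ^ 2
      ≤ (N * N) * A ^ 2 := by
        gcongr
        calc ((CoverApprox.multiIdx n j).card : ℝ≥0∞) ≤ N := by exact_mod_cast hle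
          _ = 1 * N := (one_mul _).symm
          _ ≤ _ := mul_le_mul_left hN1 _
    _ = (N * A) ^ 2 := by ring
    _ = _ := by
        rw [← ENNReal.rpow_natCast, Nat.cast_ofNat]
        congr 1
        rw [hA, mul_assoc (N : ℝ), ENNReal.ofReal_mul (Nat.cast_nonneg _), ENNReal.ofReal_natCast]
        exact (mul_assoc _ _ _).symm
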